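/- Let $\Bbbk$ be a field. A dg algebra is a $\mathbb Z$-graded associative unital $\Bbbk$-algebra with a differential $d$ of degree $+1$ that is a graded derivation with $d^2=0$ (equivalently, a dg category with one object). For dg algebras $C,D$, the twisted tensor product $C\widetilde\otimes D$ is the dg algebra generated by the symbols $1\otimes g$ and $\varepsilon(f;g_1,\dots,g_n)$ ($f\in C$, $g,g_i\in D$ homogeneous, $n\ge 0$; $\varepsilon(f;\,)=f\otimes 1$), of degrees $\deg g$ and $\deg f+\sum_i(\deg g_i-1)$, subject to: all symbols are linear in each argument; $f\mapsto f\otimes 1$ and $g\mapsto 1\otimes g$ are unital algebra maps; $\varepsilon(f;g_1,\dots,g_n)=0$ if some $g_i=1$, and $\varepsilon(1;g_1,\dots,g_n)=0$ for $n\ge 1$; and $$\varepsilon(f_2f_1;g_1,\dots,g_N)=\sum_{m=0}^N(-1)^{|f_1|\sum_{j>m}(|g_j|+1)}\,\varepsilon(f_2;g_{m+1},\dots,g_N)\,\varepsilon(f_1;g_1,\dots,g_m).$$ Its differential satisfies $d(1\otimes g)=1\otimes dg$, and on $\varepsilon(f;g_1,\dots,g_n)$ it is the signed sum of $\varepsilon(df;g_1,\dots,g_n)$,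 the $\varepsilon(f;\dots,dg_i,\dots)$, the $\varepsilon(f;\dots,g_{i+1}g_i,\dots)$, $(1\otimes g_n)\,\varepsilon(f;g_1,\dots,g_{n-1})$ and $\varepsilon(f;g_2,\dots,g_n)\,(1\otimes g_1)$, with Koszul signs. It is functorial in $C$ and $D$. For a dg algebra map $F\colon D\to E$ let $\mathrm{Hoch}(F)=[D,E](F,F)$ be the reduced (normalized) cohomological Hochschild complex of $D$ with coefficients in $E$ (a $D$-bimodule through $F$), a dg algebra with the cup product. A dg algebra map $\ell\colon C\widetilde\otimes D\to E$ with $\ell(1\otimes y)=F(y)$ for all $y\in D$ has the adjoint dg algebra map $C\to\mathrm{Hoch}(F)$, $c\mapsto\big((g_1,\dots,g_n)\mapsto \ell(\varepsilon(c;g_1,\dots,g_n))\big)_{n\ge 0}$; this is a bijection. There is a natural associator $\alpha\colon (C\widetilde\otimes D)\widetilde\otimes E\to C\widetilde\otimes(D\widetilde\otimes E)$ with $\alpha(1\otimes h)=1\otimes(1\otimes h)$, $\alpha(\varepsilon(1\otimes g;h_1,\dots,h_N))=1\otimes\varepsilon(g;h_1,\dots,h_N)$ and $$\alpha\big(\varepsilon(\varepsilon(f;g_1,\dots,g_n);h_1,\dots,h_N)\big)=\sum_{0\le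 i_1\le j_1\le\dots\le i_n\le j_n\le N}\pm\,\varepsilon\big(f;h_1,\dots,h_{i_1},\varepsilon(g_1;h_{i_1+1},\dots,h_{j_1}),h_{j_1+1},\dots,\varepsilon(g_n;h_{i_n+1},\dots,h_{j_n}),h_{j_n+1},\dots,h_N\big)$$ with Koszul signs (here $h_i$ stands for $1\otimes h_i$). A $\widetilde\otimes$-monoid is a dg algebra $B$ with a dg algebra map $m\colon B\widetilde\otimes B\to B$ such that $m\circ(m\widetilde\otimes\mathrm{id})=m\circ(\mathrm{id}\widetilde\otimes m)\circ\alpha$ and $m(1\otimes b)=m(b\otimes 1)=b$ for all $b\in B$. A dg algebra map $\ell\colon B\widetilde\otimes A\to A$ is an action of the monoid $B$ if $\ell\circ(m\widetilde\otimes\mathrm{id})=\ell\circ(\mathrm{id}\widetilde\otimes\ell)\circ\alpha$ and $\ell(1\otimes a)=a$ for all $a\in A$. For a dg algebra $A$ write $\mathrm{Hoch}(A)=\mathrm{Hoch}(\mathrm{id}_A)=[A,A](\mathrm{id},\mathrm{id})$, and let $e\colon\mathrm{Hoch}(A)\widetilde\otimes A\to A$ be the map adjoint to $\mathrm{id}_{\mathrm{Hoch}(A)}$.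 The $\widetilde\otimes$-monoid product $M\colon\mathrm{Hoch}(A)\widetilde\otimes\mathrm{Hoch}(A)\to\mathrm{Hoch}(A)$ is the adjoint of $$(\mathrm{Hoch}(A)\widetilde\otimes\mathrm{Hoch}(A))\widetilde\otimes A\xrightarrow{\ \alpha\ }\mathrm{Hoch}(A)\widetilde\otimes(\mathrm{Hoch}(A)\widetilde\otimes A)\xrightarrow{\ \mathrm{id}\widetilde\otimes e\ }\mathrm{Hoch}(A)\widetilde\otimes A\xrightarrow{\ e\ }A ,$$ and its unit is $1\in\mathrm{Hoch}(A)$. A dg algebra map $\varphi\colon B\to\mathrm{Hoch}(A)$ is a map of $\widetilde\otimes$-monoids if $\varphi\circ m=M\circ(\varphi\widetilde\otimes\varphi)$ and $\varphi(1)=1$. **Corollary 2.5.** Let $B$ be a dg algebra over $\Bbbk$ with the structure $m$ of a $\widetilde\otimes$-monoid, let $A$ be a dg algebra over $\Bbbk$, and let $\ell\colon B\widetilde\otimes A\to A$ be a dg algebra map such that $\ell(1\otimes a)=a$ for every $a\in A$. Then $\ell$ is an action of the monoid $B$ on $A$ if and only if the adjoint map $B\to[A,A](\mathrm{id},\mathrm{id})=\mathrm{Hoch}(A)$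 is a map of $\widetilde\otimes$-monoids. -/

import Mathlib

open DirectSum

set_option linter.unusedSectionVars false
set_option linter.unusedSimpArgs false
set_option linter.unusedVariables false

noncomputable section

namespace TwDG

/-- A `ℤ`-graded associative unital algebra over `k`, with internal grading `gr`. -/
class GrAlgebra (k : Type*) (A : Type*) [Field k] [Ring A] [Algebra k A] where
  gr : ℤ → Submodule k A
  graded : GradedAlgebra gr

attribute [reducible, instance] GrAlgebra.graded

/-- The degree `n` part of a graded algebra. -/
abbrev gr (k : Type*) {A : Type*} [Field k] [Ring A] [Algebra k A] [GrAlgebra k A] (n : ℤ) :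
    Submodule k A := GrAlgebra.gr n

/-- The sign `(-1)^n` as a scalar. -/
def sg (k : Type*) [Field k] (n : ℤ) : k := ((n.negOnePow : ℤ) : k)

/-- A dg algebra over `k` with differential of degree `+1`. -/
class DGAlgebra (k : Type*) (A : Type*) [Field k] [Ring A] [Algebra k A]
    extends GrAlgebra k A where
  d : A →ₗ[k] A
  d_mem : ∀ (n : ℤ) (x : A), x ∈ gr n → d x ∈ gr (n + 1)
  d_mul : ∀ (n : ℤ) (x y : A), x ∈ gr n → d (x * y) = d x * y + sg k n • (x * d y)
  d_d : ∀ x : A, d (d x) = 0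

/-- The differential of a dg algebra. -/
abbrev dif (k : Type*) {A : Type*} [Field k] [Ring A] [Algebra k A] [DGAlgebra k A] : A →ₗ[k] A :=
  DGAlgebra.d

section Signs

variable (k : Type*) [Field k]

theorem sg_add (m n : ℤ) : sg k (m + n) = sg k m * sg k n := by
  simp [sg, Int.negOnePow_add]

@[simp] theorem sg_zero : sg k 0 = 1 := by simp [sg]

@[simp] theorem sg_one : sg k 1 = -1 := by simp [sg]

@[simp] theorem sg_neg (n : ℤ) : sg k (-n) = sg k n := by simp [sg]

theorem sg_sub (m n : ℤ) : sg k (m - n) = sg k m * sg k n := by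
  rw [sub_eq_add_neg, sg_add, sg_neg]

@[simp] theorem sg_mul_self (n : ℤ) : sg k n * sg k n = 1 := by
  rw [← sg_add]
  simp [sg, Int.negOnePow_even (n + n) ⟨n, rfl⟩]

@[simp] theorem sg_sq (n : ℤ) : sg k (n * n) = sg k n := by
  simp [sg]

end Signs

section Koszul

variable (k : Type*) {A : Type*} [Field k] [Ring A] [Algebra k A] [GrAlgebra k A]

/-- The linear map that multiplies an element of degree `p` by `(-1)^(n p)`. -/
def sgnLin (n : ℤ) : A →ₗ[k] A :=
  (DirectSum.toModule k ℤ A (fun p => sg k (n * p) • (gr k (A := A) p).subtype)) ∘ₗ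
    (decomposeLinearEquiv (GrAlgebra.gr (k := k) (A := A))).toLinearMap

theorem sgnLin_of_mem (n : ℤ) {p : ℤ} {x : A} (hx : x ∈ gr k p) :
    sgnLin k n x = sg k (n * p) • x := by
  simp only [sgnLin, LinearMap.comp_apply, LinearEquiv.coe_coe, decomposeLinearEquiv_apply]
  rw [decompose_of_mem _ hx, ← DirectSum.lof_eq_of k, DirectSum.toModule_lof]
  simp

theorem gr_induction {P : A → Prop} (h : ∀ (p : ℤ) (x : A), x ∈ gr k p → P x)
    (hadd : ∀ x y, P x → P y → P (x + y)) (x : A) : P x :=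
  Decomposition.inductionOn (GrAlgebra.gr (k := k) (A := A)) (h 0 0 (zero_mem _))
    (fun {i} m => h i m m.2) (fun m m' => hadd m m') x

theorem gr_mul {p q : ℤ} {x y : A} (hx : x ∈ gr k p) (hy : y ∈ gr k q) : x * y ∈ gr k (p + q) :=
  SetLike.mul_mem_graded hx hy

theorem gr_one : (1 : A) ∈ gr k 0 := SetLike.one_mem_graded _

/-- The algebra automorphism that multiplies an element of degree `p` by `(-1)^(n p)`. -/
def sgn (n : ℤ) : A →ₐ[k] A :=
  AlgHom.ofLinearMap (sgnLin k n) (by rw [sgnLin_of_mem k n (gr_one k)]; simp) (by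
    intro x y
    refine gr_induction k
      (P := fun x => sgnLin k n (x * y) = sgnLin k n x * sgnLin k n y) (fun p x hx => ?_)
      (fun x x' hx hx' => by rw [add_mul, map_add, map_add, add_mul, hx, hx']) x
    refine gr_induction k
      (P := fun y => sgnLin k n (x * y) = sgnLin k n x * sgnLin k n y) (fun q y hy => ?_)
      (fun y y' hy hy' => by rw [mul_add, map_add, map_add, mul_add, hy, hy']) y
    rw [sgnLin_of_mem k n (gr_mul k hx hy), sgnLin_of_mem k n hx, sgnLin_of_mem k n hy,
      mul_add, sg_add, smul_mul_smul_comm])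

theorem sgn_of_mem (n : ℤ) {p : ℤ} {x : A} (hx : x ∈ gr k p) :
    sgn k n x = sg k (n * p) • x := sgnLin_of_mem k n hx

theorem sgn_add (m n : ℤ) (x : A) : sgn k (m + n) x = sgn k m (sgn k n x) := by
  refine gr_induction k (P := fun x => sgn k (m + n) x = sgn k m (sgn k n x))
    (fun p x hx => ?_) (fun x x' hx hx' => by simp only [map_add, hx, hx']) x
  rw [sgn_of_mem k _ hx, sgn_of_mem k _ hx, map_smul, sgn_of_mem k _ hx, add_mul, sg_add,
    smul_smul, mul_comm]

@[simp] theorem sgn_zero (x : A) : sgn k 0 x = x := by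
  refine gr_induction k (P := fun x => sgn k 0 x = x)
    (fun p x hx => ?_) (fun x x' hx hx' => by simp only [map_add, hx, hx']) x
  simp [sgn_of_mem k _ hx]

theorem sgn_comm (m n : ℤ) (x : A) : sgn k m (sgn k n x) = sgn k n (sgn k m x) := by
  rw [← sgn_add, ← sgn_add, add_comm]

@[simp] theorem sgn_sgn (n : ℤ) (x : A) : sgn k n (sgn k n x) = x := by
  refine gr_induction k (P := fun x => sgn k n (sgn k n x) = x)
    (fun p x hx => ?_) (fun x x' hx hx' => by simp only [map_add, hx, hx']) x
  rw [sgn_of_mem k _ hx, map_smul, sgn_of_mem k _ hx, smul_smul]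
  simp

theorem sgn_neg (n : ℤ) (x : A) : sgn k (-n) x = sgn k n x := by
  conv_lhs => rw [← sgn_sgn k n x]
  rw [← sgn_add k (-n), neg_add_cancel, sgn_zero]

end Koszul

/-- Homogeneous elements of a graded algebra. -/
@[ext]
structure Hm (k A : Type*) [Field k] [Ring A] [Algebra k A] [GrAlgebra k A] where
  deg : ℤ
  val : A
  mem : val ∈ gr k deg

namespace Hm

variable {k A : Type*} [Field k] [Ring A] [Algebra k A]

section
variable [GrAlgebra k A]

/-- The unit, in degree `0`. -/
def one : Hm k A := ⟨0, 1, gr_one k⟩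

/-- The product of homogeneous elements. -/
def mul (x y : Hm k A) : Hm k A := ⟨x.deg + y.deg, x.val * y.val, gr_mul k x.mem y.mem⟩

/-- The degree in the suspension. -/
def sdeg (x : Hm k A) : ℤ := x.deg - 1

end

/-- The differential of a homogeneous element. -/
def d [DGAlgebra k A] (x : Hm k A) : Hm k A :=
  ⟨x.deg + 1, dif k x.val, DGAlgebra.d_mem _ _ x.mem⟩

end Hm

/-- The total degree of a word of the bar construction: the sum of all `deg h - 1`. -/
def wdeg {k A : Type*} [Field k] [Ring A] [Algebra k A] [GrAlgebra k A] (L : List (Hm k A)) : ℤ :=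
  (L.map Hm.sdeg).sum

/-- Functions on words of homogeneous elements of `D`, with values in `E`. -/
def Conv (k D E : Type*) [Field k] [Ring D] [Algebra k D] [GrAlgebra k D] :=
  List (Hm k D) → E

namespace Conv

variable {k D E : Type*} [Field k] [Ring D] [Algebra k D] [GrAlgebra k D]
variable [Ring E] [Algebra k E]

instance : AddCommGroup (Conv k D E) := inferInstanceAs (AddCommGroup (List (Hm k D) → E))
instance : Module k (Conv k D E) := inferInstanceAs (Module k (List (Hm k D) → E))

@[ext] theorem ext {φ ψ : Conv k D E} (h : ∀ L, φ L = ψ L) : φ = ψ := funext h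

@[simp] theorem add_apply (φ ψ : Conv k D E) (L : List (Hm k D)) : (φ + ψ) L = φ L + ψ L := rfl
@[simp] theorem sub_apply (φ ψ : Conv k D E) (L : List (Hm k D)) : (φ - ψ) L = φ L - ψ L := rfl
@[simp] theorem neg_apply (φ : Conv k D E) (L : List (Hm k D)) : (-φ) L = -φ L := rfl
@[simp] theorem zero_apply (L : List (Hm k D)) : (0 : Conv k D E) L = 0 := rfl
@[simp] theorem smul_apply (c : k) (φ : Conv k D E) (L : List (Hm k D)) : (c • φ) L = c • φ L := rfl

variable [GrAlgebra k E]

/-- The cup product. If `ψ` is homogeneous of degree `|ψ|`, i.e. `ψ L₂` has degree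
`|ψ| + wdeg L₂`, it is `(φ ∪ ψ) L = ∑ (-1)^(|ψ| * wdeg L₁) φ L₁ * ψ L₂` over all ways to cut the
word `L` into a concatenation `L₁ ++ L₂`. -/
def cup (φ ψ : Conv k D E) : Conv k D E := fun L =>
  ∑ i ∈ Finset.range (L.length + 1),
    sg k (wdeg (L.take i) * wdeg (L.drop i)) •
      (φ (L.take i) * sgn k (wdeg (L.take i)) (ψ (L.drop i)))

instance : Mul (Conv k D E) := ⟨cup⟩

/-- The unit: `1` on the empty word and `0` on all other words. -/
instance : One (Conv k D E) := ⟨fun L => if L.isEmpty then 1 else 0⟩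

/-- The automorphism `φ ↦ (-1)^(n |φ|) φ`. -/
def tw (n : ℤ) : Conv k D E →ₗ[k] Conv k D E where
  toFun φ := fun L => sg k (n * wdeg L) • sgn k n (φ L)
  map_add' φ ψ := funext fun L => by
    simp only [add_apply, map_add, smul_add]
    rfl
  map_smul' c φ := funext fun L => by
    simp only [smul_apply, map_smul, RingHom.id_apply, smul_comm _ c]
    rfl

/-- Insertion of a first letter. -/
def cons (h : Hm k D) : Conv k D E →ₗ[k] Conv k D E where
  toFun φ := fun L => φ (h :: L)
  map_add' _ _ := rfl
  map_smul' _ _ := rfl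

end Conv

@[simp] theorem wdeg_nil {k A : Type*} [Field k] [Ring A] [Algebra k A] [GrAlgebra k A] :
    wdeg ([] : List (Hm k A)) = 0 := rfl

@[simp] theorem wdeg_cons {k A : Type*} [Field k] [Ring A] [Algebra k A] [GrAlgebra k A]
    (h : Hm k A) (L : List (Hm k A)) : wdeg (h :: L) = h.sdeg + wdeg L := by simp [wdeg]

@[simp] theorem wdeg_append {k A : Type*} [Field k] [Ring A] [Algebra k A] [GrAlgebra k A]
    (L M : List (Hm k A)) : wdeg (L ++ M) = wdeg L + wdeg M := by simp [wdeg]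

namespace Conv

variable {k D E : Type*} [Field k] [Ring D] [Algebra k D] [GrAlgebra k D]
variable [Ring E] [Algebra k E]

@[simp] theorem cons_apply (h : Hm k D) (φ : Conv k D E) (L : List (Hm k D)) :
    cons h φ L = φ (h :: L) := rfl

theorem ext_cons {φ ψ : Conv k D E} (h₀ : φ [] = ψ []) (h₁ : ∀ h, cons h φ = cons h ψ) :
    φ = ψ := by
  ext L
  cases L with
  | nil => exact h₀
  | cons h L => exact congrFun (h₁ h) L

/-- Pointwise left multiplication by a constant. -/
def lsm (e : E) : Conv k D E →ₗ[k] Conv k D E where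
  toFun φ := fun L => e * φ L
  map_add' _ _ := funext fun _ => mul_add _ _ _
  map_smul' _ _ := funext fun _ => mul_smul_comm _ _ _

@[simp] theorem lsm_apply (e : E) (φ : Conv k D E) (L : List (Hm k D)) : lsm e φ L = e * φ L := rfl

@[simp] theorem cons_lsm (h : Hm k D) (e : E) (φ : Conv k D E) :
    cons h (lsm e φ) = lsm e (cons h φ) := rfl

theorem lsm_lsm (e e' : E) (φ : Conv k D E) : lsm e (lsm e' φ) = lsm (e * e') φ := by
  ext L; simp [mul_assoc]

variable [GrAlgebra k E]

theorem mul_def (φ ψ : Conv k D E) (L : List (Hm k D)) : (φ * ψ) L =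
  ∑ i ∈ Finset.range (L.length + 1),
    sg k (wdeg (L.take i) * wdeg (L.drop i)) •
      (φ (L.take i) * sgn k (wdeg (L.take i)) (ψ (L.drop i))) := rfl

@[simp] theorem one_nil : (1 : Conv k D E) [] = 1 := rfl
@[simp] theorem one_cons (h : Hm k D) (L : List (Hm k D)) : (1 : Conv k D E) (h :: L) = 0 := rfl
@[simp] theorem cons_one (h : Hm k D) : cons h (1 : Conv k D E) = 0 := rfl

theorem tw_apply (n : ℤ) (φ : Conv k D E) (L : List (Hm k D)) :
    tw n φ L = sg k (n * wdeg L) • sgn k n (φ L) := rfl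

@[simp] theorem tw_nil (n : ℤ) (φ : Conv k D E) : tw n φ [] = sgn k n (φ []) := by
  simp [tw_apply]

theorem cons_tw (n : ℤ) (h : Hm k D) (φ : Conv k D E) :
    cons h (tw n φ) = sg k (n * h.sdeg) • tw n (cons h φ) := by
  ext L; simp [tw_apply, mul_add, sg_add, smul_smul]

theorem tw_lsm (n : ℤ) (e : E) (φ : Conv k D E) : tw n (lsm e φ) = lsm (sgn k n e) (tw n φ) := by
  ext L; simp [tw_apply]

theorem tw_add (m n : ℤ) (φ : Conv k D E) : tw (m + n) φ = tw m (tw n φ) := by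
  ext L; simp [tw_apply, sgn_add, add_mul, sg_add, smul_smul]

@[simp] theorem tw_zero (φ : Conv k D E) : tw 0 φ = φ := by
  ext L; simp [tw_apply]

theorem tw_comm (m n : ℤ) (φ : Conv k D E) : tw m (tw n φ) = tw n (tw m φ) := by
  rw [← tw_add, ← tw_add, add_comm]

@[simp] theorem tw_tw (n : ℤ) (φ : Conv k D E) : tw n (tw n φ) = φ := by
  ext L; simp [tw_apply, smul_smul]

@[simp] theorem mul_nil (φ ψ : Conv k D E) : (φ * ψ) [] = φ [] * ψ [] := by
  simp [mul_def]

theorem cons_mul (h : Hm k D) (φ ψ : Conv k D E) :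
    cons h (φ * ψ) = lsm (φ []) (cons h ψ) + cons h φ * tw h.sdeg ψ := by
  ext L
  simp only [cons_apply, add_apply, lsm_apply, mul_def]
  rw [List.length_cons, Finset.sum_range_succ', add_comm]
  congr 1
  · simp
  · refine Finset.sum_congr rfl fun i _ => ?_
    simp only [List.take_succ_cons, List.drop_succ_cons, wdeg_cons, tw_apply, map_smul,
      mul_smul_comm, smul_smul, add_mul, sg_add, sgn_add, sgn_comm k h.sdeg]
    congr 1
    ring

protected theorem add_mul (φ φ' ψ : Conv k D E) : (φ + φ') * ψ = φ * ψ + φ' * ψ := by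
  ext L; simp [mul_def, add_mul, Finset.sum_add_distrib]

protected theorem mul_add (φ ψ ψ' : Conv k D E) : φ * (ψ + ψ') = φ * ψ + φ * ψ' := by
  ext L; simp [mul_def, mul_add, Finset.sum_add_distrib]

protected theorem smul_mul (c : k) (φ ψ : Conv k D E) : (c • φ) * ψ = c • (φ * ψ) := by
  ext L; simp [mul_def, Finset.smul_sum, smul_comm c]

protected theorem mul_smul (c : k) (φ ψ : Conv k D E) : φ * (c • ψ) = c • (φ * ψ) := by
  ext L; simp [mul_def, Finset.smul_sum, smul_comm c]

protected theorem zero_mul (φ : Conv k D E) : 0 * φ = 0 := by ext L; simp [mul_def]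

protected theorem mul_zero (φ : Conv k D E) : φ * 0 = 0 := by ext L; simp [mul_def]

theorem lsm_mul (e : E) (φ ψ : Conv k D E) : lsm e (φ * ψ) = lsm e φ * ψ := by
  ext L; simp [mul_def, Finset.mul_sum, mul_assoc]

theorem tw_mul (n : ℤ) (φ ψ : Conv k D E) : tw n (φ * ψ) = tw n φ * tw n ψ := by
  ext L
  induction L generalizing φ ψ with
  | nil => simp
  | cons h L ih =>
    change cons h (tw n (φ * ψ)) L = cons h (tw n φ * tw n ψ) L
    rw [cons_tw, cons_mul, cons_mul, map_add, tw_lsm, cons_tw, cons_tw,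
      map_smul, Conv.smul_mul, smul_add, add_apply, add_apply, smul_apply, smul_apply, smul_apply,
      ih, tw_nil, tw_comm, smul_apply]

protected theorem one_mul (φ : Conv k D E) : 1 * φ = φ :=
  ext_cons (by simp) fun h => by
    rw [cons_mul, cons_one, Conv.zero_mul]; ext L; simp

protected theorem mul_one (φ : Conv k D E) : φ * 1 = φ := by
  ext L
  induction L generalizing φ with
  | nil => simp
  | cons h L ih =>
    have h1 : tw h.sdeg (1 : Conv k D E) = 1 :=
      ext_cons (by simp) fun h => by rw [cons_tw, cons_one, map_zero, smul_zero]
    change cons h (φ * 1) L = cons h φ L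
    rw [cons_mul, h1, add_apply, ih]; simp

protected theorem mul_assoc (φ ψ χ : Conv k D E) : φ * ψ * χ = φ * (ψ * χ) := by
  ext L
  induction L generalizing φ ψ χ with
  | nil => simp [mul_assoc]
  | cons h L ih =>
    change cons h (φ * ψ * χ) L = cons h (φ * (ψ * χ)) L
    rw [cons_mul, cons_mul, cons_mul, cons_mul, tw_mul, map_add,
      Conv.add_mul, lsm_mul, mul_nil, lsm_lsm]
    simp only [add_apply, ih, add_assoc]

instance : Ring (Conv k D E) where
  left_distrib := Conv.mul_add
  right_distrib := Conv.add_mul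
  zero_mul := Conv.zero_mul
  mul_zero := Conv.mul_zero
  mul_assoc := Conv.mul_assoc
  one_mul := Conv.one_mul
  mul_one := Conv.mul_one
  neg_add_cancel := neg_add_cancel
  zsmul := fun n φ => n • φ
  zsmul_zero' := zero_zsmul
  zsmul_succ' n a := SubNegMonoid.zsmul_succ' n a
  zsmul_neg' n a := SubNegMonoid.zsmul_neg' n a
  sub_eq_add_neg := sub_eq_add_neg

instance : Algebra k (Conv k D E) :=
  Algebra.ofModule Conv.smul_mul (fun c φ ψ => Conv.mul_smul c φ ψ)

@[simp] theorem tw_one (n : ℤ) : tw n (1 : Conv k D E) = 1 :=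
  ext_cons (by simp) fun h => by rw [cons_tw, cons_one, map_zero, smul_zero]

end Conv

namespace Hm
variable {k A : Type*} [Field k] [Ring A] [Algebra k A]

/-- A homogeneous element from a member of a graded piece. -/
def of [GrAlgebra k A] {p : ℤ} (a : gr k (A := A) p) : Hm k A := ⟨p, a, a.2⟩

theorem of_congr [GrAlgebra k A] {x y : Hm k A} (h : x.deg = y.deg) (h' : x.val = y.val) : x = y :=
  Hm.ext h h'

end Hm

namespace Conv

variable {k D E : Type*} [Field k] [Ring D] [Algebra k D] [GrAlgebra k D]
variable [Ring E] [Algebra k E]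

/-- Linearity and normalization in the letter that follows a given prefix. -/
structure IsCochainAt (L : List (Hm k D)) (φ : Conv k D E) : Prop where
  add : ∀ {p : ℤ} (a b : gr k (A := D) p) (R : List (Hm k D)),
    φ (L ++ Hm.of (a + b) :: R) = φ (L ++ Hm.of a :: R) + φ (L ++ Hm.of b :: R)
  smul : ∀ {p : ℤ} (c : k) (a : gr k (A := D) p) (R : List (Hm k D)),
    φ (L ++ Hm.of (c • a) :: R) = c • φ (L ++ Hm.of a :: R)
  one : ∀ R : List (Hm k D), φ (L ++ Hm.one :: R) = 0

/-- `φ` is a normalized cochain: it is linear in each letter and vanishes when a letter is `1`. -/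
def IsCochain (φ : Conv k D E) : Prop := ∀ L, IsCochainAt L φ

namespace IsCochainAt

variable {L : List (Hm k D)} {φ ψ : Conv k D E}

protected theorem addF (h : IsCochainAt L φ) (h' : IsCochainAt L ψ) : IsCochainAt L (φ + ψ) where
  add a b R := by simp only [add_apply, h.add, h'.add]; abel
  smul c a R := by simp only [add_apply, h.smul, h'.smul, smul_add]
  one R := by simp only [add_apply, h.one, h'.one, add_zero]

protected theorem smulF (c : k) (h : IsCochainAt L φ) : IsCochainAt L (c • φ) where
  add a b R := by simp only [smul_apply, h.add, smul_add]
  smul c a R := by simp only [smul_apply, h.smul, smul_comm c]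
  one R := by simp only [smul_apply, h.one, smul_zero]

protected theorem zeroF : IsCochainAt L (0 : Conv k D E) where
  add a b R := by simp
  smul c a R := by simp
  one R := by simp

protected theorem lsm (e : E) (h : IsCochainAt L φ) : IsCochainAt L (lsm e φ) where
  add a b R := by simp only [lsm_apply, h.add, mul_add]
  smul c a R := by simp only [lsm_apply, h.smul, mul_smul_comm]
  one R := by simp only [lsm_apply, h.one, mul_zero]

end IsCochainAt

theorem wdeg_of_add {p : ℤ} (a b : gr k (A := D) p) (L R : List (Hm k D)) :
    wdeg (L ++ Hm.of (a + b) :: R) = wdeg (L ++ Hm.of a :: R) := by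
  simp [Hm.of, Hm.sdeg]

variable [GrAlgebra k E]

theorem IsCochainAt.tw {L : List (Hm k D)} {φ : Conv k D E} (n : ℤ) (h : IsCochainAt L φ) :
    IsCochainAt L (tw n φ) where
  add a b R := by
    simp only [tw_apply, h.add, map_add, smul_add]
    simp [Hm.of, Hm.sdeg]
  smul c a R := by
    simp only [tw_apply, h.smul, map_smul, smul_comm _ c]
    simp [Hm.of, Hm.sdeg]
  one R := by simp only [tw_apply, h.one, map_zero, smul_zero]

section
variable {φ ψ : Conv k D E}

theorem IsCochain.add (h : IsCochain φ) (h' : IsCochain ψ) : IsCochain (φ + ψ) :=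
  fun L => (h L).addF (h' L)
theorem IsCochain.smul (c : k) (h : IsCochain φ) : IsCochain (c • φ) := fun L => (h L).smulF c
theorem IsCochain.neg (h : IsCochain φ) : IsCochain (-φ) := by
  rw [← neg_one_smul k]; exact h.smul _
theorem IsCochain.sub (h : IsCochain φ) (h' : IsCochain ψ) : IsCochain (φ - ψ) := by
  rw [sub_eq_add_neg]; exact h.add h'.neg
theorem IsCochain.zero : IsCochain (0 : Conv k D E) := fun _ => .zeroF
theorem IsCochain.tw (n : ℤ) (h : IsCochain φ) : IsCochain (tw n φ) := fun L => (h L).tw n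
theorem IsCochain.lsm (e : E) (h : IsCochain φ) : IsCochain (lsm e φ) := fun L => (h L).lsm e
theorem IsCochain.cons (h : IsCochain φ) (x : Hm k D) : IsCochain (cons x φ) := fun L =>
  ⟨(h (x :: L)).add, (h (x :: L)).smul, (h (x :: L)).one⟩

theorem IsCochain.cons_add (h : IsCochain φ) {p : ℤ} (a b : gr k (A := D) p) :
    Conv.cons (Hm.of (a + b)) φ = Conv.cons (Hm.of a) φ + Conv.cons (Hm.of b) φ :=
  Conv.ext fun R => (h []).add a b R
theorem IsCochain.cons_smul (h : IsCochain φ) {p : ℤ} (c : k) (a : gr k (A := D) p) :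
    Conv.cons (Hm.of (c • a)) φ = c • Conv.cons (Hm.of a) φ :=
  Conv.ext fun R => (h []).smul c a R
theorem IsCochain.cons_one (h : IsCochain φ) : Conv.cons Hm.one φ = 0 :=
  Conv.ext fun R => (h []).one R

theorem IsCochain.cons_of_val_eq_zero (h : IsCochain φ) {x : Hm k D} (hx : x.val = 0) :
    Conv.cons x φ = 0 := by
  have : x = Hm.of ((0 : k) • (0 : gr k (A := D) x.deg)) := Hm.of_congr rfl (by simp [hx, Hm.of])
  rw [this, h.cons_smul, zero_smul]

theorem IsCochainAt.of_head (h₁ : ∀ {p : ℤ} (a b : gr k (A := D) p),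
      Conv.cons (Hm.of (a + b)) φ = Conv.cons (Hm.of a) φ + Conv.cons (Hm.of b) φ)
    (h₂ : ∀ {p : ℤ} (c : k) (a : gr k (A := D) p),
      Conv.cons (Hm.of (c • a)) φ = c • Conv.cons (Hm.of a) φ)
    (h₃ : Conv.cons Hm.one φ = 0) : IsCochainAt [] φ :=
  ⟨fun a b => congrFun (h₁ a b), fun c a => congrFun (h₂ c a), congrFun h₃⟩

theorem IsCochainAt.of_cons {x : Hm k D} {L : List (Hm k D)}
    (h : IsCochainAt L (Conv.cons x φ)) : IsCochainAt (x :: L) φ := ⟨h.add, h.smul, h.one⟩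

theorem IsCochain.one : IsCochain (1 : Conv k D E) := fun L => by
  cases L with
  | nil => exact .of_head (by simp) (by simp) (by simp)
  | cons x L => exact .of_cons (by rw [Conv.cons_one]; exact .zeroF)

theorem IsCochain.mul (h : IsCochain φ) (h' : IsCochain ψ) : IsCochain (φ * ψ) := fun L => by
  induction L generalizing φ ψ with
  | nil =>
    refine .of_head (fun a b => ?_) (fun c a => ?_) ?_
    · rw [cons_mul, cons_mul, cons_mul, h.cons_add, h'.cons_add, map_add, add_mul]
      simp only [Hm.of, Hm.sdeg]
      abel
    · rw [cons_mul, cons_mul, h.cons_smul, h'.cons_smul, map_smul, smul_mul_assoc, smul_add]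
      simp only [Hm.of, Hm.sdeg]
    · rw [cons_mul, h.cons_one, h'.cons_one, map_zero, zero_mul, add_zero]
  | cons x L ih =>
    refine .of_cons ?_
    rw [cons_mul]
    exact (((h'.cons x).lsm _) L).addF (ih (h.cons x) (h'.tw _))

end

/-- `φ` has degree `n`: it changes degrees by `n`, words being counted with `wdeg`. -/
def HasDeg (n : ℤ) (φ : Conv k D E) : Prop := ∀ L, φ L ∈ gr k (n + wdeg L)

theorem HasDeg.tw {n m : ℤ} {φ : Conv k D E} (h : HasDeg n φ) : Conv.tw m φ = sg k (m * n) • φ := by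
  ext L
  simp only [tw_apply, sgn_of_mem k _ (h L), smul_smul, mul_add, sg_add, smul_apply]
  congr 1
  linear_combination (sg k (m * n)) * sg_mul_self k (m * wdeg L)

theorem HasDeg.mul {m n : ℤ} {φ ψ : Conv k D E} (h : HasDeg m φ) (h' : HasDeg n ψ) :
    HasDeg (m + n) (φ * ψ) := fun L => by
  rw [mul_def]
  refine Submodule.sum_mem _ fun i _ => Submodule.smul_mem _ _ ?_
  rw [sgn_of_mem k _ (h' _), mul_smul_comm]
  refine Submodule.smul_mem _ _ ?_
  have := gr_mul k (h (L.take i)) (h' (L.drop i))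
  have e : wdeg L = wdeg (L.take i) + wdeg (L.drop i) := by
    rw [← wdeg_append, List.take_append_drop]
  rw [e]
  convert this using 2
  ring

theorem HasDeg.one : HasDeg 0 (1 : Conv k D E) := fun L => by
  cases L with
  | nil => simpa using gr_one k
  | cons h L => exact zero_mem _

theorem HasDeg.cons {n : ℤ} {φ : Conv k D E} (h : HasDeg n φ) (x : Hm k D) :
    HasDeg (n + x.sdeg) (Conv.cons x φ) := fun L => by
  have := h (x :: L)
  rwa [wdeg_cons, ← add_assoc] at this

end Conv

theorem dif_mem {k A : Type*} [Field k] [Ring A] [Algebra k A] [DGAlgebra k A] {n : ℤ} {x : A}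
    (h : x ∈ gr k n) : dif k x ∈ gr k (n + 1) := DGAlgebra.d_mem _ _ h

namespace Conv

variable {k D E : Type*} [Field k] [Ring D] [Algebra k D] [GrAlgebra k D]
variable [Ring E] [Algebra k E]

/-- Multiplication of an element into the first letter of a word. -/
def merge (h : Hm k D) : Conv k D E →ₗ[k] Conv k D E where
  toFun φ := fun
    | [] => 0
    | h' :: L => φ (h.mul h' :: L)
  map_add' _ _ := funext fun L => match L with
    | [] => (add_zero (0 : E)).symm
    | _ :: _ => rfl
  map_smul' c _ := funext fun L => match L with
    | [] => (smul_zero (A := E) c).symm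
    | _ :: _ => rfl

/-- Postcomposition with a linear map. -/
def post (δ : E →ₗ[k] E) : Conv k D E →ₗ[k] Conv k D E where
  toFun φ := fun L => δ (φ L)
  map_add' _ _ := funext fun _ => map_add δ _ _
  map_smul' _ _ := funext fun _ => map_smul δ _ _

@[simp] theorem post_apply (δ : E →ₗ[k] E) (φ : Conv k D E) (L : List (Hm k D)) :
    post δ φ L = δ (φ L) := rfl

theorem cons_post (δ : E →ₗ[k] E) (h : Hm k D) (φ : Conv k D E) :
    cons h (post δ φ) = post δ (cons h φ) := rfl

end Conv
namespace Conv

variable {k D E : Type*} [Field k] [Ring D] [Algebra k D]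
variable [Ring E] [Algebra k E]

/-- Precomposition with the bar differential, a signed sum of the words in which one letter is
replaced by its differential, or two adjacent letters by their product:
`b [h₁|…|hₙ] = ∑ᵢ (-1)^(sdeg h₁ + … + sdeg hᵢ₋₁) (-[…|d hᵢ|…] + (-1)^(deg hᵢ) […|hᵢ hᵢ₊₁|…])`. -/
def barAux [DGAlgebra k D] : List (Hm k D) → Conv k D E → E
  | [], _ => 0
  | h :: L, φ => -φ (h.d :: L) + sg k h.deg • merge h φ L + sg k h.sdeg • barAux L (cons h φ)

/-- Precomposition of a function on words with the bar differential. -/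
def bar [DGAlgebra k D] (φ : Conv k D E) : Conv k D E := fun L => barAux L φ

section merge
variable [GrAlgebra k D]

@[simp] theorem merge_nil (h : Hm k D) (φ : Conv k D E) : merge h φ [] = 0 := rfl
@[simp] theorem merge_cons (h h' : Hm k D) (L : List (Hm k D)) (φ : Conv k D E) :
  merge h φ (h' :: L) = φ (h.mul h' :: L) := rfl
theorem cons_merge (h h' : Hm k D) (φ : Conv k D E) :
    cons h' (merge h φ) = cons (h.mul h') φ := rfl
end merge

variable [DGAlgebra k D]

@[simp] theorem bar_nil (φ : Conv k D E) : bar φ [] = 0 := rfl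

theorem cons_bar (h : Hm k D) (φ : Conv k D E) :
    cons h (bar φ) = -cons h.d φ + sg k h.deg • merge h φ + sg k h.sdeg • bar (cons h φ) := rfl

theorem bar_cons (h : Hm k D) (L : List (Hm k D)) (φ : Conv k D E) :
    bar φ (h :: L) = -φ (h.d :: L) + sg k h.deg • merge h φ L + sg k h.sdeg • bar (cons h φ) L :=
  rfl

theorem bar_add (φ ψ : Conv k D E) : bar (φ + ψ) = bar φ + bar ψ := by
  ext L
  induction L generalizing φ ψ with
  | nil => simp
  | cons h L ih =>
    rw [add_apply, bar_cons, bar_cons, bar_cons, map_add, map_add, ih]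
    simp only [add_apply, smul_add]
    abel

theorem bar_smul (c : k) (φ : Conv k D E) : bar (c • φ) = c • bar φ := by
  ext L
  induction L generalizing φ with
  | nil => simp
  | cons h L ih =>
    rw [smul_apply, bar_cons, bar_cons, map_smul, map_smul, ih]
    simp only [smul_apply, smul_add, smul_neg, smul_comm c]

/-- `bar` as a linear map. -/
def barL : Conv k D E →ₗ[k] Conv k D E := ⟨⟨bar, bar_add⟩, bar_smul⟩

theorem bar_neg (φ : Conv k D E) : bar (-φ) = -bar φ := (barL (k := k) (D := D) (E := E)).map_neg φ
theorem bar_sub (φ ψ : Conv k D E) : bar (φ - ψ) = bar φ - bar ψ :=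
  (barL (k := k) (D := D) (E := E)).map_sub φ ψ
theorem bar_zero : bar (0 : Conv k D E) = 0 := (barL (k := k) (D := D) (E := E)).map_zero

theorem bar_lsm (e : E) (φ : Conv k D E) : bar (lsm e φ) = lsm e (bar φ) := by
  ext L
  induction L generalizing φ with
  | nil => simp
  | cons h L ih =>
    rw [lsm_apply, bar_cons, bar_cons, cons_lsm, ih]
    cases L <;>
    simp only [lsm_apply, mul_add, mul_neg, mul_smul_comm, merge_nil, merge_cons, mul_zero]

theorem bar_post (δ : E →ₗ[k] E) (φ : Conv k D E) : bar (post δ φ) = post δ (bar φ) := by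
  ext L
  induction L generalizing φ with
  | nil => simp
  | cons h L ih =>
    rw [post_apply, bar_cons, bar_cons, cons_post, ih]
    cases L <;> simp

theorem sg_sdeg (h : Hm k D) : sg k h.sdeg = -sg k h.deg := by
  rw [Hm.sdeg, sg_sub, sg_one, mul_neg_one]

variable [GrAlgebra k E]

theorem bar_bar_apply {φ : Conv k D E} (hφ : IsCochain φ) (L : List (Hm k D)) :
    bar (bar φ) L = 0 := by
  induction L generalizing φ with
  | nil => rfl
  | cons h L ih =>
    rw [bar_cons, cons_bar, bar_add, bar_add, bar_neg, bar_smul, bar_smul]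
    simp only [add_apply, neg_apply, smul_apply, ih (hφ.cons h)]
    rw [bar_cons]
    have e1 : φ (h.d.d :: L) = 0 :=
      congrFun (hφ.cons_of_val_eq_zero (x := h.d.d) (DGAlgebra.d_d _)) L
    rw [e1, sg_sdeg, sg_sdeg]
    have e2 : sg k h.d.deg = - sg k h.deg := by simp [Hm.d, sg_add]
    rw [e2]
    have key : sg k h.deg • (merge h.d φ L + merge h (bar φ) L) - bar (merge h φ) L = 0 := by
      cases L with
      | nil => simp
      | cons h' L =>
        rw [bar_cons, merge_cons, merge_cons, merge_cons, bar_cons, cons_merge, sg_sdeg, sg_sdeg]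
        have e3 : φ ((h.mul h').d :: L) = φ (h.d.mul h' :: L) + sg k h.deg • φ (h.mul h'.d :: L) := by
          have h1 : (h.mul h').d = Hm.of
            ((⟨dif k h.val * h'.val, by
                have := gr_mul k (dif_mem h.mem) h'.mem
                rwa [add_right_comm] at this⟩ : gr k (A := D) (h.deg + h'.deg + 1)) +
             (sg k h.deg • ⟨h.val * dif k h'.val, by
                have := gr_mul k h.mem (dif_mem h'.mem)
                rwa [← add_assoc] at this⟩ : gr k (A := D) (h.deg + h'.deg + 1))) :=
            Hm.of_congr rfl (DGAlgebra.d_mul _ _ _ h.mem)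
          rw [h1]
          refine ((hφ []).add _ _ L).trans ?_
          congr 1
          · exact congrArg (fun x => φ (x :: L)) (Hm.of_congr (add_right_comm _ _ _) rfl)
          · refine ((hφ []).smul _ _ L).trans ?_
            exact congrArg (fun x => sg k h.deg • φ (x :: L)) (Hm.of_congr (add_assoc _ _ _) rfl)
        have e4 : merge (h.mul h') φ L = merge h' (merge h φ) L := by
          cases L with
          | nil => rfl
          | cons h'' L =>
            refine congrArg (fun x => φ (x :: L)) (Hm.of_congr (add_assoc _ _ _) (mul_assoc _ _ _))
        have e5 : sg k (h.mul h').deg = sg k h.deg * sg k h'.deg := sg_add _ _ _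
        have e6 : sg k h.d.deg = - sg k h.deg := by simp [Hm.d, sg_add]
        rw [e3, e4, e5]
        have hs := sg_mul_self k h.deg
        generalize sg k h.deg = s at *
        have hs' : ∀ x : E, s • s • x = x := fun x => by rw [smul_smul, hs, one_smul]
        simp only [add_apply, neg_apply, smul_apply, cons_apply, bar_add, bar_neg, bar_smul,
          smul_add, smul_neg, neg_smul, mul_smul, hs', neg_add_rev, neg_neg]
        abel
    have hs := sg_mul_self k h.deg
    generalize sg k h.deg = s at *
    have hs' : ∀ x : E, s • s • x = x := fun x => by rw [smul_smul, hs, one_smul]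
    have key' := sub_eq_zero.mp key
    simp only [add_apply, neg_apply, smul_apply, map_add, 
          smul_add, smul_neg, neg_smul, mul_smul, hs', neg_add_rev, neg_neg, ← key', smul_zero]
    abel

end Conv

namespace Hm
variable {k A : Type*} [Field k] [Ring A] [Algebra k A]
theorem sdeg_mul [GrAlgebra k A] (x y : Hm k A) : (x.mul y).sdeg = y.sdeg + (x.sdeg + 1) := by
  simp only [mul, sdeg]; ring
theorem sdeg_d [DGAlgebra k A] (x : Hm k A) : x.d.sdeg = x.sdeg + 1 := by
  simp only [d, sdeg]; ring
end Hm

namespace Conv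

variable {k D E : Type*} [Field k] [Ring D] [Algebra k D]
variable [Ring E] [Algebra k E]

section
variable [GrAlgebra k D] [GrAlgebra k E]

theorem merge_mul (h : Hm k D) (φ ψ : Conv k D E) :
    merge h (φ * ψ) = lsm (φ []) (merge h ψ) + merge h φ * tw h.sdeg (tw 1 ψ) :=
  ext_cons (by simp) fun h' => by
    rw [cons_merge, map_add, cons_lsm, cons_merge, cons_mul, cons_mul, cons_merge, merge_nil,
      Hm.sdeg_mul, tw_add, tw_add]
    ext L
    simp

theorem merge_tw (n : ℤ) (h : Hm k D) (φ : Conv k D E) :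
    merge h (tw n φ) = sg k (n * (h.sdeg + 1)) • tw n (merge h φ) := by
  refine ext_cons (by simp) fun h' => ?_
  ext L
  simp only [cons_apply, merge_cons, tw_apply, smul_apply, wdeg_cons, Hm.sdeg_mul, smul_smul,
    ← sg_add]
  congr 2
  ring

end

section
variable [GrAlgebra k D]

/-- The twisting cochain: a word of one letter is sent to (the image under `F` of) that letter, all
other words are sent to `0`. -/
def tau (F : D →ₐ[k] E) : Conv k D E := fun
  | [h] => F h.val
  | _ => 0

variable (F : D →ₐ[k] E)

@[simp] theorem tau_nil : tau (k := k) F [] = 0 := rfl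
@[simp] theorem tau_one (h : Hm k D) : tau F [h] = F h.val := rfl
@[simp] theorem tau_cons (h h' : Hm k D) (L : List (Hm k D)) : tau F (h :: h' :: L) = 0 := rfl

variable [GrAlgebra k E]

theorem cons_tau (h : Hm k D) : cons h (tau F) = lsm (F h.val) 1 :=
  ext_cons (by simp) fun h' => by ext; simp

theorem tau_mul (φ : Conv k D E) (h : Hm k D) :
    cons h (tau F * φ) = lsm (F h.val) (tw h.sdeg φ) := by
  rw [cons_mul, cons_tau, tau_nil, ← lsm_mul, one_mul]
  ext L
  simp

end

variable [DGAlgebra k D] [GrAlgebra k E]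

theorem bar_tw (n : ℤ) (φ : Conv k D E) : bar (tw n φ) = sg k n • tw n (bar φ) := by
  ext L
  induction L generalizing φ with
  | nil => simp
  | cons h L ih =>
    rw [bar_cons, merge_tw, cons_tw, bar_smul]
    simp only [smul_apply, ih]
    simp only [tw_apply, bar_cons, smul_apply, smul_smul, map_add, map_neg, map_smul, smul_add,
      smul_neg, wdeg_cons, Hm.sdeg_d, mul_add, mul_one, sg_add]
    module

theorem bar_mul (φ ψ : Conv k D E) : bar (φ * ψ) = bar φ * tw 1 ψ + φ * bar ψ := by
  ext L
  induction L generalizing φ ψ with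
  | nil => simp
  | cons h L ih =>
    change cons h (bar (φ * ψ)) L = cons h (bar φ * tw 1 ψ + φ * bar ψ) L
    rw [cons_bar, merge_mul, map_add, cons_mul, cons_mul, cons_mul, cons_mul, bar_add, bar_lsm,
      bar_nil, cons_bar, cons_bar, Hm.sdeg_d, tw_add]
    simp only [add_apply, neg_apply, smul_apply, ih, bar_tw, sg_sdeg, map_add, map_neg, map_smul,
      smul_add, mul_smul_comm, neg_smul, add_mul, neg_mul, smul_mul_assoc, smul_neg, smul_smul,
      sg_mul_self, one_smul, neg_neg, lsm_apply, zero_mul, mul_neg, mul_add]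
    rw [tw_comm 1 h.sdeg]
    abel

variable (F : D →ₐ[k] E)

/-- The part `φ ↦ -(-1)^|φ| φ ∘ b + τ ∪ φ - (-1)^|φ| φ ∪ τ` of the Hochschild differential. -/
def dtw (φ : Conv k D E) : Conv k D E := -bar (tw 1 φ) + tau F * φ - tw 1 φ * tau F

theorem dtw_add (φ ψ : Conv k D E) : dtw F (φ + ψ) = dtw F φ + dtw F ψ := by
  simp only [dtw, map_add, bar_add, mul_add, add_mul]
  abel

theorem dtw_smul (c : k) (φ : Conv k D E) : dtw F (c • φ) = c • dtw F φ := by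
  simp only [dtw, map_smul, bar_smul, mul_smul_comm, smul_mul_assoc, smul_add, smul_sub, smul_neg]

theorem dtw_mul (φ ψ : Conv k D E) : dtw F (φ * ψ) = dtw F φ * ψ + tw 1 φ * dtw F ψ := by
  simp only [dtw, tw_mul, bar_mul, tw_tw, mul_add, add_mul, mul_sub, sub_mul, neg_add, mul_neg,
    neg_mul, mul_assoc]
  abel

end Conv

/-- An algebra homomorphism that preserves degrees. -/
def IsGr {k A B : Type*} [Field k] [Ring A] [Algebra k A] [GrAlgebra k A] [Ring B] [Algebra k B]
    [GrAlgebra k B] (F : A →ₐ[k] B) : Prop := ∀ (n : ℤ) (x : A), x ∈ gr k n → F x ∈ gr k n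

namespace Hm
variable {k A : Type*} [Field k] [Ring A] [Algebra k A] [GrAlgebra k A]

/-- `z = c x + c' y` in one degree. -/
structure Lin (c c' : k) (x y z : Hm k A) : Prop where
  dx : x.deg = z.deg
  dy : y.deg = z.deg
  val : z.val = c • x.val + c' • y.val

variable {c c' : k} {x y z : Hm k A}

theorem Lin.d {k A : Type*} [Field k] [Ring A] [Algebra k A] [DGAlgebra k A] {c c' : k}
    {x y z : Hm k A} (h : Lin c c' x y z) : Lin c c' x.d y.d z.d :=
  ⟨congrArg (· + 1) h.dx, congrArg (· + 1) h.dy, by simp [Hm.d, h.val]⟩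
theorem Lin.mul_left (h : Lin c c' x y z) (w : Hm k A) : Lin c c' (w.mul x) (w.mul y) (w.mul z) :=
  ⟨congrArg (w.deg + ·) h.dx, congrArg (w.deg + ·) h.dy, by simp [mul, h.val, mul_add]⟩
theorem Lin.mul_right (h : Lin c c' x y z) (w : Hm k A) : Lin c c' (x.mul w) (y.mul w) (z.mul w) :=
  ⟨congrArg (· + w.deg) h.dx, congrArg (· + w.deg) h.dy, by simp [mul, h.val, add_mul]⟩
theorem Lin.sx (h : Lin c c' x y z) : x.sdeg = z.sdeg := congrArg (· - 1) h.dx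
theorem Lin.sy (h : Lin c c' x y z) : y.sdeg = z.sdeg := congrArg (· - 1) h.dy
theorem Lin.add {p : ℤ} (a b : gr k (A := A) p) : Lin 1 1 (of a) (of b) (of (a + b)) :=
  ⟨rfl, rfl, by simp [of]⟩
theorem Lin.smul {p : ℤ} (c : k) (a : gr k (A := A) p) : Lin c 0 (of a) (of a) (of (c • a)) :=
  ⟨rfl, rfl, by simp [of]⟩
end Hm

theorem dif_one (k A : Type*) [Field k] [Ring A] [Algebra k A] [DGAlgebra k A] :
    dif k (1 : A) = 0 := by
  have := DGAlgebra.d_mul 0 (1 : A) 1 (gr_one k)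
  simpa using this

namespace Conv

variable {k D E : Type*} [Field k] [Ring D] [Algebra k D]
variable [Ring E] [Algebra k E]

theorem isCochain_of_lin [GrAlgebra k D] {φ : Conv k D E}
    (h : ∀ (c c' : k) (x y z : Hm k D), Hm.Lin c c' x y z → ∀ L R,
      φ (L ++ z :: R) = c • φ (L ++ x :: R) + c' • φ (L ++ y :: R))
    (h₁ : ∀ L R, φ (L ++ Hm.one :: R) = 0) : IsCochain φ := fun L =>
  ⟨fun a b R => by simpa using h _ _ _ _ _ (Hm.Lin.add a b) L R,
   fun c a R => by simpa using h _ _ _ _ _ (Hm.Lin.smul c a) L R, h₁ L⟩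

theorem IsCochain.lin [GrAlgebra k D] {φ : Conv k D E} (hφ : IsCochain φ) {c c' : k}
    {x y z : Hm k D} (h : Hm.Lin c c' x y z) (L R : List (Hm k D)) :
    φ (L ++ z :: R) = c • φ (L ++ x :: R) + c' • φ (L ++ y :: R) := by
  obtain ⟨q, z, hz⟩ := z
  obtain ⟨p, x, hx⟩ := x
  obtain ⟨r, y, hy⟩ := y
  obtain ⟨h1, h2, h3⟩ := h
  dsimp only at h1 h2 h3
  subst h1 h2
  have : (⟨_, z, hz⟩ : Hm k D) = Hm.of (c • ⟨x, hx⟩ + c' • ⟨y, hy⟩ : gr k (A := D) _) :=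
    Hm.of_congr rfl h3
  rw [this, (hφ L).add, (hφ L).smul, (hφ L).smul]
  rfl

theorem IsCochain.cons_lin [GrAlgebra k D] {φ : Conv k D E} (hφ : IsCochain φ) {c c' : k}
    {x y z : Hm k D} (h : Hm.Lin c c' x y z) :
    Conv.cons z φ = c • Conv.cons x φ + c' • Conv.cons y φ :=
  Conv.ext fun R => hφ.lin h [] R

theorem IsCochain.merge_lin [GrAlgebra k D] {φ : Conv k D E} (hφ : IsCochain φ) {c c' : k}
    {x y z : Hm k D} (h : Hm.Lin c c' x y z) :
    merge z φ = c • merge x φ + c' • merge y φ :=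
  ext_cons (by simp) fun h' => hφ.cons_lin (h.mul_right h')

theorem IsCochain.merge_lin' [GrAlgebra k D] {φ : Conv k D E} (hφ : IsCochain φ) {c c' : k}
    {x y z : Hm k D} (h : Hm.Lin c c' x y z) (w : Hm k D) (L R : List (Hm k D)) :
    merge w φ (L ++ z :: R) = c • merge w φ (L ++ x :: R) + c' • merge w φ (L ++ y :: R) := by
  cases L with
  | nil => exact hφ.lin (h.mul_left w) [] R
  | cons u L => exact hφ.lin h (w.mul u :: L) R

variable [GrAlgebra k E]

theorem tw_neg [GrAlgebra k D] (n : ℤ) (φ : Conv k D E) : tw (-n) φ = tw n φ := by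
  ext L
  rw [tw_apply, tw_apply, sgn_neg, neg_mul, sg_neg]

theorem tau_hasDeg [GrAlgebra k D] {F : D →ₐ[k] E} (hF : IsGr F) :
    HasDeg 1 (tau (k := k) F)
  | [] => zero_mem _
  | [h] => by
    have := hF _ _ h.mem
    rw [tau_one]
    simpa [Hm.sdeg] using this
  | _ :: _ :: _ => zero_mem _

theorem tw_tau [GrAlgebra k D] {F : D →ₐ[k] E} (hF : IsGr F) (n : ℤ) :
    tw n (tau (k := k) F) = sg k n • tau F := by
  rw [(tau_hasDeg hF).tw, mul_one]

theorem IsCochain.tau_mul_lin [GrAlgebra k D] {φ : Conv k D E} (hφ : IsCochain φ) {c c' : k}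
    {x y z : Hm k D} (h : Hm.Lin c c' x y z) (F : D →ₐ[k] E) (L R : List (Hm k D)) :
    (tau F * φ) (L ++ z :: R) = c • (tau F * φ) (L ++ x :: R) + c' • (tau F * φ) (L ++ y :: R) := by
  cases L with
  | nil =>
    change Conv.cons z (tau F * φ) R = c • Conv.cons x (tau F * φ) R +
      c' • Conv.cons y (tau F * φ) R
    rw [tau_mul, tau_mul, tau_mul, h.sx, h.sy]
    simp [h.val, add_mul]
  | cons u L =>
    change Conv.cons u (tau F * φ) (L ++ z :: R) = c • Conv.cons u (tau F * φ) (L ++ x :: R) +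
      c' • Conv.cons u (tau F * φ) (L ++ y :: R)
    rw [tau_mul]
    simp only [lsm_apply]
    rw [(hφ.tw _).lin h]
    simp only [mul_add, mul_smul_comm]

variable [DGAlgebra k D] 

theorem cons_dtw {F : D →ₐ[k] E} (hF : IsGr F) (h : Hm k D) (φ : Conv k D E) :
    cons h (dtw F φ) = cons h.d (tw 1 φ) - sg k h.deg • merge h (tw 1 φ)
      + lsm (F h.val) (tw h.sdeg φ) - lsm (tw 1 φ []) (cons h (tau F)) + dtw F (cons h φ)
      - tau F * cons h φ := by
  rw [dtw, map_sub, map_add, map_neg, cons_bar, tau_mul, cons_mul (φ := tw 1 φ), cons_tw (h := h),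
    tw_tau hF, dtw, bar_smul]
  simp only [one_mul, smul_mul_assoc, mul_smul_comm, smul_smul, sg_mul_self, one_smul]
  abel

theorem dtw_one_head {F : D →ₐ[k] E} (hF : IsGr F) {φ : Conv k D E} (hφ : IsCochain φ) :
    cons Hm.one (dtw F φ) = 0 := by
  have h1 : (Hm.one.d : Hm k D).val = 0 := dif_one k D
  have h2 : merge Hm.one (tw 1 φ) = tw 1 φ - lsm (tw 1 φ []) 1 := by
    refine ext_cons (by simp) fun h => ?_
    have e5 : Hm.mul Hm.one h = h := Hm.of_congr (zero_add _) (one_mul _)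
    rw [cons_merge, e5]
    ext L
    simp
  rw [cons_dtw hF, (hφ.tw 1).cons_of_val_eq_zero h1, hφ.cons_one, h2, cons_tau]
  have h3 : tw (Hm.one : Hm k D).sdeg φ = tw 1 φ := tw_neg 1 φ
  rw [h3]
  ext L
  simp [Hm.one, dtw, bar_zero]

theorem IsCochain.dtw {φ : Conv k D E} (hφ : IsCochain φ) {F : D →ₐ[k] E} (hF : IsGr F) :
    IsCochain (dtw F φ) := by
  refine isCochain_of_lin (fun c c' x y z h L R => ?_) (fun L R => ?_)
  · induction L generalizing φ with
    | nil =>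
      change Conv.cons z (Conv.dtw F φ) R = c • Conv.cons x (Conv.dtw F φ) R +
        c' • Conv.cons y (Conv.dtw F φ) R
      rw [cons_dtw hF, cons_dtw hF, cons_dtw hF, (hφ.tw 1).cons_lin h.d, (hφ.tw 1).merge_lin h,
        hφ.cons_lin h, dtw_add, dtw_smul, dtw_smul, h.sx, h.sy, h.dx, h.dy, cons_tau, cons_tau,
        cons_tau, h.val, mul_add]
      simp only [add_apply, sub_apply, smul_apply, lsm_apply, map_add, map_smul, add_mul, mul_add,
        smul_mul_assoc, mul_smul_comm, smul_add, smul_sub, smul_comm _ (sg k z.deg)]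
      abel
    | cons u L ih =>
      change Conv.cons u (Conv.dtw F φ) (L ++ z :: R) =
        c • Conv.cons u (Conv.dtw F φ) (L ++ x :: R) +
        c' • Conv.cons u (Conv.dtw F φ) (L ++ y :: R)
      rw [cons_dtw hF]
      simp only [add_apply, sub_apply, smul_apply, lsm_apply, ih (hφ.cons u), cons_apply]
      have e1 := (hφ.tw 1).lin h (u.d :: L) R
      have e2 := (hφ.cons u).tau_mul_lin h F L R
      have e4 : ∀ w : Hm k D, tau (k := k) F (u :: (L ++ w :: R)) = 0 := fun w => by
        cases L <;> rfl
      rw [(hφ.tw u.sdeg).lin h, (hφ.tw 1).merge_lin' h, e2, e4, e4, e4]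
      simp only [List.cons_append] at e1
      rw [e1]
      simp only [mul_add, mul_smul_comm, smul_add, smul_sub, smul_comm _ (sg k u.deg), mul_zero,
        smul_zero]
      abel
  · induction L generalizing φ with
    | nil => exact congrFun (dtw_one_head hF hφ) R
    | cons u L ih =>
      change Conv.cons u (Conv.dtw F φ) (L ++ Hm.one :: R) = 0
      rw [cons_dtw hF]
      simp only [add_apply, sub_apply, smul_apply, lsm_apply, ih (hφ.cons u), cons_apply]
      have e1 := ((hφ.tw 1) (u.d :: L)).one R
      have e4 : tau (k := k) F (u :: (L ++ Hm.one :: R)) = 0 := by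
        cases L <;> rfl
      simp only [List.cons_append] at e1
      rw [e1, e4, ((hφ.tw _) L).one R]
      cases L with
      | nil => 
        have : (Conv.tau F * Conv.cons u φ) ([] ++ Hm.one :: R) =
            F 1 * Conv.tw (-1) (Conv.cons u φ) R := congrFun (tau_mul F _ _) R
        rw [this]
        have e5 : u.mul Hm.one = u := Hm.of_congr (add_zero _) (mul_one _)
        rw [List.nil_append, merge_cons, e5]
        simp only [tw_apply, cons_apply, map_one, one_mul, neg_mul, sg_neg, wdeg_cons, sg_add,
          Hm.sdeg, sg_one, sg_sub]
        have h3 : sgn k (-1) (φ (u :: R)) = sgn k 1 (φ (u :: R)) := sgn_neg k 1 _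
        rw [h3]
        simp only [one_mul, sub_self, smul_smul, mul_zero, mul_neg, neg_mul, mul_one, smul_neg,
          neg_smul, zero_sub, sub_neg_eq_add, neg_neg, add_zero, zero_add, neg_add_rev,
          ← mul_assoc, sg_mul_self]
        abel
      | cons v L => 
        have e2 := congrFun (tau_mul F (Conv.cons u φ) v) (L ++ Hm.one :: R)
        rw [cons_apply, lsm_apply, (((hφ.cons u).tw _) L).one, mul_zero] at e2
        have e3 := ((hφ.tw 1) (u.mul v :: L)).one R
        simp only [List.cons_append] at e3 ⊢
        rw [e2, merge_cons, e3]
        simp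

end Conv

/-- A graded derivation of degree `1`. -/
structure IsDer {k E : Type*} [Field k] [Ring E] [Algebra k E] [GrAlgebra k E] (δ : E →ₗ[k] E) :
    Prop where
  mem : ∀ (n : ℤ) (x : E), x ∈ gr k n → δ x ∈ gr k (n + 1)
  mul : ∀ (n : ℤ) (x y : E), x ∈ gr k n → δ (x * y) = δ x * y + sg k n • (x * δ y)

section
variable {k E : Type*} [Field k] [Ring E] [Algebra k E]

theorem isDer_dif [DGAlgebra k E] : IsDer (dif k (A := E)) := ⟨DGAlgebra.d_mem, DGAlgebra.d_mul⟩

variable [GrAlgebra k E] {δ : E →ₗ[k] E}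

theorem IsDer.map_mul (h : IsDer δ) (x y : E) : δ (x * y) = δ x * y + sgn k 1 x * δ y := by
  refine gr_induction k (P := fun x => δ (x * y) = δ x * y + sgn k 1 x * δ y)
    (fun p x hx => ?_) (fun x x' hx hx' => ?_) x
  · rw [h.mul p x y hx, sgn_of_mem k 1 hx, one_mul, smul_mul_assoc]
  · rw [add_mul, map_add, map_add, map_add, hx, hx', add_mul, add_mul]
    abel

theorem IsDer.map_sgn (h : IsDer δ) (n : ℤ) (x : E) : δ (sgn k n x) = sg k n • sgn k n (δ x) := by
  refine gr_induction k (P := fun x => δ (sgn k n x) = sg k n • sgn k n (δ x))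
    (fun p x hx => ?_) (fun x x' hx hx' => by simp only [map_add, hx, hx', smul_add]) x
  rw [sgn_of_mem k n hx, sgn_of_mem k n (h.mem p x hx), map_smul, smul_smul, mul_add, mul_one,
    sg_add, mul_comm (sg k (n * p)), ← mul_assoc, sg_mul_self, one_mul]

theorem IsDer.map_one (h : IsDer δ) : δ 1 = 0 := by
  have := h.mul 0 1 1 (gr_one k)
  simpa using this

end

namespace Conv

variable {k D E : Type*} [Field k] [Ring D] [Algebra k D]
variable [Ring E] [Algebra k E] [GrAlgebra k E]

section
variable [GrAlgebra k D] {δ : E →ₗ[k] E}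

theorem post_lsm (h : IsDer δ) (e : E) (φ : Conv k D E) :
    post δ (lsm e φ) = lsm (δ e) φ + lsm (sgn k 1 e) (post δ φ) := by
  ext L
  simp [h.map_mul]

theorem post_tw (h : IsDer δ) (n : ℤ) (φ : Conv k D E) :
    post δ (tw n φ) = sg k n • tw n (post δ φ) := by
  ext L
  simp [tw_apply, h.map_sgn, smul_comm (sg k n)]

theorem post_mul (h : IsDer δ) (φ ψ : Conv k D E) :
    post δ (φ * ψ) = post δ φ * ψ + tw 1 φ * post δ ψ := by
  ext L
  induction L generalizing φ ψ with
  | nil => simp [h.map_mul]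
  | cons x L ih =>
    change cons x (post δ (φ * ψ)) L = cons x (post δ φ * ψ + tw 1 φ * post δ ψ) L
    rw [cons_post, cons_mul, map_add, map_add, cons_mul, cons_mul, post_lsm h, add_apply, ih,
      post_tw h, cons_tw, tw_nil, post_apply, cons_post, cons_post]
    simp only [add_apply, smul_mul_assoc, mul_smul_comm, one_mul]
    abel

theorem HasDeg.post (h : IsDer δ) {n : ℤ} {φ : Conv k D E} (hφ : HasDeg n φ) :
    HasDeg (n + 1) (post δ φ) := fun L => by
  have := h.mem _ _ (hφ L)
  rwa [add_right_comm] at this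

theorem IsCochain.post {φ : Conv k D E} (hφ : IsCochain φ) (δ : E →ₗ[k] E) :
    IsCochain (post δ φ) := fun L =>
  ⟨fun a b R => by simp only [post_apply, (hφ L).add, map_add],
   fun c a R => by simp only [post_apply, (hφ L).smul, map_smul],
   fun R => by simp only [post_apply, (hφ L).one, map_zero]⟩

end

variable [DGAlgebra k D]

theorem bar_mem (L : List (Hm k D)) {n : ℤ} {φ : Conv k D E} (hφ : HasDeg n φ) :
    bar φ L ∈ gr k (n + 1 + wdeg L) := by
  induction L generalizing φ n with
  | nil => exact zero_mem _
  | cons h L ih =>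
    rw [bar_cons]
    refine add_mem (add_mem (neg_mem ?_) (Submodule.smul_mem _ _ ?_)) (Submodule.smul_mem _ _ ?_)
    · have := hφ (h.d :: L)
      rw [wdeg_cons, Hm.sdeg_d] at this
      rw [wdeg_cons]
      convert this using 2
      ring
    · cases L with
      | nil => exact zero_mem _
      | cons h' L =>
        have := hφ (h.mul h' :: L)
        rw [wdeg_cons, Hm.sdeg_mul] at this
        rw [wdeg_cons, wdeg_cons, merge_cons]
        convert this using 2
        ring
    · have := ih (hφ.cons h)
      rw [wdeg_cons]
      convert this using 2
      ring

theorem HasDeg.dtw {F : D →ₐ[k] E} (hF : IsGr F) {n : ℤ} {φ : Conv k D E} (hφ : HasDeg n φ) :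
    HasDeg (n + 1) (dtw F φ) := fun L => by
  unfold Conv.dtw
  rw [hφ.tw, bar_smul, smul_mul_assoc]
  refine sub_mem (add_mem (neg_mem (Submodule.smul_mem _ _ (bar_mem L hφ))) ?_)
    (Submodule.smul_mem _ _ ((hφ.mul (tau_hasDeg hF)) L))
  rw [add_comm n]
  exact ((tau_hasDeg hF).mul hφ) L

/-- The Hochschild differential. -/
def hd (δ : E →ₗ[k] E) (F : D →ₐ[k] E) : Conv k D E →ₗ[k] Conv k D E where
  toFun φ := post δ φ + dtw F φ
  map_add' φ ψ := by rw [map_add, dtw_add]; abel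
  map_smul' c φ := by rw [map_smul, dtw_smul, smul_add]; rfl

theorem hd_apply (δ : E →ₗ[k] E) (F : D →ₐ[k] E) (φ : Conv k D E) :
    hd δ F φ = post δ φ + dtw F φ := rfl

variable {δ : E →ₗ[k] E} {F : D →ₐ[k] E}

theorem hd_mul (h : IsDer δ) (φ ψ : Conv k D E) :
    hd δ F (φ * ψ) = hd δ F φ * ψ + tw 1 φ * hd δ F ψ := by
  rw [hd_apply, hd_apply, hd_apply, post_mul h, dtw_mul, add_mul, mul_add]
  abel

theorem maurer_cartan (hF : IsGr F) (hd : ∀ x : Hm k D, δ (F x.val) = F (dif k x.val)) :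
    bar (tau F) = -post δ (tau F) - tau F * tau F := by
  refine ext_cons (by simp) fun h => ?_
  ext L
  rw [map_sub, map_neg, tau_mul, tw_tau hF, cons_bar, cons_post]
  cases L with
  | nil => simp [hd, Hm.d]
  | cons h' L =>
    cases L with
    | nil =>
      simp [bar_cons, cons_tau, sg_sdeg, Hm.mul]
    | cons h'' L =>
      have : bar (cons h (tau F)) (h' :: h'' :: L) = 0 := by
        rw [cons_tau, bar_lsm, lsm_apply]
        have : bar (1 : Conv k D E) = 0 := by
          have := bar_mul (1 : Conv k D E) 1
          simpa using this
        rw [this]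
        simp
      simp [this]

theorem hd_hd (h : IsDer δ) (hF : IsGr F) (hd' : ∀ x : Hm k D, δ (F x.val) = F (dif k x.val))
    {φ : Conv k D E} (hφ : IsCochain φ) : hd δ F (hd δ F φ) = post δ (post δ φ) := by
  have hbb : bar (bar φ) = 0 := ext (bar_bar_apply hφ)
  have mc := maurer_cartan hF hd'
  have e1 : post δ (bar (tw 1 φ)) = bar (post δ (tw 1 φ)) := (bar_post _ _).symm
  have e2 : post δ (bar φ) = bar (post δ φ) := (bar_post _ _).symm
  simp only [hd_apply, dtw, map_add, e2, map_sub, map_neg, post_mul h, e1, post_tw h, bar_tw, bar_neg,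
    bar_sub, bar_add, bar_smul, hbb, tw_mul, tw_tau hF, tw_tw, sg_one, neg_smul, one_smul, bar_mul,
    mc, mul_add, add_mul, mul_sub, sub_mul, mul_neg, neg_mul, map_zero, neg_neg, ← mul_assoc,
    map_smul]
  simp only [mul_assoc]
  abel

end Conv

section
variable (k C D : Type*) [Field k] [Ring C] [Algebra k C] [GrAlgebra k C]
  [Ring D] [Algebra k D] [GrAlgebra k D]

/-- Generators of the twisted tensor product of dg algebras, which are regarded as dg categories with
one object. Words are written in the order of composition, from left to right as in a product: `gs =
[gₙ, …, g₁]` stands for the chain of morphisms that starts with `g₁` and ends with `gₙ`. For the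
empty word, `ε(f; )` is `f ⊗ 1`. -/
inductive Gen
  | right (g : Hm k D)
  | eps (f : Hm k C) (gs : List (Hm k D))

variable {k C D}

/-- The generator `1 ⊗ g` of the free algebra. -/
def genR (g : Hm k D) : FreeAlgebra k (Gen k C D) := FreeAlgebra.ι k (.right g)

/-- The generator `ε(f; gs)` of the free algebra. -/
def genE (f : Hm k C) (gs : List (Hm k D)) : FreeAlgebra k (Gen k C D) := FreeAlgebra.ι k (.eps f gs)

variable (k C D)

/-- The defining relations of the twisted tensor product: `1 ⊗ g` and `ε(f; gs)` are linear in each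
argument, `g ↦ 1 ⊗ g` is a morphism of algebras, `ε(1; ) = 1` and `ε(1; gs) = 0` for nonempty `gs`,
`ε(f; gs) = 0` if some letter of `gs` is `1`, and `ε(f₂ f₁; gs)` is the sum of
`± ε(f₂; gs₂) * ε(f₁; gs₁)` over all ways to cut `gs` into `gs₂ ++ gs₁`, the sign being
`(-1)^(|f₁| * wdeg gs₂)`. For the empty word the last one reads `f₂ f₁ ⊗ 1 = (f₂ ⊗ 1) * (f₁ ⊗ 1)`. -/
inductive Rel : FreeAlgebra k (Gen k C D) → FreeAlgebra k (Gen k C D) → Prop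
  | right_add {p : ℤ} (a b : gr k (A := D) p) :
      Rel (genR (Hm.of (a + b))) (genR (Hm.of a) + genR (Hm.of b))
  | right_smul {p : ℤ} (c : k) (a : gr k (A := D) p) :
      Rel (genR (Hm.of (c • a))) (c • genR (Hm.of a))
  | right_one : Rel (genR Hm.one) 1
  | right_mul (g₂ g₁ : Hm k D) : Rel (genR (g₂.mul g₁)) (genR g₂ * genR g₁)
  | left_add {p : ℤ} (a b : gr k (A := C) p) (L : List (Hm k D)) :
      Rel (genE (Hm.of (a + b)) L) (genE (Hm.of a) L + genE (Hm.of b) L)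
  | left_smul {p : ℤ} (c : k) (a : gr k (A := C) p) (L : List (Hm k D)) :
      Rel (genE (Hm.of (c • a)) L) (c • genE (Hm.of a) L)
  | left_one_nil : Rel (genE Hm.one []) 1
  | left_one_cons (g : Hm k D) (L : List (Hm k D)) : Rel (genE Hm.one (g :: L)) 0
  | word_add (f : Hm k C) (L : List (Hm k D)) {p : ℤ} (a b : gr k (A := D) p)
      (R : List (Hm k D)) :
      Rel (genE f (L ++ Hm.of (a + b) :: R))
        (genE f (L ++ Hm.of a :: R) + genE f (L ++ Hm.of b :: R))
  | word_smul (f : Hm k C) (L : List (Hm k D)) {p : ℤ} (c : k) (a : gr k (A := D) p)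
      (R : List (Hm k D)) :
      Rel (genE f (L ++ Hm.of (c • a) :: R)) (c • genE f (L ++ Hm.of a :: R))
  | word_one (f : Hm k C) (L R : List (Hm k D)) : Rel (genE f (L ++ Hm.one :: R)) 0
  | left_mul (f₂ f₁ : Hm k C) (L : List (Hm k D)) :
      Rel (genE (f₂.mul f₁) L) (∑ i ∈ Finset.range (L.length + 1),
        sg k (f₁.deg * wdeg (L.take i)) • (genE f₂ (L.take i) * genE f₁ (L.drop i)))

/-- The underlying algebra of the twisted tensor product. -/
def TwTensor : Type _ := RingQuot (Rel k C D)

instance : Ring (TwTensor k C D) := inferInstanceAs (Ring (RingQuot (Rel k C D)))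
instance : Algebra k (TwTensor k C D) := inferInstanceAs (Algebra k (RingQuot (Rel k C D)))

/-- A solution of the defining relations in an algebra `E`. -/
structure TwData (E : Type*) [Ring E] [Algebra k E] where
  r : Hm k D → E
  e : Hm k C → Conv k D E
  right_add : ∀ {p : ℤ} (a b : gr k (A := D) p), r (Hm.of (a + b)) = r (Hm.of a) + r (Hm.of b)
  right_smul : ∀ {p : ℤ} (c : k) (a : gr k (A := D) p), r (Hm.of (c • a)) = c • r (Hm.of a)
  right_one : r Hm.one = 1
  right_mul : ∀ g₂ g₁ : Hm k D, r (g₂.mul g₁) = r g₂ * r g₁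
  left_add : ∀ {p : ℤ} (a b : gr k (A := C) p), e (Hm.of (a + b)) = e (Hm.of a) + e (Hm.of b)
  left_smul : ∀ {p : ℤ} (c : k) (a : gr k (A := C) p), e (Hm.of (c • a)) = c • e (Hm.of a)
  left_one_nil : e Hm.one [] = 1
  left_one_cons : ∀ g L, e Hm.one (g :: L) = 0
  word : ∀ f, (e f).IsCochain
  left_mul : ∀ (f₂ f₁ : Hm k C) (L : List (Hm k D)),
      e (f₂.mul f₁) L = ∑ i ∈ Finset.range (L.length + 1),
        sg k (f₁.deg * wdeg (L.take i)) • (e f₂ (L.take i) * e f₁ (L.drop i))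

end

namespace TwTensor

variable {k C D E : Type*} [Field k] [Ring C] [Algebra k C] [GrAlgebra k C]
  [Ring D] [Algebra k D] [GrAlgebra k D] [Ring E] [Algebra k E]

/-- The quotient map from the free algebra. -/
def mk : FreeAlgebra k (Gen k C D) →ₐ[k] TwTensor k C D := RingQuot.mkAlgHom k (Rel k C D)

theorem mk_rel {x y : FreeAlgebra k (Gen k C D)} (h : Rel k C D x y) : mk x = mk y :=
  RingQuot.mkAlgHom_rel k h

variable (C) in
/-- The element `1 ⊗ g`. -/
def right (g : Hm k D) : TwTensor k C D := mk (genR g)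

/-- The element `ε(f; gs)`; for the empty word it is `f ⊗ 1`. -/
def eps (f : Hm k C) : Conv k D (TwTensor k C D) := fun gs => mk (genE f gs)

variable (k C D) in
/-- The tautological solution. -/
def univ : TwData k C D (TwTensor k C D) where
  r := right C
  e := eps
  right_add a b := (mk_rel (.right_add a b)).trans (map_add _ _ _)
  right_smul c a := (mk_rel (.right_smul c a)).trans (map_smul _ _ _)
  right_one := (mk_rel .right_one).trans (map_one _)
  right_mul x y := (mk_rel (.right_mul x y)).trans (map_mul _ _ _)
  left_add a b := Conv.ext fun L => (mk_rel (.left_add a b L)).trans (map_add _ _ _)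
  left_smul c a := Conv.ext fun L => (mk_rel (.left_smul c a L)).trans (map_smul _ _ _)
  left_one_nil := (mk_rel .left_one_nil).trans (map_one _)
  left_one_cons g L := (mk_rel (.left_one_cons g L)).trans (map_zero _)
  word f := fun L =>
    ⟨fun a b R => (mk_rel (.word_add f L a b R)).trans (map_add _ _ _),
     fun c a R => (mk_rel (.word_smul f L c a R)).trans (map_smul _ _ _),
     fun R => (mk_rel (.word_one f L R)).trans (map_zero _)⟩
  left_mul x y L := (mk_rel (.left_mul x y L)).trans (by
    simp only [map_sum, map_smul, map_mul]
    rfl)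

/-- The universal property of the underlying algebra. -/
def lift (t : TwData k C D E) : TwTensor k C D →ₐ[k] E :=
  RingQuot.liftAlgHom k (s := Rel k C D)
    ⟨FreeAlgebra.lift k fun
      | .right g => t.r g
      | .eps f gs => t.e f gs, by
    have hr : ∀ g, FreeAlgebra.lift k (fun
      | .right g => t.r g
      | .eps f gs => t.e f gs) (genR (C := C) g) = t.r g := fun g => by
        rw [genR, FreeAlgebra.lift_ι_apply]
    have he : ∀ f L, FreeAlgebra.lift k (fun
      | .right g => t.r g
      | .eps f gs => t.e f gs) (genE f L) = t.e f L := fun f L => by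
        rw [genE, FreeAlgebra.lift_ι_apply]
    intro x y h
    cases h with
    | right_add a b => rw [map_add, hr, hr, hr, t.right_add]
    | right_smul c a => rw [map_smul, hr, hr, t.right_smul]
    | right_one => rw [hr, map_one, t.right_one]
    | right_mul x y => rw [map_mul, hr, hr, hr, t.right_mul]
    | left_add a b L => rw [map_add, he, he, he, t.left_add, Conv.add_apply]
    | left_smul c a L => rw [map_smul, he, he, t.left_smul, Conv.smul_apply]
    | left_one_nil => rw [he, map_one, t.left_one_nil]
    | left_one_cons g L => rw [he, map_zero, t.left_one_cons]
    | word_add f L a b R => rw [map_add, he, he, he, (t.word f L).add]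
    | word_smul f L c a R => rw [map_smul, he, he, (t.word f L).smul]
    | word_one f L R => rw [he, map_zero, (t.word f L).one]
    | left_mul x y L => 
      rw [he, t.left_mul, map_sum]
      refine Finset.sum_congr rfl fun i _ => ?_
      rw [map_smul, map_mul, he, he]⟩

theorem lift_right (t : TwData k C D E) (g : Hm k D) : lift t (right C g) = t.r g := by
  rw [lift, right, mk]
  erw [RingQuot.liftAlgHom_mkAlgHom_apply]
  rw [genR, FreeAlgebra.lift_ι_apply]

theorem lift_eps (t : TwData k C D E) (f : Hm k C) (L : List (Hm k D)) :
    lift t (eps f L) = t.e f L := by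
  rw [lift, eps, mk]
  erw [RingQuot.liftAlgHom_mkAlgHom_apply]
  rw [genE, FreeAlgebra.lift_ι_apply]

theorem induction {P : TwTensor k C D → Prop} (hc : ∀ c : k, P (algebraMap k _ c))
    (hr : ∀ g, P (right C g)) (he : ∀ f L, P (eps f L))
    (hmul : ∀ x y, P x → P y → P (x * y)) (hadd : ∀ x y, P x → P y → P (x + y))
    (x : TwTensor k C D) : P x := by
  obtain ⟨y, rfl⟩ : ∃ y, mk y = x := RingQuot.mkAlgHom_surjective k (Rel k C D) x
  induction y using FreeAlgebra.induction with
  | grade0 c => rw [AlgHom.commutes]; exact hc c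
  | grade1 g =>
    cases g with
    | right g => exact hr g
    | eps f L => exact he f L
  | mul a b ha hb => rw [map_mul]; exact hmul _ _ ha hb
  | add a b ha hb => rw [map_add]; exact hadd _ _ ha hb

theorem algHom_ext {f g : TwTensor k C D →ₐ[k] E} (hr : ∀ x, f (right C x) = g (right C x))
    (he : ∀ x L, f (eps x L) = g (eps x L)) : f = g := by
  ext x
  refine induction (P := fun x => f x = g x) (fun c => ?_) hr he (fun x y hx hy => ?_)
    (fun x y hx hy => ?_) x
  · rw [AlgHom.commutes, AlgHom.commutes]
  · rw [map_mul, map_mul, hx, hy]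
  · rw [map_add, map_add, hx, hy]

/-! ### The grading -/

/-- Homogeneous elements: `1 ⊗ g` has degree `deg g`, and `ε(f; g₁, …, gₙ)` has degree
`deg f + ∑ (deg gᵢ - 1)`. -/
inductive Homog : ℤ → TwTensor k C D → Prop
  | zero (n : ℤ) : Homog n 0
  | add {n : ℤ} {x y : TwTensor k C D} : Homog n x → Homog n y → Homog n (x + y)
  | smul {n : ℤ} (c : k) {x : TwTensor k C D} : Homog n x → Homog n (c • x)
  | one : Homog 0 1
  | mul {m n : ℤ} {x y : TwTensor k C D} : Homog m x → Homog n y → Homog (m + n) (x * y)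
  | right (g : Hm k D) : Homog g.deg (right C g)
  | eps (f : Hm k C) (L : List (Hm k D)) : Homog (f.deg + wdeg L) (eps f L)

variable (k C D) in
/-- The degree `n` part of the twisted tensor product. -/
def grT (n : ℤ) : Submodule k (TwTensor k C D) where
  carrier := {x | Homog n x}
  add_mem' := .add
  zero_mem' := .zero n
  smul_mem' c _ := .smul c

instance : SetLike.GradedMonoid (grT k C D) where
  one_mem := .one
  mul_mem _ _ _ _ := .mul

/-- Inclusion of a homogeneous element into the direct sum. -/
def inc (n : ℤ) (x : TwTensor k C D) (h : Homog n x) : ⨁ i, grT k C D i :=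
  DirectSum.lof k ℤ (fun i => grT k C D i) n ⟨x, h⟩

theorem inc_congr {m n : ℤ} {x y : TwTensor k C D} (h : m = n) (h' : x = y) (hx : Homog m x)
    (hy : Homog n y) : inc m x hx = inc n y hy := by
  subst h h'
  rfl

theorem inc_mul {m n p : ℤ} {x y : TwTensor k C D} (hx : Homog m x) (hy : Homog n y)
    (h : Homog p (x * y)) (e : m + n = p) : inc m x hx * inc n y hy = inc p (x * y) h := by
  subst e
  exact DirectSum.of_mul_of _ _

theorem inc_add {m : ℤ} {x y : TwTensor k C D} (hx : Homog m x) (hy : Homog m y)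
    (h : Homog m (x + y)) : inc m (x + y) h = inc m x hx + inc m y hy :=
  map_add (DirectSum.lof k ℤ (fun i => grT k C D i) m) ⟨x, hx⟩ ⟨y, hy⟩

theorem inc_smul {m : ℤ} (c : k) {x : TwTensor k C D} (hx : Homog m x) (h : Homog m (c • x)) :
    inc m (c • x) h = c • inc m x hx :=
  map_smul (DirectSum.lof k ℤ (fun i => grT k C D i) m) c ⟨x, hx⟩

theorem inc_zero {m : ℤ} (h : Homog m (0 : TwTensor k C D)) : inc m 0 h = 0 :=
  map_zero (DirectSum.lof k ℤ (fun i => grT k C D i) m)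

theorem inc_one (h : Homog 0 (1 : TwTensor k C D)) : inc 0 1 h = 1 := rfl

theorem inc_sum {ι : Type*} {m : ℤ} (s : Finset ι) (f : ι → TwTensor k C D)
    (hf : ∀ i, Homog m (f i)) (h : Homog m (∑ i ∈ s, f i)) :
    inc m (∑ i ∈ s, f i) h = ∑ i ∈ s, inc m (f i) (hf i) := by
  classical
  induction s using Finset.induction_on with
  | empty => simpa using inc_zero _
  | insert a s ha ih =>
    have hs : Homog m (∑ i ∈ s, f i) := (grT k C D m).sum_mem fun i _ => hf i
    refine (inc_congr rfl (Finset.sum_insert ha) _ (.add (hf a) hs)).trans ?_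
    refine (inc_add (hf a) hs _).trans ?_
    refine Eq.trans ?_ (Finset.sum_insert ha).symm
    rw [ih hs]

variable (k C D) in
/-- The solution that gives the decomposition into homogeneous parts. -/
def decData : TwData k C D (⨁ i, grT k C D i) where
  r g := inc _ _ (.right g)
  e f := fun L => inc _ _ (.eps f L)
  right_add a b := (inc_congr rfl ((univ k C D).right_add a b) _
    (.add (.right (Hm.of a)) (.right (Hm.of b)))).trans (inc_add _ _ _)
  right_smul c a := (inc_congr rfl ((univ k C D).right_smul c a) _
    (.smul c (.right (Hm.of a)))).trans (inc_smul _ _ _)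
  right_one := inc_congr rfl (univ k C D).right_one _ .one
  right_mul x y := by
    rw [inc_mul (.right x) (.right y) (.mul (.right x) (.right y)) rfl]
    exact inc_congr rfl ((univ k C D).right_mul x y) _ _
  left_add a b := Conv.ext fun L => (inc_congr rfl (congrFun ((univ k C D).left_add a b) L) _
    (.add (.eps (Hm.of a) L) (.eps (Hm.of b) L))).trans (inc_add _ _ _)
  left_smul c a := Conv.ext fun L => (inc_congr rfl (congrFun ((univ k C D).left_smul c a) L) _
    (.smul c (.eps (Hm.of a) L))).trans (inc_smul _ _ _)
  left_one_nil := inc_congr rfl (univ k C D).left_one_nil _ .one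
  left_one_cons g L :=
    (inc_congr rfl ((univ k C D).left_one_cons g L) _ (.zero _)).trans (inc_zero _)
  word f L :=
   ⟨fun {p} a b R => by
      have e1 : wdeg (L ++ Hm.of (a + b) :: R) = wdeg (L ++ Hm.of a :: R) := by
        simp [Hm.of, Hm.sdeg]
      have e2 : wdeg (L ++ Hm.of b :: R) = wdeg (L ++ Hm.of a :: R) := by
        simp [Hm.of, Hm.sdeg]
      have hb := Homog.eps (C := C) f (L ++ Hm.of b :: R)
      rw [e2] at hb
      rw [inc_congr (congrArg (f.deg + ·) e2) rfl _ hb]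
      exact (inc_congr (congrArg (f.deg + ·) e1) (((univ k C D).word f L).add a b R) _
        (.add (.eps _ _) hb)).trans (inc_add _ _ _),
    fun {p} c a R => by
      have e1 : wdeg (L ++ Hm.of (c • a) :: R) = wdeg (L ++ Hm.of a :: R) := by
        simp [Hm.of, Hm.sdeg]
      exact (inc_congr (congrArg (f.deg + ·) e1) (((univ k C D).word f L).smul c a R) _
        (.smul c (.eps _ _))).trans (inc_smul _ _ _),
    fun R => (inc_congr rfl (((univ k C D).word f L).one R) _ (.zero _)).trans (inc_zero _)⟩
  left_mul x y L := by
    have e : ∀ i, x.deg + wdeg (L.take i) + (y.deg + wdeg (L.drop i)) =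
        (x.mul y).deg + wdeg L := fun i => by
      conv_rhs => rw [← List.take_append_drop i L, wdeg_append]
      rw [Hm.mul]
      ring
    have h : ∀ i, Homog ((x.mul y).deg + wdeg L)
        (eps (D := D) x (L.take i) * eps y (L.drop i)) := fun i => by
      rw [← e i]
      exact .mul (.eps _ _) (.eps _ _)
    refine (inc_congr rfl ((univ k C D).left_mul x y L) _
      ((grT k C D _).sum_mem fun i _ => .smul _ (h i))).trans ?_
    refine (inc_sum _ _ (fun i => .smul _ (h i)) _).trans ?_
    refine Finset.sum_congr rfl fun i _ => ?_
    refine (inc_smul _ (h i) _).trans ?_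
    exact congrArg (fun z => sg k (y.deg * wdeg (L.take i)) • z)
      (inc_mul (.eps _ _) (.eps _ _) (h i) (e i)).symm

theorem lift_decData {n : ℤ} {x : TwTensor k C D} (h : Homog n x) :
    lift (decData k C D) x = inc n x h := by
  induction h with
  | zero n => rw [map_zero, inc_zero]
  | add hx hy ihx ihy => rw [map_add, ihx, ihy, ← inc_add]
  | smul c hx ih => rw [map_smul, ih, ← inc_smul]
  | one => rw [map_one, inc_one]
  | mul hx hy ihx ihy => rw [map_mul, ihx, ihy, inc_mul _ _ _ rfl]
  | right g => rw [lift_right]; rfl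
  | eps f L => rw [lift_eps]; rfl

instance gradedAlgebra : GradedAlgebra (grT k C D) :=
  GradedAlgebra.ofAlgHom _ (lift (decData k C D))
    (algHom_ext
      (fun x => by
        rw [AlgHom.comp_apply, lift_decData (.right x)]
        exact DirectSum.coeAlgHom_of _ _ _)
      (fun f L => by
        rw [AlgHom.comp_apply, lift_decData (.eps f L)]
        exact DirectSum.coeAlgHom_of _ _ _))
    (fun i x => lift_decData x.2)

instance : GrAlgebra k (TwTensor k C D) := ⟨grT k C D, gradedAlgebra⟩

end TwTensor

namespace Hm
variable {k A : Type*} [Field k] [Ring A] [Algebra k A]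
@[simp] theorem d_val [DGAlgebra k A] (x : Hm k A) : x.d.val = dif k x.val := rfl
@[simp] theorem one_val [GrAlgebra k A] : (one : Hm k A).val = 1 := rfl
@[simp] theorem mul_val [GrAlgebra k A] (x y : Hm k A) : (x.mul y).val = x.val * y.val := rfl
@[simp] theorem of_val [GrAlgebra k A] {p : ℤ} (a : gr k (A := A) p) : (of a).val = a := rfl
end Hm

section ofHm
variable {k A E : Type*} [Field k] [Ring A] [Algebra k A] [GrAlgebra k A] [Ring E] [Algebra k E]

/-- Linear extension of a function on homogeneous elements. -/
def linOfHm (r : Hm k A → E)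
    (hadd : ∀ {p : ℤ} (a b : gr k (A := A) p), r (Hm.of (a + b)) = r (Hm.of a) + r (Hm.of b))
    (hsmul : ∀ {p : ℤ} (c : k) (a : gr k (A := A) p), r (Hm.of (c • a)) = c • r (Hm.of a)) :
    A →ₗ[k] E :=
  (DirectSum.toModule k ℤ E (fun p =>
    { toFun := fun a : gr k (A := A) p => r (Hm.of a), map_add' := hadd, map_smul' := hsmul })) ∘ₗ
    (decomposeLinearEquiv (GrAlgebra.gr (k := k) (A := A))).toLinearMap

theorem linOfHm_val (r : Hm k A → E) (hadd) (hsmul) (x : Hm k A) :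
    linOfHm r hadd hsmul x.val = r x := by
  simp only [linOfHm, LinearMap.comp_apply, LinearEquiv.coe_coe, decomposeLinearEquiv_apply]
  rw [decompose_of_mem _ x.mem, ← DirectSum.lof_eq_of k, DirectSum.toModule_lof]
  rfl

/-- Extension of a multiplicative function on homogeneous elements to an algebra homomorphism. -/
def algOfHm (r : Hm k A → E)
    (hadd : ∀ {p : ℤ} (a b : gr k (A := A) p), r (Hm.of (a + b)) = r (Hm.of a) + r (Hm.of b))
    (hsmul : ∀ {p : ℤ} (c : k) (a : gr k (A := A) p), r (Hm.of (c • a)) = c • r (Hm.of a))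
    (hone : r Hm.one = 1) (hmul : ∀ x y, r (Hm.mul x y) = r x * r y) : A →ₐ[k] E :=
  AlgHom.ofLinearMap (linOfHm r hadd hsmul)
    ((linOfHm_val r hadd hsmul Hm.one).trans hone) (by
    intro x y
    refine gr_induction k (P := fun x => linOfHm r hadd hsmul (x * y) =
      linOfHm r hadd hsmul x * linOfHm r hadd hsmul y) (fun p x hx => ?_)
      (fun x x' hx hx' => by rw [add_mul, map_add, map_add, add_mul, hx, hx']) x
    refine gr_induction k (P := fun y => linOfHm r hadd hsmul (x * y) =
      linOfHm r hadd hsmul x * linOfHm r hadd hsmul y) (fun q y hy => ?_)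
      (fun y y' hy hy' => by rw [mul_add, map_add, map_add, mul_add, hy, hy']) y
    have h := linOfHm_val r hadd hsmul (Hm.mul ⟨p, x, hx⟩ ⟨q, y, hy⟩)
    rw [hmul, ← linOfHm_val r hadd hsmul, ← linOfHm_val r hadd hsmul] at h
    exact h)

theorem algOfHm_val (r : Hm k A → E) (hadd) (hsmul) (hone) (hmul) (x : Hm k A) :
    algOfHm r hadd hsmul hone hmul x.val = r x := linOfHm_val r hadd hsmul x

end ofHm

namespace TwTensor

section
variable (k C D : Type*) [Field k] [Ring C] [Algebra k C] [GrAlgebra k C]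
  [Ring D] [Algebra k D] [GrAlgebra k D]

/-- The map `d ↦ 1 ⊗ d`. -/
def inr : D →ₐ[k] TwTensor k C D :=
  algOfHm (right C) (univ k C D).right_add (univ k C D).right_smul (univ k C D).right_one
    (univ k C D).right_mul

/-- The map `c ↦ c ⊗ 1`. -/
def inl : C →ₐ[k] TwTensor k C D :=
  algOfHm (fun f => eps f []) (fun a b => congrFun ((univ k C D).left_add a b) [])
    (fun c a => congrFun ((univ k C D).left_smul c a) []) (univ k C D).left_one_nil
    (fun x y => ((univ k C D).left_mul x y []).trans (by simp; rfl))

variable {k C D}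

theorem inr_val (g : Hm k D) : inr k C D g.val = right C g := algOfHm_val _ _ _ _ _ g
theorem inl_val (f : Hm k C) : inl k C D f.val = eps f [] := algOfHm_val _ _ _ _ _ f

theorem isGr_inr : IsGr (inr k C D) := fun n x hx => by
  rw [inr_val ⟨n, x, hx⟩]
  exact Homog.right (C := C) (⟨n, x, hx⟩ : Hm k D)

theorem eps_hasDeg (f : Hm k C) : (eps (D := D) f).HasDeg f.deg := fun L => Homog.eps f L

theorem eps_isCochain (f : Hm k C) : (eps (D := D) f).IsCochain := (univ k C D).word f

theorem eps_mul (x y : Hm k C) : eps (D := D) (x.mul y) = eps x * eps y := by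
  ext L
  refine ((univ k C D).left_mul x y L).trans ?_
  rw [Conv.mul_def]
  refine Finset.sum_congr rfl fun i _ => ?_
  rw [sgn_of_mem k _ (eps_hasDeg y _), mul_smul_comm, smul_smul, mul_add, sg_add, mul_comm (sg k _),
    mul_assoc, sg_mul_self, mul_one, mul_comm y.deg]
  rfl

theorem eps_one : eps (Hm.one : Hm k C) = (1 : Conv k D _) := by
  ext L
  cases L with
  | nil => exact (univ k C D).left_one_nil
  | cons g L => exact (univ k C D).left_one_cons g L

theorem gr_le {n : ℤ} {x : TwTensor k C D} (h : x ∈ gr k n) : Homog n x := h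

end

section
variable (k C D : Type*) [Field k] [Ring C] [Algebra k C] [DGAlgebra k C]
  [Ring D] [Algebra k D] [DGAlgebra k D]

variable {k C D} in
/-- The differential of `ε(f; -)`, as a function on words. -/
def deps (f : Hm k C) : Conv k D (TwTensor k C D) := eps f.d - Conv.dtw (inr k C D) (eps f)

variable {k C D} in
/-- The matrix with entries `σ x, a, 0, x`. -/
def umat : (TwTensor k C D × TwTensor k C D) →ₗ[k] Matrix (Fin 2) (Fin 2) (TwTensor k C D) where
  toFun p := !![sgn k 1 p.1, p.2; 0, p.1]
  map_add' p q := by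
    ext i j; fin_cases i <;> fin_cases j <;> simp
  map_smul' c p := by
    ext i j; fin_cases i <;> fin_cases j <;> simp

variable {k C D}

theorem umat_mul (x y a b : TwTensor k C D) :
    umat (x, a) * umat (y, b) = umat (x * y, sgn k 1 x * b + a * y) := by
  simp [umat, Matrix.mul_fin_two]

theorem umat_one : umat ((1 : TwTensor k C D), 0) = 1 := by
  simp [umat, Matrix.one_fin_two]

theorem deps_lin {c c' : k} {x y z : Hm k C} (h : Hm.Lin c c' x y z)
    (he : ∀ {x y z : Hm k C}, Hm.Lin c c' x y z → eps (D := D) z = c • eps x + c' • eps y) :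
    deps (D := D) z = c • deps x + c' • deps y := by
  rw [deps, deps, deps, he h, he h.d, Conv.dtw_add, Conv.dtw_smul, Conv.dtw_smul]
  simp only [smul_sub]
  abel

theorem eps_lin {c c' : k} {x y z : Hm k C} (h : Hm.Lin c c' x y z) :
    eps (D := D) z = c • eps x + c' • eps y := by
  obtain ⟨q, z, hz⟩ := z
  obtain ⟨p, x, hx⟩ := x
  obtain ⟨r, y, hy⟩ := y
  obtain ⟨h1, h2, h3⟩ := h
  dsimp only at h1 h2 h3
  subst h1 h2
  have : (⟨_, z, hz⟩ : Hm k C) = Hm.of (c • ⟨x, hx⟩ + c' • ⟨y, hy⟩ : gr k (A := C) _) :=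
    Hm.of_congr rfl h3
  rw [this]
  refine ((univ k C D).left_add _ _).trans ?_
  exact congrArg₂ (· + ·) ((univ k C D).left_smul _ _) ((univ k C D).left_smul _ _)

theorem deps_isCochain (f : Hm k C) : (deps (D := D) f).IsCochain :=
  (eps_isCochain _).sub ((eps_isCochain f).dtw isGr_inr)

theorem deps_hasDeg (f : Hm k C) : (deps (D := D) f).HasDeg (f.deg + 1) := fun L =>
  sub_mem (eps_hasDeg f.d L) ((eps_hasDeg f).dtw isGr_inr L)

theorem right_eq (g : Hm k D) : right C g = inr k C D g.val := (inr_val g).symm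

theorem deps_mul (x y : Hm k C) :
    deps (D := D) (x.mul y) = deps x * eps y + Conv.tw 1 (eps x) * deps y := by
  have h : Hm.Lin 1 (sg k x.deg) (x.d.mul y) (x.mul y.d) (x.mul y).d :=
    ⟨add_right_comm _ _ _, (add_assoc _ _ _).symm, by
      simp only [Hm.d, Hm.mul, one_smul]
      exact DGAlgebra.d_mul _ _ _ x.mem⟩
  rw [deps, eps_lin h, eps_mul, eps_mul, eps_mul, Conv.dtw_mul, one_smul, deps, deps,
    (eps_hasDeg x).tw, one_mul]
  simp only [sub_mul, mul_sub, smul_mul_assoc]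
  abel

theorem deps_one : deps (Hm.one : Hm k C) = (0 : Conv k D _) := by
  have h : Hm.Lin 0 0 Hm.one.d Hm.one.d (Hm.one : Hm k C).d := ⟨rfl, rfl, by
    rw [Hm.d_val, Hm.one_val, dif_one]; simp⟩
  have h1 : Conv.dtw (inr k C D) 1 = 0 := by
    have := Conv.dtw_mul (inr k C D) 1 1
    simpa using this
  rw [deps, eps_lin h, eps_one, h1]
  simp

theorem umat_left_mul (x y : Hm k C) (L : List (Hm k D)) :
    umat (eps (x.mul y) L, deps (x.mul y) L) = ∑ i ∈ Finset.range (L.length + 1),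
        sg k (y.deg * wdeg (L.take i)) • (umat (eps x (L.take i), deps x (L.take i)) *
          umat (eps y (L.drop i), deps y (L.drop i))) := by
  have h1 : ((eps (x.mul y) L : TwTensor k C D), deps (x.mul y) L) =
      ∑ i ∈ Finset.range (L.length + 1), sg k (y.deg * wdeg (L.take i)) •
        ((eps x (L.take i) * eps y (L.drop i) : TwTensor k C D),
          sgn k 1 (eps x (L.take i)) * deps y (L.drop i) + deps x (L.take i) * eps y (L.drop i)) := by
    refine Prod.ext ?_ ?_
    · rw [Prod.fst_sum]
      exact (univ k C D).left_mul x y L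
    · rw [Prod.snd_sum]
      simp only [Prod.smul_snd]
      rw [deps_mul, Conv.add_apply, Conv.mul_def, Conv.mul_def, ← Finset.sum_add_distrib]
      refine Finset.sum_congr rfl fun i _ => ?_
      rw [sgn_of_mem k _ (eps_hasDeg y _), sgn_of_mem k _ (deps_hasDeg y _), Conv.tw_apply,
        smul_mul_assoc, mul_smul_comm, mul_smul_comm, smul_smul, smul_smul, smul_smul, smul_add,
        add_comm]
      simp only [mul_add, sg_add, mul_one, one_mul, mul_comm y.deg]
      have h1 := sg_mul_self k (wdeg (L.take i))
      have h2 := sg_mul_self k (wdeg (L.take i) * wdeg (L.drop i))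
      congr 2
      · linear_combination (sg k (wdeg (L.take i) * y.deg)) *
          (sg k (wdeg (L.take i)) * sg k (wdeg (L.take i)) * h2 + h1)
      · linear_combination (sg k (wdeg (L.take i) * y.deg)) * h2
  rw [h1, map_sum]
  simp only [map_smul, umat_mul]

variable (k C D) in
/-- The solution of the relations that defines the differential. -/
def difData : TwData k C D (Matrix (Fin 2) (Fin 2) (TwTensor k C D)) where
  r g := umat (right C g, right C g.d)
  e f := fun L => umat (eps f L, deps f L)
  right_add a b := by
    rw [← map_add, Prod.mk_add_mk]
    simp [right_eq]
  right_smul c a := by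
    rw [← map_smul, Prod.smul_mk]
    simp [right_eq]
  right_one := by
    rw [right_eq, right_eq, Hm.d_val, Hm.one_val, dif_one, map_zero, map_one]
    exact umat_one
  right_mul x y := by
    have h : dif k (x.mul y).val = dif k x.val * y.val + sg k x.deg • (x.val * dif k y.val) :=
      DGAlgebra.d_mul _ _ _ x.mem
    have h' : (x.mul y).val = x.val * y.val := rfl
    rw [umat_mul]
    simp only [right_eq, Hm.d]
    rw [h, h', sgn_of_mem k _ (isGr_inr _ _ x.mem), map_mul, map_add, map_smul, map_mul, map_mul,
      one_mul, smul_mul_assoc, add_comm]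
  left_add a b := Conv.ext fun L => by
    rw [eps_lin (Hm.Lin.add a b), deps_lin (Hm.Lin.add a b) eps_lin]
    simp only [one_smul, Conv.add_apply]
    exact map_add umat (_, _) (_, _)
  left_smul c a := Conv.ext fun L => by
    rw [eps_lin (Hm.Lin.smul c a), deps_lin (Hm.Lin.smul c a) eps_lin]
    simp only [zero_smul, add_zero, Conv.smul_apply]
    exact map_smul umat c (_, _)
  left_one_nil := by
    rw [eps_one, deps_one]; exact umat_one
  left_one_cons g L := by
    rw [eps_one, deps_one]
    exact map_zero umat
  word f L := ⟨fun a b R => by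
      rw [(eps_isCochain f L).add, (deps_isCochain f L).add, ← Prod.mk_add_mk, map_add],
    fun c a R => by
      rw [(eps_isCochain f L).smul, (deps_isCochain f L).smul, ← Prod.smul_mk, map_smul],
    fun R => by
      rw [(eps_isCochain f L).one, (deps_isCochain f L).one]
      exact map_zero umat⟩
  left_mul := umat_left_mul

theorem lift_difData (x : TwTensor k C D) : ∃ a, lift (difData k C D) x = umat (x, a) := by
  refine induction (P := fun x => ∃ a, lift (difData k C D) x = umat (x, a)) (fun c => ⟨0, ?_⟩) (fun g => ⟨_, lift_right _ _⟩) (fun f L => ⟨_, lift_eps _ _ _⟩)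
    ?_ ?_ x
  · rw [AlgHom.commutes, Algebra.algebraMap_eq_smul_one, Algebra.algebraMap_eq_smul_one,
      ← umat_one, ← map_smul]
    simp
  · rintro x y ⟨a, ha⟩ ⟨b, hb⟩
    exact ⟨_, by rw [map_mul, ha, hb, umat_mul]⟩
  · rintro x y ⟨a, ha⟩ ⟨b, hb⟩
    exact ⟨_, by rw [map_add, ha, hb, ← map_add, Prod.mk_add_mk]⟩

variable (k C D) in
/-- The differential of the twisted tensor product: the derivation that is given on the generators
by `d (1 ⊗ g) = 1 ⊗ d g` and `d ε(f; -) = ε(d f; -) - dtw ε(f; -)`. -/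
def difT : TwTensor k C D →ₗ[k] TwTensor k C D where
  toFun x := lift (difData k C D) x 0 1
  map_add' x y := by rw [map_add]; rfl
  map_smul' c x := by rw [map_smul]; rfl

theorem lift_eq (x : TwTensor k C D) : lift (difData k C D) x = umat (x, difT k C D x) := by
  obtain ⟨a, ha⟩ := lift_difData x
  have : difT k C D x = a := by
    change lift (difData k C D) x 0 1 = a
    rw [ha]
    rfl
  rw [this, ha]

theorem difT_mul (x y : TwTensor k C D) :
    difT k C D (x * y) = sgn k 1 x * difT k C D y + difT k C D x * y := by
  change lift (difData k C D) (x * y) 0 1 = _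
  rw [map_mul, lift_eq, lift_eq, umat_mul]
  rfl

theorem difT_right (g : Hm k D) : difT k C D (right C g) = right C g.d := by
  change lift (difData k C D) _ 0 1 = _
  rw [lift_right]
  rfl

theorem difT_eps (f : Hm k C) (L : List (Hm k D)) : difT k C D (eps f L) = deps f L := by
  change lift (difData k C D) _ 0 1 = _
  rw [lift_eps]
  rfl

theorem difT_one : difT k C D 1 = 0 := by
  have := difT_mul (k := k) (C := C) (D := D) 1 1
  simpa using this

theorem difT_mem {n : ℤ} {x : TwTensor k C D} (h : Homog n x) : Homog (n + 1) (difT k C D x) := by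
  induction h with
  | zero n => rw [map_zero]; exact .zero _
  | add hx hy ihx ihy => rw [map_add]; exact .add ihx ihy
  | smul c hx ih => rw [map_smul]; exact .smul c ih
  | one => rw [difT_one]; exact .zero _
  | @mul m n x y hx hy ihx ihy =>
    rw [difT_mul, sgn_of_mem k 1 (show x ∈ gr k m from hx), smul_mul_assoc]
    refine .add (.smul _ ?_) ?_
    · rw [add_assoc]; exact .mul hx ihy
    · rw [add_right_comm]; exact .mul ihx hy
  | right g => rw [difT_right]; exact .right g.d
  | eps f L =>
    rw [difT_eps, add_right_comm]
    exact deps_hasDeg f L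

theorem isDer_difT : IsDer (difT k C D) :=
  ⟨fun _ _ h => difT_mem h, fun n x y h => by
    rw [difT_mul, sgn_of_mem k 1 h, one_mul, smul_mul_assoc, add_comm]⟩

theorem post_difT (f : Hm k C) : Conv.post (difT k C D) (eps f) = deps f :=
  Conv.ext fun L => difT_eps f L

theorem difT_difT_eps (f : Hm k C) (L : List (Hm k D)) :
    difT k C D (difT k C D (eps f L)) = 0 := by
  have h1 : ∀ f : Hm k C, Conv.hd (difT k C D) (inr k C D) (eps f) = eps f.d := fun f => by
    rw [Conv.hd_apply, post_difT, deps, sub_add_cancel]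
  have h2 := Conv.hd_hd isDer_difT isGr_inr (F := inr k C D) (fun x => by
    rw [inr_val, difT_right, right_eq]; rfl) (eps_isCochain f)
  rw [h1, h1] at h2
  have h : Hm.Lin 0 0 f.d.d f.d.d f.d.d := ⟨rfl, rfl, by
    rw [Hm.d_val, Hm.d_val, show dif k (dif k f.val) = 0 from DGAlgebra.d_d f.val]; simp⟩
  rw [eps_lin h] at h2
  refine (congrFun h2 L).symm.trans ?_
  simp

theorem difT_difT (x : TwTensor k C D) : difT k C D (difT k C D x) = 0 := by
  refine induction (P := fun x => difT k C D (difT k C D x) = 0) (fun c => ?_) (fun g => ?_) difT_difT_eps (fun x y hx hy => ?_)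
    (fun x y hx hy => ?_) x
  · rw [Algebra.algebraMap_eq_smul_one, map_smul, difT_one, smul_zero, map_zero]
  · have h : g.d.d.val = 0 := DGAlgebra.d_d g.val
    rw [difT_right, difT_right, right_eq, h, map_zero]
  · rw [difT_mul, map_add, difT_mul, difT_mul, hx, hy, isDer_difT.map_sgn]
    simp
  · rw [map_add, map_add, hx, hy, add_zero]

instance : DGAlgebra k (TwTensor k C D) where
  d := difT k C D
  d_mem := isDer_difT.mem
  d_mul := isDer_difT.mul
  d_d := difT_difT

end

end TwTensor

/-- Morphisms of graded algebras. -/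
structure GrHom (k A B : Type*) [Field k] [Ring A] [Algebra k A] [GrAlgebra k A]
    [Ring B] [Algebra k B] [GrAlgebra k B] extends A →ₐ[k] B where
  isGr : IsGr toAlgHom

/-- Morphisms of dg algebras. -/
structure DGHom (k A B : Type*) [Field k] [Ring A] [Algebra k A] [DGAlgebra k A]
    [Ring B] [Algebra k B] [DGAlgebra k B] extends GrHom k A B where
  map_d : ∀ x : A, toAlgHom (dif k x) = dif k (toAlgHom x)

namespace GrHom
variable {k A B C : Type*} [Field k] [Ring A] [Algebra k A] [GrAlgebra k A]
    [Ring B] [Algebra k B] [GrAlgebra k B] [Ring C] [Algebra k C] [GrAlgebra k C]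

instance : CoeFun (GrHom k A B) (fun _ => A → B) := ⟨fun f => f.toAlgHom⟩

/-- Composition `g ∘ f`. -/
def comp (g : GrHom k B C) (f : GrHom k A B) : GrHom k A C :=
  ⟨g.toAlgHom.comp f.toAlgHom, fun n x hx => g.isGr n _ (f.isGr n x hx)⟩

variable (k A) in
/-- The identity. -/
def id : GrHom k A A := ⟨AlgHom.id k A, fun _ _ hx => hx⟩

end GrHom

namespace DGHom
variable {k A B C : Type*} [Field k] [Ring A] [Algebra k A] [DGAlgebra k A]
    [Ring B] [Algebra k B] [DGAlgebra k B] [Ring C] [Algebra k C] [DGAlgebra k C]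

instance : CoeFun (DGHom k A B) (fun _ => A → B) := ⟨fun f => f.toAlgHom⟩

variable (k A) in
/-- The identity. -/
def id : DGHom k A A := ⟨GrHom.id k A, fun _ => rfl⟩

end DGHom

namespace Hm
variable {k A B : Type*} [Field k] [Ring A] [Algebra k A] [GrAlgebra k A]
    [Ring B] [Algebra k B] [GrAlgebra k B]

/-- The image of a homogeneous element. -/
def map (f : GrHom k A B) (x : Hm k A) : Hm k B := ⟨x.deg, f x.val, f.isGr _ _ x.mem⟩

@[simp] theorem map_val (f : GrHom k A B) (x : Hm k A) : (map f x).val = f x.val := rfl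
@[simp] theorem map_deg (f : GrHom k A B) (x : Hm k A) : (map f x).deg = x.deg := rfl
@[simp] theorem map_sdeg (f : GrHom k A B) (x : Hm k A) : (map f x).sdeg = x.sdeg := rfl

theorem Lin.map {c c' : k} {x y z : Hm k A} (h : Lin c c' x y z) (f : GrHom k A B) :
    Lin c c' (x.map f) (y.map f) (z.map f) :=
  ⟨h.dx, h.dy, by simp [h.val]⟩

theorem map_one (f : GrHom k A B) : map f one = one := Hm.ext rfl (_root_.map_one f.toAlgHom)

@[simp] theorem wdeg_map (f : GrHom k A B) (L : List (Hm k A)) : wdeg (L.map (map f)) = wdeg L := by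
  induction L with
  | nil => rfl
  | cons h L ih => simp [ih]

end Hm

section Cochains

variable (k D E : Type*) [Field k] [Ring D] [Algebra k D] [GrAlgebra k D]
  [Ring E] [Algebra k E] [GrAlgebra k E]

/-- The normalized cochains of degree `n`. -/
def cochainDeg (n : ℤ) : Submodule k (Conv k D E) where
  carrier := {φ | φ.IsCochain ∧ φ.HasDeg n}
  add_mem' h h' := ⟨h.1.add h'.1, fun L => add_mem (h.2 L) (h'.2 L)⟩
  zero_mem' := ⟨.zero, fun _ => zero_mem _⟩
  smul_mem' c _ h := ⟨h.1.smul c, fun L => Submodule.smul_mem _ _ (h.2 L)⟩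

variable {k D E} in
theorem iSup_cochain_induction {P : Conv k D E → Prop}
    (h : ∀ n φ, φ ∈ cochainDeg k D E n → P φ) (hadd : ∀ φ ψ, P φ → P ψ → P (φ + ψ))
    {φ : Conv k D E} (hφ : φ ∈ ⨆ n, cochainDeg k D E n) : P φ :=
  Submodule.iSup_induction _ (motive := P) hφ (fun n x hx => h n x hx) (h 0 0 (zero_mem _)) hadd

theorem cochainDeg_mul {m n : ℤ} {φ ψ : Conv k D E} (h : φ ∈ cochainDeg k D E m)
    (h' : ψ ∈ cochainDeg k D E n) : φ * ψ ∈ cochainDeg k D E (m + n) :=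
  ⟨h.1.mul h'.1, h.2.mul h'.2⟩

/-- The algebra of normalized cochains: finite sums of homogeneous normalized cochains, with the cup
product. -/
def cochainAlg : Subalgebra k (Conv k D E) :=
  (⨆ n, cochainDeg k D E n).toSubalgebra
    (Submodule.mem_iSup_of_mem 0 ⟨.one, .one⟩)
    (fun φ ψ hφ hψ => by
      refine iSup_cochain_induction (P := fun φ => φ * ψ ∈ ⨆ n, cochainDeg k D E n)
        (fun m φ hφ => ?_) (fun φ φ' h h' => by rw [add_mul]; exact add_mem h h') hφ
      refine iSup_cochain_induction (P := fun ψ => φ * ψ ∈ ⨆ n, cochainDeg k D E n)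
        (fun n ψ hψ => ?_) (fun ψ ψ' h h' => by rw [mul_add]; exact add_mem h h') hψ
      exact Submodule.mem_iSup_of_mem (m + n) (cochainDeg_mul k D E hφ hψ))

/-- The type of normalized cochains. -/
def Cochains : Type _ := cochainAlg k D E

instance : Ring (Cochains k D E) := inferInstanceAs (Ring (cochainAlg k D E))
instance : Algebra k (Cochains k D E) := inferInstanceAs (Algebra k (cochainAlg k D E))

/-- The underlying function on words of a cochain. -/
def Cochains.val : Cochains k D E →ₐ[k] Conv k D E := (cochainAlg k D E).val

theorem Cochains.val_injective : Function.Injective (Cochains.val k D E) := Subtype.val_injective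

/-- The cochains of degree `n`. -/
def grC (n : ℤ) : Submodule k (Cochains k D E) :=
  (cochainDeg k D E n).comap (Cochains.val k D E).toLinearMap

variable {k D E}

/-- A homogeneous cochain. -/
def Cochains.ofDeg {n : ℤ} (φ : Conv k D E) (h : φ ∈ cochainDeg k D E n) : Cochains k D E :=
  ⟨φ, Submodule.mem_iSup_of_mem n h⟩

@[simp] theorem Cochains.val_ofDeg {n : ℤ} (φ : Conv k D E) (h : φ ∈ cochainDeg k D E n) :
    Cochains.val k D E (Cochains.ofDeg φ h) = φ := rfl

theorem Cochains.mem_gr {n : ℤ} {φ : Cochains k D E} :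
    φ ∈ grC k D E n ↔ (Cochains.val k D E φ).IsCochain ∧ (Cochains.val k D E φ).HasDeg n := Iff.rfl

theorem Cochains.induction {P : Cochains k D E → Prop}
    (h : ∀ n φ, φ ∈ grC k D E n → P φ) (hadd : ∀ φ ψ, P φ → P ψ → P (φ + ψ))
    (φ : Cochains k D E) : P φ := by
  obtain ⟨φ, hφ⟩ := φ
  have : ∃ h' : φ ∈ ⨆ n, cochainDeg k D E n, P ⟨φ, h'⟩ := by
    refine iSup_cochain_induction (P := fun φ => ∃ h' : φ ∈ ⨆ n, cochainDeg k D E n, P ⟨φ, h'⟩)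
      (fun n φ hφ => ⟨Submodule.mem_iSup_of_mem n hφ, h n _ hφ⟩) ?_ hφ
    rintro φ ψ ⟨h1, h2⟩ ⟨h3, h4⟩
    exact ⟨add_mem h1 h3, hadd _ _ h2 h4⟩
  exact this.2

theorem Cochains.isCochain (φ : Cochains k D E) : (Cochains.val k D E φ).IsCochain := by
  refine Cochains.induction (P := fun φ => (Cochains.val k D E φ).IsCochain)
    (fun n φ h => h.1) (fun φ ψ h h' => ?_) φ
  rw [map_add]
  exact h.add h'

instance : SetLike.GradedMonoid (grC k D E) where
  one_mem := ⟨.one, .one⟩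
  mul_mem _ _ _ _ h h' := by
    have := cochainDeg_mul k D E h h'
    exact this

variable (k D E) in
/-- The component of degree `n`. -/
def projC (n : ℤ) : Conv k D E →ₗ[k] Conv k D E where
  toFun φ := fun L => (decompose (GrAlgebra.gr (k := k) (A := E)) (φ L) (n + wdeg L) : E)
  map_add' φ ψ := by
    ext L
    change ((decompose (GrAlgebra.gr (k := k) (A := E)) (φ L + ψ L)) (n + wdeg L) : E) = _
    rw [decompose_add]
    rfl
  map_smul' c φ := by
    ext L
    change ((decompose (GrAlgebra.gr (k := k) (A := E)) (c • φ L)) (n + wdeg L) : E) = _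
    rw [decompose_smul]
    rfl

theorem projC_same {n : ℤ} {φ : Conv k D E} (h : φ.HasDeg n) : projC k D E n φ = φ :=
  Conv.ext fun L => decompose_of_mem_same _ (h L)

theorem projC_ne {m n : ℤ} (hmn : m ≠ n) {φ : Conv k D E} (h : φ.HasDeg m) : projC k D E n φ = 0 :=
  Conv.ext fun L => decompose_of_mem_ne _ (h L) (by omega)

theorem isInternal_grC : DirectSum.IsInternal (grC k D E) := by
  refine DirectSum.isInternal_submodule_of_iSupIndep_of_iSup_eq_top ?_ ?_
  · refine iSupIndep_of_dfinsupp_lsum_injective _ ?_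
    refine (injective_iff_map_eq_zero _).mpr fun f hf => ?_
    have key : ∀ (n : ℤ) (f : Π₀ i, grC k D E i), projC k D E n (Cochains.val k D E
        (DFinsupp.lsum ℕ (fun i => (grC k D E i).subtype) f)) = Cochains.val k D E (f n) := by
      intro n f
      induction f using DFinsupp.induction with
      | h0 => simp
      | ha i b f h1 h2 ih =>
        rw [map_add, map_add, map_add, ih, DFinsupp.add_apply, Submodule.coe_add, map_add]
        congr 1
        simp only [DFinsupp.lsum_single, Submodule.subtype_apply]
        have hb : (Cochains.val k D E b).HasDeg i := b.2.2
        by_cases hi : i = n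
        · subst hi
          rw [DFinsupp.single_eq_same, projC_same hb]
        · rw [projC_ne hi hb, DFinsupp.single_eq_of_ne (Ne.symm hi)]
          simp
    ext n : 1
    have := key n f
    rw [hf] at this
    refine Subtype.ext (Cochains.val_injective k D E ?_)
    rw [← this]
    simp
  · rw [eq_top_iff]
    intro φ _
    refine Cochains.induction (P := fun φ => φ ∈ ⨆ n, grC k D E n)
      (fun n φ h => Submodule.mem_iSup_of_mem n h) (fun φ ψ h h' => add_mem h h') φ

instance gradedC : GradedAlgebra (grC k D E) :=
  { isInternal_grC.chooseDecomposition with }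

instance : GrAlgebra k (Cochains k D E) := ⟨grC k D E, gradedC⟩

end Cochains

namespace Conv
variable {k C D D' E E' : Type*} [Field k] [Ring C] [Algebra k C]
  [Ring D] [Algebra k D] [Ring D'] [Algebra k D']
  [Ring E] [Algebra k E] [GrAlgebra k E] [Ring E'] [Algebra k E'] [GrAlgebra k E']

theorem sgn_map (f : GrHom k E E') (n : ℤ) (x : E) : sgn k n (f x) = f (sgn k n x) := by
  refine gr_induction k (P := fun x => sgn k n (f x) = f (sgn k n x)) (fun p x hx => ?_)
    (fun x x' hx hx' => by simp only [map_add, hx, hx']) x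
  rw [sgn_of_mem k n hx, sgn_of_mem k n (f.isGr _ _ hx), map_smul]

/-- Postcomposition with a morphism of graded algebras. -/
def postA [GrAlgebra k D] (f : GrHom k E E') : Conv k D E →ₐ[k] Conv k D E' :=
  AlgHom.ofLinearMap
    { toFun := fun φ => fun L => f (φ L)
      map_add' := fun φ ψ => funext fun L => map_add f.toAlgHom _ _
      map_smul' := fun c φ => funext fun L => map_smul f.toAlgHom _ _ }
    (ext_cons (map_one f.toAlgHom) fun h => Conv.ext fun L => map_zero f.toAlgHom)
    (fun φ ψ => Conv.ext fun L => by
      change f ((φ * ψ) L) = _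
      simp only [mul_def, map_sum, map_smul, map_mul, ← sgn_map]
      rfl)

@[simp] theorem postA_apply [GrAlgebra k D] (f : GrHom k E E') (φ : Conv k D E)
    (L : List (Hm k D)) : postA f φ L = f (φ L) := rfl

theorem postA_tw [GrAlgebra k D] (f : GrHom k E E') (n : ℤ) (φ : Conv k D E) :
    postA f (tw n φ) = tw n (postA f φ) := by
  ext L
  simp [tw_apply, sgn_map]

theorem postA_bar [DGAlgebra k D] (f : GrHom k E E') (φ : Conv k D E) :
    postA f (bar φ) = bar (postA f φ) := by
  ext L
  induction L generalizing φ with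
  | nil => simp
  | cons h L ih =>
    rw [postA_apply, bar_cons, bar_cons]
    have ih' : f (bar (cons h φ) L) = bar (cons h (postA f φ)) L := ih (cons h φ)
    rw [← ih']
    cases L <;> simp

theorem postA_dtw [DGAlgebra k D] (f : GrHom k E E') (F : D →ₐ[k] E) (F' : D →ₐ[k] E')
    (h : ∀ x, f (F x) = F' x) (φ : Conv k D E) : postA f (dtw F φ) = dtw F' (postA f φ) := by
  have ht : postA f (tau F) = tau (k := k) F' := Conv.ext fun L => by
    match L with
    | [] => simp
    | [x] => simp [h]
    | _ :: _ :: _ => simp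
  rw [dtw, dtw, map_sub, map_add, map_neg, map_mul, map_mul, postA_bar, postA_tw, ht]

theorem IsCochain.postA [GrAlgebra k D] {φ : Conv k D E} (hφ : IsCochain φ) (f : GrHom k E E') :
    IsCochain (postA f φ) := fun L =>
  ⟨fun a b R => by simp only [postA_apply, (hφ L).add, map_add],
   fun c a R => by simp only [postA_apply, (hφ L).smul, map_smul],
   fun R => by simp only [postA_apply, (hφ L).one, map_zero]⟩

theorem HasDeg.postA [GrAlgebra k D] {n : ℤ} {φ : Conv k D E} (hφ : HasDeg n φ)
    (f : GrHom k E E') : HasDeg n (postA f φ) := fun L => f.isGr _ _ (hφ L)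

/-- Precomposition with a morphism of graded algebras. -/
def pre [GrAlgebra k D] [GrAlgebra k D'] (g : GrHom k D' D) : Conv k D E →ₐ[k] Conv k D' E :=
  AlgHom.ofLinearMap
    { toFun := fun φ => fun L => φ (L.map (Hm.map g))
      map_add' := fun φ ψ => rfl
      map_smul' := fun c φ => rfl }
    (ext_cons rfl fun h => rfl)
    (fun φ ψ => Conv.ext fun L => by
      change (φ * ψ) (L.map (Hm.map g)) = _
      simp only [mul_def, List.length_map, ← List.map_take, ← List.map_drop, Hm.wdeg_map]
      rfl)

@[simp] theorem pre_apply [GrAlgebra k D] [GrAlgebra k D'] (g : GrHom k D' D) (φ : Conv k D E)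
    (L : List (Hm k D')) : pre g φ L = φ (L.map (Hm.map g)) := rfl

theorem IsCochain.pre [GrAlgebra k D] [GrAlgebra k D'] {φ : Conv k D E} (hφ : IsCochain φ)
    (g : GrHom k D' D) : IsCochain (pre g φ) :=
  isCochain_of_lin (fun c c' x y z h L R => by simpa using hφ.lin (h.map g) _ _)
    (fun L R => by simpa [Hm.map_one] using (hφ _).one _)

theorem HasDeg.pre [GrAlgebra k D] [GrAlgebra k D'] {n : ℤ} {φ : Conv k D E} (hφ : HasDeg n φ)
    (g : GrHom k D' D) : HasDeg n (pre g φ) := fun L => by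
  simpa using hφ (L.map (Hm.map g))

theorem mul_apply_of_hasDeg [GrAlgebra k D] {n : ℤ} (φ : Conv k D E) {ψ : Conv k D E}
    (h : HasDeg n ψ) (L : List (Hm k D)) : (φ * ψ) L = ∑ i ∈ Finset.range (L.length + 1),
      sg k (n * wdeg (L.take i)) • (φ (L.take i) * ψ (L.drop i)) := by
  rw [mul_def]
  refine Finset.sum_congr rfl fun i _ => ?_
  rw [sgn_of_mem k _ (h _), mul_smul_comm, smul_smul, mul_add, sg_add, mul_comm (sg k _),
    mul_assoc, sg_mul_self, mul_one, mul_comm]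

end Conv

section Hoch
variable {k D E : Type*} [Field k] [Ring D] [Algebra k D] [DGAlgebra k D]
  [Ring E] [Algebra k E] [DGAlgebra k E]

/-- The reduced Hochschild complex of `D` with coefficients in `E`, regarded as a `D`-bimodule
through `F`; this is the endomorphism dg algebra of `F` in the coherent internal Hom. -/
def Hoch (_ : DGHom k D E) : Type _ := Cochains k D E

instance (F : DGHom k D E) : Ring (Hoch F) := inferInstanceAs (Ring (Cochains k D E))
instance (F : DGHom k D E) : Algebra k (Hoch F) := inferInstanceAs (Algebra k (Cochains k D E))
instance (F : DGHom k D E) : GrAlgebra k (Hoch F) := inferInstanceAs (GrAlgebra k (Cochains k D E))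

/-- The underlying function on words of a Hochschild cochain. -/
def Hoch.val (F : DGHom k D E) : Hoch F →ₐ[k] Conv k D E := Cochains.val k D E

theorem Hoch.val_injective (F : DGHom k D E) : Function.Injective (Hoch.val F) :=
  Subtype.val_injective

theorem Hoch.induction {F : DGHom k D E} {P : Hoch F → Prop}
    (h : ∀ n φ, φ ∈ gr k n → P φ) (hadd : ∀ φ ψ, P φ → P ψ → P (φ + ψ)) (φ : Hoch F) : P φ :=
  gr_induction k h hadd φ

theorem Hoch.mem_gr {F : DGHom k D E} {n : ℤ} {φ : Hoch F} :
    φ ∈ gr k n ↔ (Hoch.val F φ).IsCochain ∧ (Hoch.val F φ).HasDeg n := Iff.rfl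

theorem hd_mem (F : DGHom k D E) {n : ℤ} {φ : Conv k D E} (h : φ ∈ cochainDeg k D E n) :
    Conv.hd (dif k) F.toAlgHom φ ∈ cochainDeg k D E (n + 1) :=
  ⟨(h.1.post _).add (h.1.dtw F.isGr), fun L => add_mem (h.2.post isDer_dif L) (h.2.dtw F.isGr L)⟩

/-- The Hochschild differential. -/
def hochD (F : DGHom k D E) : Hoch F →ₗ[k] Hoch F :=
  ((Conv.hd (dif k) F.toAlgHom).comp (Hoch.val F).toLinearMap).codRestrict
    (Subalgebra.toSubmodule (cochainAlg k D E)) (fun φ => by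
      refine Hoch.induction (P := fun φ => Conv.hd (dif k) F.toAlgHom (Hoch.val F φ) ∈
          ⨆ n, cochainDeg k D E n) (fun n φ h => ?_) (fun φ ψ h h' => ?_) φ
      · exact Submodule.mem_iSup_of_mem (n + 1) (hd_mem F h)
      · rw [map_add, map_add]
        exact add_mem h h')

theorem hochD_val (F : DGHom k D E) (φ : Hoch F) :
    Hoch.val F (hochD F φ) = Conv.hd (dif k) F.toAlgHom (Hoch.val F φ) := rfl

instance (F : DGHom k D E) : DGAlgebra k (Hoch F) where
  d := hochD F
  d_mem n φ h := by
    have := hd_mem F (φ := Hoch.val F φ) h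
    exact this
  d_mul n φ ψ h := by
    refine Hoch.val_injective F ?_
    have h2 : (Hoch.val F φ).HasDeg n := (Hoch.mem_gr.mp h).2
    rw [hochD_val, map_mul, Conv.hd_mul isDer_dif, h2.tw, one_mul, smul_mul_assoc, map_add,
      map_smul, map_mul (Hoch.val F), map_mul (Hoch.val F), hochD_val, hochD_val]
  d_d φ := by
    refine Hoch.val_injective F ?_
    rw [hochD_val, hochD_val, Conv.hd_hd isDer_dif F.isGr (fun x => (F.map_d x.val).symm)
      (show (Hoch.val F φ).IsCochain from Cochains.isCochain φ), map_zero]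
    ext L
    exact DGAlgebra.d_d _

end Hoch

namespace TwTensor

section gr
variable {k C D E : Type*} [Field k] [Ring C] [Algebra k C] [GrAlgebra k C]
  [Ring D] [Algebra k D] [GrAlgebra k D] [Ring E] [Algebra k E] [GrAlgebra k E]

/-- The solution of the relations that corresponds to `F : D → E` and `η` from `C` to cochains. -/
def ofHoms (F : GrHom k D E) (η : GrHom k C (Cochains k D E)) : TwData k C D E where
  r g := F g.val
  e f := Cochains.val k D E (η f.val)
  right_add a b := by simp
  right_smul c a := by simp
  right_one := by simp
  right_mul x y := by simp
  left_add a b := by simp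
  left_smul c a := by simp
  left_one_nil := by simp
  left_one_cons g L := by simp
  word f := Cochains.isCochain _
  left_mul x y L := by
    have hy : (Cochains.val k D E (η y.val)).HasDeg y.deg := (η.isGr _ _ y.mem).2
    rw [Hm.mul_val, map_mul, map_mul, Conv.mul_apply_of_hasDeg _ hy]

/-- The morphism of graded algebras out of the twisted tensor product that corresponds to `F` and
`η`. -/
def desc (F : GrHom k D E) (η : GrHom k C (Cochains k D E)) : GrHom k (TwTensor k C D) E where
  toAlgHom := lift (ofHoms F η)
  isGr n x hx := by
    have h := gr_le hx
    clear hx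
    induction h with
    | zero n => rw [map_zero]; exact zero_mem _
    | add hx hy ihx ihy => rw [map_add]; exact add_mem ihx ihy
    | smul c hx ih => rw [map_smul]; exact Submodule.smul_mem _ _ ih
    | one => rw [map_one]; exact gr_one k
    | mul hx hy ihx ihy => rw [map_mul]; exact gr_mul k ihx ihy
    | right g => rw [lift_right]; exact F.isGr _ _ g.mem
    | eps f L => rw [lift_eps]; exact (η.isGr _ _ f.mem).2 L

theorem desc_right (F : GrHom k D E) (η : GrHom k C (Cochains k D E)) (g : Hm k D) :
    desc F η (right C g) = F g.val := lift_right _ _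

theorem desc_eps (F : GrHom k D E) (η : GrHom k C (Cochains k D E)) (f : Hm k C)
    (L : List (Hm k D)) : desc F η (eps f L) = Cochains.val k D E (η f.val) L := lift_eps _ _ _

variable (k C D) in
/-- `inr` as a morphism of graded algebras. -/
def inrG : GrHom k D (TwTensor k C D) := ⟨inr k C D, isGr_inr⟩

variable (k C D) in
/-- The universal cochains: `f ↦ ε(f; -)`. -/
def epsA : C →ₐ[k] Conv k D (TwTensor k C D) :=
  algOfHm eps (univ k C D).left_add (univ k C D).left_smul eps_one eps_mul

theorem epsA_val (f : Hm k C) : epsA k C D f.val = eps f := algOfHm_val _ _ _ _ _ f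

theorem epsA_mem (n : ℤ) (x : C) (hx : x ∈ gr k n) : epsA k C D x ∈ cochainDeg k D _ n := by
  rw [epsA_val ⟨n, x, hx⟩]
  exact ⟨eps_isCochain ⟨n, x, hx⟩, eps_hasDeg (⟨n, x, hx⟩ : Hm k C)⟩

end gr

end TwTensor

section adj
variable {k C C' D D' E : Type*} [Field k] [Ring C] [Algebra k C] [GrAlgebra k C]
  [Ring C'] [Algebra k C'] [GrAlgebra k C'] [Ring D'] [Algebra k D'] [GrAlgebra k D']
  [Ring D] [Algebra k D] [GrAlgebra k D] [Ring E] [Algebra k E] [GrAlgebra k E]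

/-- A morphism to functions on words whose values are cochains of the right degree. -/
def toCochains (φ : C →ₐ[k] Conv k D E) (h : ∀ n x, x ∈ gr k n → φ x ∈ cochainDeg k D E n) :
    GrHom k C (Cochains k D E) where
  toAlgHom := φ.codRestrict (cochainAlg k D E) fun x =>
    gr_induction k (P := fun x => φ x ∈ cochainAlg k D E)
      (fun n x hx => Submodule.mem_iSup_of_mem n (h n x hx))
      (fun x y hx hy => by rw [map_add]; exact add_mem hx hy) x
  isGr n x hx := h n x hx

theorem toCochains_val (φ : C →ₐ[k] Conv k D E) (h) (x : C) :
    Cochains.val k D E (toCochains φ h x) = φ x := rfl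

/-- The adjoint of a morphism `ℓ : C ⊗̃ D → E`, on the level of graded algebras: it sends `c` to the
cochain `(g₁, …, gₙ) ↦ ℓ (ε(c; g₁, …, gₙ))`. -/
def adj (ℓ : GrHom k (TwTensor k C D) E) : GrHom k C (Cochains k D E) :=
  toCochains ((Conv.postA ℓ).comp (TwTensor.epsA k C D)) fun n x hx =>
    ⟨(TwTensor.epsA_mem n x hx).1.postA ℓ, (TwTensor.epsA_mem n x hx).2.postA ℓ⟩

theorem adj_val (ℓ : GrHom k (TwTensor k C D) E) (c : Hm k C) (L : List (Hm k D)) :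
    Cochains.val k D E (adj ℓ c.val) L = ℓ (TwTensor.eps c L) := by
  have : Cochains.val k D E (adj ℓ c.val) = Conv.postA ℓ (TwTensor.epsA k C D c.val) := rfl
  rw [this, TwTensor.epsA_val, Conv.postA_apply]

namespace TwTensor

/-- Functoriality of the twisted tensor product: `(f ⊗̃ g) (1 ⊗ y) = 1 ⊗ g y` and
`(f ⊗̃ g) ε(x; y₁, …, yₙ) = ε(f x; g y₁, …, g yₙ)`. -/
def map (f : GrHom k C C') (g : GrHom k D D') : GrHom k (TwTensor k C D) (TwTensor k C' D') :=
  desc ((inrG k C' D').comp g) (toCochains ((Conv.pre g).comp ((epsA k C' D').comp f.toAlgHom))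
    fun n x hx => ⟨(epsA_mem n _ (f.isGr n x hx)).1.pre g, (epsA_mem n _ (f.isGr n x hx)).2.pre g⟩)

theorem map_right (f : GrHom k C C') (g : GrHom k D D') (y : Hm k D) :
    map f g (right C y) = right C' (y.map g) := (desc_right _ _ y).trans (inr_val (y.map g))

theorem map_eps (f : GrHom k C C') (g : GrHom k D D') (x : Hm k C) (L : List (Hm k D)) :
    map f g (eps x L) = eps (x.map f) (L.map (Hm.map g)) := by
  refine (desc_eps _ _ x L).trans ?_
  exact congrFun (epsA_val (x.map f)) (L.map (Hm.map g))

end TwTensor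
end adj

section adjDG
variable {k C D E : Type*} [Field k] [Ring C] [Algebra k C] [DGAlgebra k C]
  [Ring D] [Algebra k D] [DGAlgebra k D] [Ring E] [Algebra k E] [DGAlgebra k E]

/-- The adjoint of a morphism of dg algebras `ℓ : C ⊗̃ D → E` whose restriction to `D` is `F`; it is
a morphism of dg algebras from `C` to the Hochschild complex of `F`. -/
def adjDG (F : DGHom k D E) (ℓ : DGHom k (TwTensor k C D) E)
    (h : ∀ y : D, ℓ (TwTensor.inr k C D y) = F y) : DGHom k C (Hoch F) where
  toGrHom := adj ℓ.toGrHom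
  map_d x := by
    refine gr_induction k (P := fun x => adj ℓ.toGrHom (dif k x) =
      hochD F (adj ℓ.toGrHom x)) (fun p x hx => ?_)
      (fun x x' hx hx' => by
        rw [map_add, map_add, map_add, hx, hx']
        exact (map_add (hochD F) _ _).symm) x
    refine Hoch.val_injective F ?_
    have e1 : (Hoch.val F) (adj ℓ.toGrHom x) = Conv.postA ℓ.toGrHom
        (TwTensor.eps (⟨p, x, hx⟩ : Hm k C)) :=
      congrArg (Conv.postA ℓ.toGrHom) (TwTensor.epsA_val (⟨p, x, hx⟩ : Hm k C))
    have e2 : (Hoch.val F) (adj ℓ.toGrHom (dif k x)) = Conv.postA ℓ.toGrHom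
        (TwTensor.eps (⟨p, x, hx⟩ : Hm k C).d) :=
      congrArg (Conv.postA ℓ.toGrHom) (TwTensor.epsA_val (⟨p, x, hx⟩ : Hm k C).d)
    refine e2.trans (Eq.trans ?_ ((hochD_val F _).trans (congrArg _ e1)).symm)
    rw [Conv.hd_apply, ← Conv.postA_dtw ℓ.toGrHom (TwTensor.inr k C D) _ h]
    ext L
    have h3 := congrFun (TwTensor.post_difT (D := D) (⟨p, x, hx⟩ : Hm k C)) L
    have h4 := ℓ.map_d (TwTensor.eps (⟨p, x, hx⟩ : Hm k C) L)
    rw [Conv.add_apply, Conv.post_apply, Conv.postA_apply, Conv.postA_apply, Conv.postA_apply, ← h4]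
    have h5 : dif k (TwTensor.eps (⟨p, x, hx⟩ : Hm k C) L) =
      TwTensor.deps (⟨p, x, hx⟩ : Hm k C) L := h3
    rw [h5, ← map_add]
    congr 1
    simp [TwTensor.deps]

end adjDG

/-- The sum of `a H₁ H₂` over all ways to cut `H` into a concatenation `H₁ ++ H₂`. -/
def cutSum {X Y : Type*} [AddCommMonoid Y] (a : List X → List X → Y) (H : List X) : Y :=
  ∑ i ∈ Finset.range (H.length + 1), a (H.take i) (H.drop i)

section cut
variable {X Y : Type*} [AddCommMonoid Y]

@[simp] theorem cutSum_nil (a : List X → List X → Y) : cutSum a [] = a [] [] := by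
  simp [cutSum]

theorem cutSum_cons (a : List X → List X → Y) (h : X) (H : List X) :
    cutSum a (h :: H) = a [] (h :: H) + cutSum (fun P S => a (h :: P) S) H := by
  rw [cutSum, List.length_cons, Finset.sum_range_succ', add_comm]
  rfl

theorem cutSum_add (a b : List X → List X → Y) (H : List X) :
    cutSum (fun P S => a P S + b P S) H = cutSum a H + cutSum b H := Finset.sum_add_distrib

theorem cutSum_finset_sum {ι : Type*} (s : Finset ι) (a : ι → List X → List X → Y) (H : List X) :
    cutSum (fun P S => ∑ i ∈ s, a i P S) H = ∑ i ∈ s, cutSum (a i) H := Finset.sum_comm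

theorem cutSum_map {Z F : Type*} [AddCommMonoid Z] [FunLike F Y Z] [AddMonoidHomClass F Y Z]
    (f : F) (a : List X → List X → Y) (H : List X) :
    cutSum (fun P S => f (a P S)) H = f (cutSum a H) := (map_sum f _ _).symm

theorem cutSum_smul {k : Type*} [Semiring k] [Module k Y] (c : k) (a : List X → List X → Y)
    (H : List X) : cutSum (fun P S => c • a P S) H = c • cutSum a H := Finset.smul_sum.symm

theorem take_drop_cases (L R : List X) (i : ℕ) :
    (∃ P S, ∀ w, (L ++ w :: R).take i = P ∧ (L ++ w :: R).drop i = S ++ w :: R) ∨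
    ∃ R₁ R₂, ∀ w, (L ++ w :: R).take i = L ++ w :: R₁ ∧ (L ++ w :: R).drop i = R₂ := by
  obtain h | ⟨n, hn⟩ : i ≤ L.length ∨ ∃ n, i = L.length + (n + 1) := by
    by_cases h : i ≤ L.length
    · exact .inl h
    · exact .inr ⟨i - L.length - 1, by omega⟩
  · exact .inl ⟨L.take i, L.drop i, fun w =>
      ⟨List.take_append_of_le_length h, List.drop_append_of_le_length h⟩⟩
  · refine .inr ⟨R.take n, R.drop n, fun w => ?_⟩
    subst hn
    rw [List.take_length_add_append, List.drop_length_add_append]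
    exact ⟨rfl, rfl⟩

theorem cutSum_lin {k : Type*} [Semiring k] [Module k Y] {a : List X → List X → Y} {c c' : k}
    {x y z : X} {L R : List X}
    (h₁ : ∀ P S, a P (S ++ z :: R) = c • a P (S ++ x :: R) + c' • a P (S ++ y :: R))
    (h₂ : ∀ R₁ R₂, a (L ++ z :: R₁) R₂ = c • a (L ++ x :: R₁) R₂ + c' • a (L ++ y :: R₁) R₂) :
    cutSum a (L ++ z :: R) = c • cutSum a (L ++ x :: R) + c' • cutSum a (L ++ y :: R) := by
  have hl : ∀ w, (L ++ w :: R).length = (L ++ z :: R).length := fun w => by simp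
  simp only [cutSum, hl, Finset.smul_sum]
  rw [← Finset.sum_add_distrib]
  refine Finset.sum_congr rfl fun i _ => ?_
  obtain ⟨P, S, h⟩ | ⟨R₁, R₂, h⟩ := take_drop_cases L R i
  · rw [(h x).1, (h x).2, (h y).1, (h y).2, (h z).1, (h z).2, h₁]
  · rw [(h x).1, (h x).2, (h y).1, (h y).2, (h z).1, (h z).2, h₂]

theorem cutSum_zero {a : List X → List X → Y} {z : X} {L R : List X}
    (h₁ : ∀ P S, a P (S ++ z :: R) = 0) (h₂ : ∀ R₁ R₂, a (L ++ z :: R₁) R₂ = 0) :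
    cutSum a (L ++ z :: R) = 0 := by
  refine Finset.sum_eq_zero fun i _ => ?_
  obtain ⟨P, S, h⟩ | ⟨R₁, R₂, h⟩ := take_drop_cases L R i
  · rw [(h z).1, (h z).2, h₁]
  · rw [(h z).1, (h z).2, h₂]

theorem cutSum_congr_of_append {a b : List X → List X → Y} {H : List X}
    (h : ∀ P S, P ++ S = H → a P S = b P S) : cutSum a H = cutSum b H :=
  Finset.sum_congr rfl fun i _ => h _ _ (List.take_append_drop i H)

theorem cutSum_eq_zero {a : List X → List X → Y} {H : List X} (h : ∀ P S, a P S = 0) :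
    cutSum a H = 0 := Finset.sum_eq_zero fun _ _ => h _ _

theorem cutSum_mem {k : Type*} [Semiring k] [Module k Y] (p : Submodule k Y)
    {a : List X → List X → Y} {H : List X} (h : ∀ P S, P ++ S = H → a P S ∈ p) : cutSum a H ∈ p :=
  Submodule.sum_mem _ fun i _ => h _ _ (List.take_append_drop i H)

theorem cutSum_congr {a b : List X → List X → Y} {H : List X}
    (h : ∀ P S, a P S = b P S) : cutSum a H = cutSum b H :=
  Finset.sum_congr rfl fun _ _ => h _ _

end cut

/-- Insertion of a prefix. -/
def Conv.pref {k D E : Type*} [Field k] [Ring D] [Algebra k D] [GrAlgebra k D]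
    [Ring E] [Algebra k E] (W : List (Hm k D)) : Conv k D E →ₗ[k] Conv k D E where
  toFun φ := fun L => φ (W ++ L)
  map_add' _ _ := rfl
  map_smul' _ _ := rfl

@[simp] theorem Conv.pref_apply {k D E : Type*} [Field k] [Ring D] [Algebra k D] [GrAlgebra k D]
    [Ring E] [Algebra k E] (W : List (Hm k D)) (φ : Conv k D E) (L : List (Hm k D)) :
    Conv.pref W φ L = φ (W ++ L) := rfl

section assoc
variable {k D E Y : Type*} [Field k] [Ring D] [Algebra k D] [GrAlgebra k D]
  [Ring E] [Algebra k E] [GrAlgebra k E] [Ring Y] [Algebra k Y] [GrAlgebra k Y]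

open TwTensor

/-- `ε(g; H)` as a homogeneous element. -/
def epsHm (g : Hm k D) (H : List (Hm k E)) : Hm k (TwTensor k D E) :=
  ⟨g.deg + wdeg H, eps g H, eps_hasDeg g H⟩

/-- The insertion of the letters `G` into the word `H`. For `G = [g₁, …, gₙ]` this is the sum of
`± φ [P₀, ε(g₁; H₁), P₁, ε(g₂; H₂), …, ε(gₙ; Hₙ), Pₙ]` over all ways to cut `H` into a concatenation
of (possibly empty) words `P₀, H₁, P₁, H₂, …, Hₙ, Pₙ`, the letters `h` of the `Pᵢ` being sent to
`1 ⊗ h`. The sign is the Koszul sign of the permutation of `g₁, …, gₙ` and the letters of `H`, all of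
which are counted with their degrees `sdeg`. -/
def ins : List (Hm k D) → Conv k (TwTensor k D E) Y → Conv k E Y
  | [], φ => Conv.pre (inrG k D E) φ
  | g :: G, φ => fun H =>
      cutSum (fun P H' => cutSum (fun H₁ H₂ =>
        sg k (wdeg (g :: G) * wdeg P + wdeg G * wdeg H₁) •
          ins G (Conv.pref (P.map (Hm.map (inrG k D E)) ++ [epsHm g H₁]) φ) H₂) H') H

/-- The part of `ins (g :: G) φ` where `P₀` is empty. -/
def insQ (g : Hm k D) (G : List (Hm k D)) (φ : Conv k (TwTensor k D E) Y) : Conv k E Y := fun H =>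
  cutSum (fun H₁ H₂ => sg k (wdeg G * wdeg H₁) • ins G (Conv.cons (epsHm g H₁) φ) H₂) H

@[simp] theorem ins_nil (φ : Conv k (TwTensor k D E) Y) : ins [] φ = Conv.pre (inrG k D E) φ := rfl

theorem ins_cons (g : Hm k D) (G : List (Hm k D)) (φ : Conv k (TwTensor k D E) Y)
    (H : List (Hm k E)) : ins (g :: G) φ H =
      cutSum (fun P H' => cutSum (fun H₁ H₂ =>
        sg k (wdeg (g :: G) * wdeg P + wdeg G * wdeg H₁) •
          ins G (Conv.pref (P.map (Hm.map (inrG k D E)) ++ [epsHm g H₁]) φ) H₂) H') H := rfl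

theorem insQ_apply (g : Hm k D) (G : List (Hm k D)) (φ : Conv k (TwTensor k D E) Y)
    (H : List (Hm k E)) : insQ g G φ H =
  cutSum (fun H₁ H₂ => sg k (wdeg G * wdeg H₁) • ins G (Conv.cons (epsHm g H₁) φ) H₂) H := rfl

theorem ins_cons_nil (g : Hm k D) (G : List (Hm k D)) (φ : Conv k (TwTensor k D E) Y) :
    ins (g :: G) φ [] = insQ g G φ [] := by
  simp only [ins_cons, insQ_apply, cutSum_nil, wdeg_nil, mul_zero, zero_add]
  rfl

theorem cons_ins (h : Hm k E) (g : Hm k D) (G : List (Hm k D)) (φ : Conv k (TwTensor k D E) Y) :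
    Conv.cons h (ins (g :: G) φ) = Conv.cons h (insQ g G φ) + sg k (wdeg (g :: G) * h.sdeg) •
      ins (g :: G) (Conv.cons (h.map (inrG k D E)) φ) := by
  ext H
  rw [Conv.add_apply, Conv.smul_apply, Conv.cons_apply, Conv.cons_apply, ins_cons, cutSum_cons]
  congr 1
  · rw [insQ_apply]
    refine cutSum_congr fun P S => ?_
    rw [wdeg_nil, mul_zero, zero_add]
    rfl
  · rw [ins_cons, ← cutSum_smul]
    refine cutSum_congr fun P S => ?_
    rw [← cutSum_smul]
    refine cutSum_congr fun H₁ H₂ => ?_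
    rw [smul_smul, ← sg_add, wdeg_cons h]
    congr 1
    congr 1
    ring

theorem ins_add (G : List (Hm k D)) (φ ψ : Conv k (TwTensor k D E) Y) :
    ins G (φ + ψ) = ins G φ + ins G ψ := by
  induction G generalizing φ ψ with
  | nil => exact map_add (Conv.pre (inrG k D E)).toLinearMap _ _
  | cons g G ih =>
    ext H
    rw [Conv.add_apply]
    simp only [ins_cons, map_add, ih, Conv.add_apply, smul_add, cutSum_add]

theorem ins_smul (G : List (Hm k D)) (c : k) (φ : Conv k (TwTensor k D E) Y) :
    ins G (c • φ) = c • ins G φ := by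
  induction G generalizing φ with
  | nil => exact map_smul (Conv.pre (inrG k D E)).toLinearMap _ _
  | cons g G ih =>
    ext H
    rw [Conv.smul_apply]
    simp only [ins_cons, map_smul, ih, Conv.smul_apply, smul_comm _ c, cutSum_smul]

/-- `ins` as a linear map. -/
def insL (G : List (Hm k D)) : Conv k (TwTensor k D E) Y →ₗ[k] Conv k E Y :=
  ⟨⟨ins G, ins_add G⟩, ins_smul G⟩

theorem insL_apply (G : List (Hm k D)) (φ : Conv k (TwTensor k D E) Y) : insL G φ = ins G φ := rfl

theorem ins_lsm (G : List (Hm k D)) (e : Y) (φ : Conv k (TwTensor k D E) Y) :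
    ins G (Conv.lsm e φ) = Conv.lsm e (ins G φ) := by
  induction G generalizing φ with
  | nil => rfl
  | cons g G ih =>
    have h1 : ∀ (W : List (Hm k (TwTensor k D E))) (φ : Conv k (TwTensor k D E) Y),
      Conv.pref W (Conv.lsm e φ) = Conv.lsm e (Conv.pref W φ) := fun W φ => rfl
    ext H
    simp only [Conv.lsm_apply, ins_cons, h1, ih]
    simp only [← mul_smul_comm]
    refine Eq.trans ?_ (cutSum_map (AddMonoidHom.mulLeft e) _ H)
    refine cutSum_congr fun P S => ?_
    exact cutSum_map (AddMonoidHom.mulLeft e) _ S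

theorem ins_hasDeg (G : List (Hm k D)) {n : ℤ} {φ : Conv k (TwTensor k D E) Y}
    (h : φ.HasDeg n) : (ins G φ).HasDeg (n + wdeg G) := by
  induction G generalizing n φ with
  | nil => rw [wdeg_nil, add_zero]; exact h.pre _
  | cons g G ih =>
    intro H
    rw [ins_cons]
    refine cutSum_mem _ fun P S hPS => cutSum_mem _ fun H₁ H₂ hH => Submodule.smul_mem _ _ ?_
    have h1 : (Conv.pref (P.map (Hm.map (inrG k D E)) ++ [epsHm g H₁]) φ).HasDeg
        (n + wdeg P + (g.sdeg + wdeg H₁)) := fun W => by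
      have := h (P.map (Hm.map (inrG k D E)) ++ [epsHm g H₁] ++ W)
      rw [wdeg_append, wdeg_append, Hm.wdeg_map, wdeg_cons, wdeg_nil] at this
      rw [Conv.pref_apply]
      convert this using 2
      simp only [epsHm, Hm.sdeg]
      ring
    convert ih h1 H₂ using 2
    rw [← hPS, ← hH, wdeg_append, wdeg_append, wdeg_cons]
    ring

theorem epsHm_lin {c c' : k} {x y z : Hm k D} (h : Hm.Lin c c' x y z) (H : List (Hm k E)) :
    Hm.Lin c c' (epsHm x H) (epsHm y H) (epsHm z H) where
  dx := congrArg (· + wdeg H) h.dx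
  dy := congrArg (· + wdeg H) h.dy
  val := by
    have e : epsA k D E z.val = c • epsA k D E x.val + c' • epsA k D E y.val := by
      rw [h.val, map_add, map_smul, map_smul]
    rw [epsA_val, epsA_val, epsA_val] at e
    exact congrFun e H

theorem epsHm_one_nil : epsHm Hm.one ([] : List (Hm k E)) = (Hm.one : Hm k (TwTensor k D E)) :=
  Hm.of_congr rfl (univ k D E).left_one_nil

theorem isCochain_pref {φ : Conv k (TwTensor k D E) Y} (h : φ.IsCochain)
    (W : List (Hm k (TwTensor k D E))) : (Conv.pref W φ).IsCochain :=
  Conv.isCochain_of_lin (fun c c' x y z hz L R => by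
      have := h.lin hz (W ++ L) R
      simpa only [List.append_assoc, Conv.pref_apply] using this)
    (fun L R => by
      have := (h (W ++ L)).one R
      simpa only [List.append_assoc, Conv.pref_apply] using this)

/-- `ins` is linear and normalized in each inserted letter. -/
theorem ins_lin {φ : Conv k (TwTensor k D E) Y} (hφ : φ.IsCochain) {c c' : k} {x y z : Hm k D}
    (h : Hm.Lin c c' x y z) (L R : List (Hm k D)) :
    ins (L ++ z :: R) φ = c • ins (L ++ x :: R) φ + c' • ins (L ++ y :: R) φ := by
  induction L generalizing φ with
  | nil =>
    ext H
    simp only [Conv.add_apply, Conv.smul_apply, List.nil_append, ins_cons, wdeg_cons, h.sx, h.sy,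
      ← cutSum_smul, ← cutSum_add]
    refine cutSum_congr fun P S => cutSum_congr fun H₁ H₂ => ?_
    have : Conv.pref (P.map (Hm.map (inrG k D E)) ++ [epsHm z H₁]) φ =
        c • Conv.pref (P.map (Hm.map (inrG k D E)) ++ [epsHm x H₁]) φ +
        c' • Conv.pref (P.map (Hm.map (inrG k D E)) ++ [epsHm y H₁]) φ := by
      ext W
      have := hφ.lin (epsHm_lin h H₁) (P.map (Hm.map (inrG k D E))) W
      simpa  using this
    rw [this, ins_add, ins_smul, ins_smul]
    simp only [Conv.add_apply, Conv.smul_apply, smul_add, smul_comm _ c, smul_comm _ c']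
  | cons u L ih =>
    ext H
    have e : ∀ w, wdeg (L ++ w :: R) = wdeg L + (w.sdeg + wdeg R) := fun w => by simp
    simp only [Conv.add_apply, Conv.smul_apply, List.cons_append, ins_cons, wdeg_cons, e, h.sx,
      h.sy, ← cutSum_smul, ← cutSum_add]
    refine cutSum_congr fun P S => cutSum_congr fun H₁ H₂ => ?_
    rw [ih (isCochain_pref hφ _)]
    simp only [Conv.add_apply, Conv.smul_apply, smul_add, smul_comm _ c, smul_comm _ c']

theorem ins_one {φ : Conv k (TwTensor k D E) Y} (hφ : φ.IsCochain) (L R : List (Hm k D)) :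
    ins (L ++ Hm.one :: R) φ = 0 := by
  induction L generalizing φ with
  | nil =>
    ext H
    rw [List.nil_append, ins_cons]
    refine cutSum_eq_zero fun P S => cutSum_eq_zero fun H₁ H₂ => ?_
    have : Conv.pref (List.map (Hm.map (inrG k D E)) P ++
        [epsHm Hm.one H₁]) φ = 0 := by
      ext W
      have e : Conv.pref (List.map (Hm.map (inrG k D E)) P ++
        [epsHm Hm.one H₁]) φ W = φ (List.map (Hm.map (inrG k D E)) P ++
        epsHm Hm.one H₁ :: W) := by simp 
      rw [e]
      cases H₁ with
      | nil => rw [epsHm_one_nil, (hφ _).one]; rfl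
      | cons g K =>
        have h0 : (epsHm Hm.one (g :: K) : Hm k (TwTensor k D E)).val = 0 :=
          (univ k D E).left_one_cons g K
        have h1 : Hm.Lin 0 0 (epsHm Hm.one (g :: K) : Hm k (TwTensor k D E))
          (epsHm Hm.one (g :: K)) (epsHm Hm.one (g :: K)) := ⟨rfl, rfl, by rw [h0]; simp⟩
        rw [hφ.lin h1]
        simp
    rw [this]
    have h0 : ins R (0 : Conv k (TwTensor k D E) Y) = 0 := (insL R).map_zero
    rw [h0]
    simp
  | cons u L ih =>
    ext H
    rw [List.cons_append, ins_cons]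
    refine cutSum_eq_zero fun P S => cutSum_eq_zero fun H₁ H₂ => ?_
    rw [ih (isCochain_pref hφ _)]
    simp

theorem ins_isCochain (G : List (Hm k D)) {φ : Conv k (TwTensor k D E) Y} (hφ : φ.IsCochain) :
    (ins G φ).IsCochain := by
  induction G generalizing φ with
  | nil => exact hφ.pre _
  | cons g G ih =>
    refine Conv.isCochain_of_lin (fun c c' x y z h L R => ?_) (fun L R => ?_)
    · rw [ins_cons, ins_cons, ins_cons]
      have e : ∀ (w : Hm k E) (L R : List (Hm k E)), wdeg (L ++ w :: R) =
        wdeg L + (w.sdeg + wdeg R) := fun w L R => by simp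
      refine cutSum_lin (fun P S => cutSum_lin (fun H₁ S => ?_) (fun R₁ R₂ => ?_))
        (fun R₁ R₂ => ?_)
      · rw [(ih (isCochain_pref hφ _)).lin h]
        simp only [smul_add, smul_comm _ c, smul_comm _ c']
      · have hl : Hm.Lin c c' (epsHm g (S ++ x :: R₁)) (epsHm g (S ++ y :: R₁))
            (epsHm g (S ++ z :: R₁)) :=
          ⟨by simp [epsHm, h.sx], by simp [epsHm, h.sy], (eps_isCochain g).lin h S R₁⟩
        have : Conv.pref (P.map (Hm.map (inrG k D E)) ++ [epsHm g (S ++ z :: R₁)]) φ =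
            c • Conv.pref (P.map (Hm.map (inrG k D E)) ++ [epsHm g (S ++ x :: R₁)]) φ +
            c' • Conv.pref (P.map (Hm.map (inrG k D E)) ++ [epsHm g (S ++ y :: R₁)]) φ := by
          ext W
          have := hφ.lin hl (P.map (Hm.map (inrG k D E))) W
          simpa  using this
        rw [this, ins_add, ins_smul, ins_smul, e, e, e, h.sx, h.sy]
        simp only [Conv.add_apply, Conv.smul_apply, smul_add, smul_comm _ c, smul_comm _ c']
      · rw [← cutSum_smul, ← cutSum_smul, ← cutSum_add]
        refine cutSum_congr fun H₁ H₂ => ?_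
        have : Conv.pref ((L ++ z :: R₁).map (Hm.map (inrG k D E)) ++ [epsHm g H₁]) φ =
            c • Conv.pref ((L ++ x :: R₁).map (Hm.map (inrG k D E)) ++ [epsHm g H₁]) φ +
            c' • Conv.pref ((L ++ y :: R₁).map (Hm.map (inrG k D E)) ++ [epsHm g H₁]) φ := by
          ext W
          have := hφ.lin (h.map (inrG k D E)) (L.map (Hm.map (inrG k D E)))
            (R₁.map (Hm.map (inrG k D E)) ++ [epsHm g H₁] ++ W)
          simpa  using this
        rw [this, ins_add, ins_smul, ins_smul, e, e, e, h.sx, h.sy]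
        simp only [Conv.add_apply, Conv.smul_apply, smul_add, smul_comm _ c, smul_comm _ c']
    · rw [ins_cons]
      have h0 : ins G (0 : Conv k (TwTensor k D E) Y) = 0 := (insL G).map_zero
      refine cutSum_zero (fun P S => cutSum_zero (fun H₁ S => ?_) (fun R₁ R₂ => ?_))
        (fun R₁ R₂ => ?_)
      · rw [((ih (isCochain_pref hφ _)) S).one, smul_zero]
      · have hv : (epsHm g (S ++ Hm.one :: R₁) : Hm k (TwTensor k D E)).val = 0 :=
          ((eps_isCochain g) S).one R₁
        have hl : Hm.Lin 0 0 (epsHm g (S ++ Hm.one :: R₁) : Hm k (TwTensor k D E))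
            (epsHm g (S ++ Hm.one :: R₁)) (epsHm g (S ++ Hm.one :: R₁)) :=
          ⟨rfl, rfl, by rw [hv]; simp⟩
        have : Conv.pref (P.map (Hm.map (inrG k D E)) ++ [epsHm g (S ++ Hm.one :: R₁)]) φ =
            0 := by
          ext W
          have := hφ.lin hl (P.map (Hm.map (inrG k D E))) W
          simpa  using this
        rw [this, h0, Conv.zero_apply, smul_zero]
      · refine cutSum_eq_zero fun H₁ H₂ => ?_
        have : Conv.pref ((L ++ Hm.one :: R₁).map (Hm.map (inrG k D E)) ++
            [epsHm g H₁]) φ = 0 := by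
          ext W
          have := (hφ (L.map (Hm.map (inrG k D E)))).one
            (R₁.map (Hm.map (inrG k D E)) ++ [epsHm g H₁] ++ W)
          simpa [Hm.map_one] using this
        rw [this, h0, Conv.zero_apply, smul_zero]

end assoc

section assoc
variable {k D E Y : Type*} [Field k] [Ring D] [Algebra k D] [GrAlgebra k D]
  [Ring E] [Algebra k E] [GrAlgebra k E] [Ring Y] [Algebra k Y] [GrAlgebra k Y]

open TwTensor

/-- A sum over all ways to cut a word, with functions on words as values. -/
def cutConv (a : List (Hm k E) → Conv k E Y) : Conv k E Y := fun H => cutSum (fun P S => a P S) H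

theorem cutSum_mul_aux (a : List (Hm k E) → Conv k E Y) (χ : Conv k E Y) (H : List (Hm k E)) :
    (cutConv a * χ : Conv k E Y) H =
      cutSum (fun H₁ H₂ => (a H₁ * Conv.tw (wdeg H₁) χ) H₂) H := by
  have e0 : ∀ (a : List (Hm k E) → Conv k E Y) (h : Hm k E),
      Conv.cons h (cutConv a) =
      Conv.cons h (a []) +
        cutConv (fun P => a (h :: P)) := fun a h =>
    Conv.ext fun H => cutSum_cons (fun H₁ H₂ => a H₁ H₂) h H
  induction H generalizing a χ with
  | nil => rw [Conv.mul_nil, cutConv, cutSum_nil, cutSum_nil, wdeg_nil, Conv.tw_zero, Conv.mul_nil]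
  | cons h H ih =>
    rw [cutSum_cons, wdeg_nil, Conv.tw_zero]
    have e1 := congrFun (Conv.cons_mul h (cutConv a) χ) H
    have e2 := congrFun (Conv.cons_mul h (a []) χ) H
    rw [Conv.cons_apply] at e1 e2
    rw [e1, e2, e0, add_mul]
    have e3 : cutConv a [] = a [] [] := cutSum_nil _
    simp only [Conv.add_apply, e3]
    rw [ih (fun P => a (h :: P)), add_assoc]
    congr 2
    refine cutSum_congr fun P S => ?_
    rw [wdeg_cons, add_comm h.sdeg, Conv.tw_add]

/-- The right hand side of the product formula for `ins`. -/
def insS (q : ℤ) (G : List (Hm k D)) (φ ψ : Conv k (TwTensor k D E) Y) : Conv k E Y :=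
  cutSum (fun G₁ G₂ => sg k (q * wdeg G₁) • (ins G₁ φ * ins G₂ ψ)) G

theorem conv_cutSum_apply {X : Type*} (a : List X → List X → Conv k E Y) (G : List X)
    (H : List (Hm k E)) : cutSum a G H = cutSum (fun P S => a P S H) G := by
  rw [cutSum, cutSum]
  exact Finset.sum_apply _ _ _

theorem insQ_mul {q : ℤ} (g : Hm k D) (G : List (Hm k D)) {φ ψ : Conv k (TwTensor k D E) Y}
    (hψ : ψ.HasDeg q) (ih : ∀ φ : Conv k (TwTensor k D E) Y, ins G (φ * ψ) = insS q G φ ψ) :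
    insQ g G (φ * ψ) = Conv.lsm (φ []) (insQ g G ψ) +
      cutSum (fun G₁ G₂ => sg k (q * (g.sdeg + wdeg G₁)) • (insQ g G₁ φ * ins G₂ ψ)) G := by
  have e1 : ∀ H₁ : List (Hm k E), ins G (Conv.cons (epsHm g H₁) (φ * ψ)) =
      Conv.lsm (φ []) (ins G (Conv.cons (epsHm g H₁) ψ)) +
      sg k (q * (g.sdeg + wdeg H₁)) • insS q G (Conv.cons (epsHm g H₁) φ) ψ := fun H₁ => by
    rw [Conv.cons_mul, ins_add, ins_lsm, hψ.tw, mul_smul_comm, ins_smul, ih]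
    congr 3
    simp only [epsHm, Hm.sdeg]
    ring
  ext H
  rw [Conv.add_apply, conv_cutSum_apply, insQ_apply]
  simp only [e1, Conv.add_apply, smul_add, cutSum_add]
  congr 1
  · rw [Conv.lsm_apply, insQ_apply]
    simp only [Conv.lsm_apply, ← mul_smul_comm]
    exact cutSum_map (AddMonoidHom.mulLeft (φ [])) _ H
  · have e2 : ∀ G₁ G₂ : List (Hm k D), (insQ g G₁ φ * ins G₂ ψ) H =
        cutSum (fun H₁ H₂ => (sg k (wdeg G₁ * wdeg H₁) * sg k (wdeg H₁ * (q + wdeg G₂))) •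
          (ins G₁ (Conv.cons (epsHm g H₁) φ) * ins G₂ ψ) H₂) H := fun G₁ G₂ => by
      refine (cutSum_mul_aux (fun H₁ => sg k (wdeg G₁ * wdeg H₁) •
        ins G₁ (Conv.cons (epsHm g H₁) φ)) (ins G₂ ψ) H).trans ?_
      refine cutSum_congr fun H₁ H₂ => ?_
      rw [(ins_hasDeg G₂ hψ).tw, smul_mul_smul_comm]
      rfl
    simp only [Conv.smul_apply, e2, insS, conv_cutSum_apply, ← cutSum_smul]
    rw [cutSum, cutSum]
    simp only [cutSum]
    rw [Finset.sum_comm]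
    refine Finset.sum_congr rfl fun i _ => Finset.sum_congr rfl fun j _ => ?_
    simp only [smul_smul, ← sg_add]
    congr 1
    have : wdeg G = wdeg (G.take i) + wdeg (G.drop i) := by
      rw [← wdeg_append, List.take_append_drop]
    rw [this]
    congr 1
    ring

theorem cons_cutSum {X : Type*} (a : List X → List X → Conv k E Y) (G : List X) (h : Hm k E) :
    Conv.cons h (cutSum a G) = cutSum (fun P S => Conv.cons h (a P S)) G :=
  (cutSum_map (Conv.cons h) a G).symm

theorem ins_mul {q : ℤ} (G : List (Hm k D)) (φ : Conv k (TwTensor k D E) Y)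
    {ψ : Conv k (TwTensor k D E) Y} (hψ : ψ.HasDeg q) : ins G (φ * ψ) = insS q G φ ψ := by
  induction G generalizing φ ψ q with
  | nil => simp [insS]
  | cons g G ih =>
    have hQ := fun {q : ℤ} {φ ψ : Conv k (TwTensor k D E) Y} (hψ : ψ.HasDeg q) =>
      insQ_mul (φ := φ) g G hψ (fun φ => ih φ hψ)
    ext H
    induction H generalizing φ ψ q with
    | nil =>
      rw [ins_cons_nil, hQ hψ, insS, cutSum_cons, Conv.add_apply, Conv.add_apply, conv_cutSum_apply,
        conv_cutSum_apply]
      congr 1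
      · simp [ins_cons_nil]
      · refine cutSum_congr fun P S => ?_
        simp [ins_cons_nil]
    | cons h H ihH =>
      change Conv.cons h (ins (g :: G) (φ * ψ)) H = Conv.cons h (insS q (g :: G) φ ψ) H
      rw [cons_ins, Conv.cons_mul, ins_add, ins_lsm, hψ.tw, mul_smul_comm, ins_smul]
      rw [hQ hψ, insS, cutSum_cons, map_add, map_add, cons_cutSum, cons_cutSum]
      have e1 : ∀ P S, Conv.cons h (sg k (q * (wdeg (g :: P))) • (ins (g :: P) φ * ins S ψ)) =
          Conv.cons h (sg k (q * (g.sdeg + wdeg P)) • (insQ g P φ * ins S ψ)) +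
          sg k (q * (wdeg (g :: P))) • (sg k (wdeg (g :: P) * h.sdeg + h.sdeg * (q + wdeg S)) •
            (ins (g :: P) (Conv.cons (h.map (inrG k D E)) φ) * ins S ψ)) := fun P S => by
        rw [map_smul, map_smul, Conv.cons_mul, Conv.cons_mul, cons_ins, ins_cons_nil, add_mul,
          (ins_hasDeg S hψ).tw, smul_mul_smul_comm, sg_add (k := k) (wdeg (g :: P) * h.sdeg),
          wdeg_cons, smul_add, smul_add, smul_add, add_assoc]
      have e2 : Conv.cons h (sg k (q * wdeg ([] : List (Hm k D))) • (ins [] φ * ins (g :: G) ψ)) =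
          Conv.cons h (Conv.lsm (φ []) (insQ g G ψ)) + sg k (wdeg (g :: G) * h.sdeg) •
            Conv.lsm (φ []) (ins (g :: G) (Conv.cons (h.map (inrG k D E)) ψ)) +
          sg k (h.sdeg * (q + wdeg (g :: G))) •
            (ins [] (Conv.cons (h.map (inrG k D E)) φ) * ins (g :: G) ψ) := by
        rw [wdeg_nil, mul_zero, sg_zero, one_smul, Conv.cons_mul, cons_ins,
          (ins_hasDeg (g :: G) hψ).tw, mul_smul_comm, map_add, map_smul]
        rfl
      simp only [e1, e2, cutSum_add, Conv.add_apply, Conv.smul_apply]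
      have e3 := ihH (Conv.cons (h.map (inrG k D E)) φ) hψ
      rw [e3, insS, cutSum_cons]
      simp only [Conv.add_apply, smul_add, Conv.smul_apply, smul_smul, conv_cutSum_apply,
        ← cutSum_smul]
      have hs : (h.map (inrG k D E)).sdeg = h.sdeg := rfl
      have e4 : sg k (wdeg (g :: G) * h.sdeg) * (sg k ((h.map (inrG k D E)).sdeg * q) *
          sg k (q * wdeg ([] : List (Hm k D)))) = sg k (h.sdeg * (q + wdeg (g :: G))) := by
        rw [hs, ← sg_add, ← sg_add, wdeg_nil]
        congr 1
        ring
      have e5 : cutSum (fun P S => (sg k (wdeg (g :: G) * h.sdeg) *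
          (sg k ((h.map (inrG k D E)).sdeg * q) * sg k (q * wdeg (g :: P)))) •
            (ins (g :: P) (Conv.cons (h.map (inrG k D E)) φ) * ins S ψ) H) G =
          cutSum (fun P S => (sg k (q * wdeg (g :: P)) *
            sg k (wdeg (g :: P) * h.sdeg + h.sdeg * (q + wdeg S))) •
              (ins (g :: P) (Conv.cons (h.map (inrG k D E)) φ) * ins S ψ) H) G := by
        refine cutSum_congr_of_append fun P S hPS => ?_
        have : wdeg (g :: G) = wdeg (g :: P) + wdeg S := by
          rw [← wdeg_append, List.cons_append, hPS]
        rw [hs, ← sg_add, ← sg_add, ← sg_add, this]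
        congr 2
        ring
      rw [e4, e5]
      abel

theorem ins_pre_one (G : List (Hm k D)) :
    ins G (1 : Conv k (TwTensor k D E) Y) = if G.isEmpty then 1 else 0 := by
  cases G with
  | nil => exact map_one (Conv.pre (inrG k D E))
  | cons g G =>
    ext H
    rw [ins_cons]
    refine cutSum_eq_zero fun P S => cutSum_eq_zero fun H₁ H₂ => ?_
    have : Conv.pref (P.map (Hm.map (inrG k D E)) ++ [epsHm g H₁])
        (1 : Conv k (TwTensor k D E) Y) = 0 := by
      ext W
      cases P <;> rfl
    rw [this]
    have h0 : ins G (0 : Conv k (TwTensor k D E) Y) = 0 := (insL G).map_zero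
    rw [h0]
    simp

end assoc

section assoc
variable (k C D E : Type*) [Field k] [Ring C] [Algebra k C] [GrAlgebra k C]
  [Ring D] [Algebra k D] [GrAlgebra k D]
  [Ring E] [Algebra k E] [GrAlgebra k E]

open TwTensor

/-- The morphism from `C ⊗̃ D` to cochains on `E` that corresponds to the associator. It sends
`1 ⊗ g` to `H ↦ 1 ⊗ ε(g; H)` and `ε(f; G)` to `H ↦ ins G ε(f; -) H`. -/
def assocData : TwData k C D (Conv k E (TwTensor k C (TwTensor k D E))) where
  r g := Conv.postA (inrG k C (TwTensor k D E)) (eps g)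
  e f := fun G => ins G (eps f)
  right_add a b := (congrArg (Conv.postA _) ((univ k D E).left_add a b)).trans (map_add _ _ _)
  right_smul c a := (congrArg (Conv.postA _) ((univ k D E).left_smul c a)).trans (map_smul _ _ _)
  right_one := (congrArg (Conv.postA _) eps_one).trans (map_one _)
  right_mul x y := (congrArg (Conv.postA _) (eps_mul x y)).trans (map_mul _ _ _)
  left_add a b := Conv.ext fun G =>
    (congrArg (ins G) ((univ k C (TwTensor k D E)).left_add a b)).trans (ins_add _ _ _)
  left_smul c a := Conv.ext fun G =>
    (congrArg (ins G) ((univ k C (TwTensor k D E)).left_smul c a)).trans (ins_smul _ _ _)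
  left_one_nil := (congrArg (ins []) eps_one).trans (ins_pre_one [])
  left_one_cons g L := (congrArg (ins (g :: L)) eps_one).trans (ins_pre_one (g :: L))
  word f := Conv.isCochain_of_lin
    (fun c c' x y z h L R => ins_lin (eps_isCochain f) h L R)
    (fun L R => ins_one (eps_isCochain f) L R)
  left_mul x y L := (congrArg (ins L) (eps_mul x y)).trans (ins_mul L (eps x) (eps_hasDeg y))

theorem assocData_mem (n : ℤ) (x : TwTensor k C D) (hx : x ∈ gr k n) :
    lift (assocData k C D E) x ∈ cochainDeg k E (TwTensor k C (TwTensor k D E)) n := by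
  have h := gr_le hx
  clear hx
  induction h with
  | zero n => rw [map_zero]; exact zero_mem _
  | add hx hy ihx ihy => rw [map_add]; exact add_mem ihx ihy
  | smul c hx ih => rw [map_smul]; exact Submodule.smul_mem _ _ ih
  | one => rw [map_one]; exact ⟨.one, .one⟩
  | mul hx hy ihx ihy => rw [map_mul]; exact cochainDeg_mul _ _ _ ihx ihy
  | right g => rw [lift_right]; exact ⟨(eps_isCochain g).postA _, (eps_hasDeg g).postA _⟩
  | eps f L =>
    rw [lift_eps]
    exact ⟨ins_isCochain L (eps_isCochain f), ins_hasDeg L (eps_hasDeg f)⟩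

/-- The associator `(C ⊗̃ D) ⊗̃ E → C ⊗̃ (D ⊗̃ E)`. It sends `1 ⊗ h` to `1 ⊗ (1 ⊗ h)`,
`ε(1 ⊗ g; H)` to `1 ⊗ ε(g; H)`, and `ε(ε(f; g₁, …, gₘ); H)` to the sum of
`± ε(f; P₀, ε(g₁; H₁), P₁, …, ε(gₘ; Hₘ), Pₘ)` over all cuts of `H`. Only the underlying morphism of
graded algebras is recorded here; that is all that the commutativity of diagrams involves. -/
def assoc : GrHom k (TwTensor k (TwTensor k C D) E) (TwTensor k C (TwTensor k D E)) :=
  desc ((inrG k C (TwTensor k D E)).comp (inrG k D E))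
    (toCochains (lift (assocData k C D E)) (assocData_mem k C D E))

variable {k C D E}

theorem assoc_right (h : Hm k E) :
    assoc k C D E (right (TwTensor k C D) h) = inr k C _ (inr k D E h.val) := desc_right _ _ h

theorem assoc_eps_right (g : Hm k D) (H : List (Hm k E)) :
    assoc k C D E (eps ⟨g.deg, inr k C D g.val, isGr_inr _ _ g.mem⟩ H) =
      inr k C _ (eps g H) := by
  refine (desc_eps _ _ _ H).trans ?_
  have h : lift (assocData k C D E) (inr k C D g.val) = (assocData k C D E).r g := by
    rw [inr_val, lift_right]
  exact congrFun h H

theorem assoc_eps_eps (f : Hm k C) (G : List (Hm k D)) (H : List (Hm k E)) :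
    assoc k C D E (eps (epsHm f G) H) = ins G (eps f) H := by
  refine (desc_eps _ _ _ H).trans ?_
  have h : lift (assocData k C D E) (eps f G) = (assocData k C D E).e f G := lift_eps _ _ _
  exact congrFun h H

end assoc

section monoid
variable (k : Type*) [Field k]

/-- A monoid with respect to the twisted tensor product: a dg algebra `B` with a morphism of dg
algebras `mul : B ⊗̃ B → B` that is associative, and for which the unit of the algebra `B` is a
two-sided unit. -/
structure TwMonoid (B : Type*) [Ring B] [Algebra k B] [DGAlgebra k B] where
  mul : DGHom k (TwTensor k B B) B
  one_mul : ∀ b : B, mul (TwTensor.inr k B B b) = b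
  mul_one : ∀ b : B, mul (TwTensor.inl k B B b) = b
  mul_assoc : ∀ x : TwTensor k (TwTensor k B B) B,
    mul (TwTensor.map mul.toGrHom (GrHom.id k B) x) =
      mul (TwTensor.map (GrHom.id k B) mul.toGrHom (assoc k B B B x))

variable {k}

/-- `ℓ : B ⊗̃ A → A` is an action of the monoid `B` on `A`. -/
structure IsAction {A B : Type*} [Ring A] [Algebra k A] [DGAlgebra k A]
    [Ring B] [Algebra k B] [DGAlgebra k B] (μ : TwMonoid k B) (ℓ : DGHom k (TwTensor k B A) A) :
    Prop where
  mul_act : ∀ x : TwTensor k (TwTensor k B B) A,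
    ℓ (TwTensor.map μ.mul.toGrHom (GrHom.id k A) x) =
      ℓ (TwTensor.map (GrHom.id k B) ℓ.toGrHom (assoc k B B A x))
  one_act : ∀ a : A, ℓ (TwTensor.inr k B A a) = a

section hoch
variable (k) (A : Type*) [Ring A] [Algebra k A] [DGAlgebra k A]

/-- The evaluation `Hoch(A) ⊗̃ A → A`, adjoint to the identity of `Hoch(A)`. -/
def evalHoch : GrHom k (TwTensor k (Hoch (DGHom.id k A)) A) A :=
  TwTensor.desc (GrHom.id k A) (GrHom.id k (Hoch (DGHom.id k A)))

/-- The monoid product `Hoch(A) ⊗̃ Hoch(A) → Hoch(A)`: the adjoint of the composition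
`(Hoch(A) ⊗̃ Hoch(A)) ⊗̃ A → Hoch(A) ⊗̃ (Hoch(A) ⊗̃ A) → Hoch(A) ⊗̃ A → A` of the associator and two
evaluations. -/
def hochMul : GrHom k (TwTensor k (Hoch (DGHom.id k A)) (Hoch (DGHom.id k A)))
    (Hoch (DGHom.id k A)) :=
  adj ((evalHoch k A).comp
    ((TwTensor.map (GrHom.id k (Hoch (DGHom.id k A))) (evalHoch k A)).comp
      (assoc k (Hoch (DGHom.id k A)) (Hoch (DGHom.id k A)) A)))

end hoch

/-- `f : B → Hoch(A)` is a morphism of monoids with respect to the twisted tensor product. -/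
structure IsMonoidMap {A B : Type*} [Ring A] [Algebra k A] [DGAlgebra k A]
    [Ring B] [Algebra k B] [DGAlgebra k B] (μ : TwMonoid k B)
    (f : DGHom k B (Hoch (DGHom.id k A))) : Prop where
  map_mul : ∀ x : TwTensor k B B,
    f (μ.mul x) = hochMul k A (TwTensor.map f.toGrHom f.toGrHom x)
  map_one : f 1 = 1

end monoid

end TwDG

end

/-! Since `C ⊗̃ D` is generated by the elements `1 ⊗ g` and `ε(c; g₁, …, gₙ)`, a morphism out of it
is determined by its restriction to `D` together with its adjoint, which records the values on all
`ε(c; -)`. So two morphisms with the same restriction to `D` coincide exactly when their adjoints do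
(`eq_iff_adj_eq`).

The multiplicative law of an action compares `ℓ ∘ (m ⊗̃ id)` with `ℓ ∘ (id ⊗̃ ℓ) ∘ α`, both defined
on `(B ⊗̃ B) ⊗̃ A`. Because `ℓ (1 ⊗ a) = a`, both restrict to the identity of `A`, and the law
becomes an equality of two maps from `B ⊗̃ B` to cochains on `A`. Let `φ` be the adjoint of `ℓ`, `e`
the evaluation and `M` the product of `Hoch(A)`. The adjoint of `ℓ ∘ (m ⊗̃ id)` is `φ ∘ m`, by
naturality of the adjunction (`adj_comp_map_id`). The adjoint of `ℓ ∘ (id ⊗̃ ℓ) ∘ α` is `M ∘ (φ ⊗̃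
φ)` (`hochMul_map_adj`): by definition of `M` and naturality, `M ∘ (φ ⊗̃ φ)` is the adjoint of `e ∘
(id ⊗̃ e) ∘ α ∘ ((φ ⊗̃ φ) ⊗̃ id) = e ∘ (id ⊗̃ e) ∘ (φ ⊗̃ (φ ⊗̃ id)) ∘ α = e ∘ (φ ⊗̃ id) ∘ (id ⊗̃ ℓ)
∘ α = ℓ ∘ (id ⊗̃ ℓ) ∘ α`. This uses naturality of `α` (`assoc_natural`), functoriality of `⊗̃`, and
twice the identity `e ∘ (φ ⊗̃ id) = ℓ` (`evalHoch_map_adj`). Thus the action law says exactly that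
`φ ∘ m = M ∘ (φ ⊗̃ φ)`. The unit conditions hold on both sides in any case: `φ` is a morphism of
algebras, and `ℓ (1 ⊗ a) = a` is assumed.

The only computation is the naturality of `α`. Its adjoint is a morphism of algebras into functions
on words with the cup product, so naturality can be tested on generators of `C ⊗̃ D`. There it
reduces to the compatibility of the insertion `ins` with postcomposition (`postA_ins`) and with a
change of the inserted letters (`ins_pre`). No sign has to be recomputed, since the signs depend
only on degrees and all morphisms preserve degrees. The identities that carry the proof are between
morphisms of graded algebras; the differentials do not enter them. -/

namespace TwDG

namespace TwTensor

/-! ### Functoriality of `⊗̃` and naturality of the adjunction. -/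

section functoriality
variable {k C C' C'' D D' D'' E : Type*} [Field k] [Ring C] [Algebra k C] [GrAlgebra k C]
  [Ring C'] [Algebra k C'] [GrAlgebra k C'] [Ring C''] [Algebra k C''] [GrAlgebra k C'']
  [Ring D] [Algebra k D] [GrAlgebra k D] [Ring D'] [Algebra k D'] [GrAlgebra k D']
  [Ring D''] [Algebra k D''] [GrAlgebra k D''] [Ring E] [Algebra k E] [GrAlgebra k E]

theorem map_hm_id (L : List (Hm k D)) : L.map (Hm.map (GrHom.id k D)) = L :=
  L.map_id

/-- Two morphisms out of a twisted tensor product agree if they agree on the elements `1 ⊗ g` and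
`ε(f; gs)`. -/
theorem grHom_ext {f g : GrHom k (TwTensor k C D) E} (hr : ∀ y, f (right C y) = g (right C y))
    (he : ∀ x L, f (eps x L) = g (eps x L)) (x : TwTensor k C D) : f x = g x :=
  DFunLike.congr_fun (algHom_ext (f := f.toAlgHom) (g := g.toAlgHom) hr he) x

/-- On generators both sides apply the composites letter by letter. This is what allows `φ` in the
first factor and `ℓ` in the second to be applied in either order. -/
theorem map_map (f : GrHom k C C') (g : GrHom k D D') (f' : GrHom k C' C'') (g' : GrHom k D' D'')
    (x : TwTensor k C D) : map f' g' (map f g x) = map (f'.comp f) (g'.comp g) x :=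
  grHom_ext (f := (map f' g').comp (map f g)) (g := map (f'.comp f) (g'.comp g))
    (fun y => by
      change map f' g' (map f g (right C y)) = _
      rw [map_right, map_right, map_right]
      rfl)
    (fun x L => by
      change map f' g' (map f g (eps x L)) = _
      rw [map_eps, map_eps, map_eps, List.map_map]
      rfl) x

/-- Naturality of the adjunction in the first variable. -/
theorem adj_comp_map_id (ℓ : GrHom k (TwTensor k C' D) E) (f : GrHom k C C') (x : C) :
    adj (ℓ.comp (map f (GrHom.id k D))) x = adj ℓ (f x) := by
  -- The symbols `ε(x; -)` exist only for homogeneous `x`, so the formula `adj_val` becomes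
  -- available after a reduction to that case.
  refine gr_induction k (P := fun x => adj (ℓ.comp (map f (GrHom.id k D))) x = adj ℓ (f x))
    (fun p x hx => ?_) (fun x y hx hy => by simp only [map_add, hx, hy]) x
  refine Cochains.val_injective k D E (Conv.ext fun L => ?_)
  refine (adj_val _ (⟨p, x, hx⟩ : Hm k C) L).trans ?_
  refine Eq.trans ?_ (adj_val ℓ ((⟨p, x, hx⟩ : Hm k C).map f) L).symm
  -- What remains is `ℓ ((f ⊗̃ id) ε(x; L)) = ℓ (ε(f x; L))`.
  change ℓ (map f (GrHom.id k D) (eps _ L)) = _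
  rw [map_eps, map_hm_id]

/-- The adjoint sees all generators except the `1 ⊗ y`, and on those agreement is assumed. With this
lemma an identity on `(B ⊗̃ B) ⊗̃ A` turns into an identity on `B ⊗̃ B`. -/
theorem eq_iff_adj_eq {f g : GrHom k (TwTensor k C D) E}
    (hr : ∀ y, f (right C y) = g (right C y)) :
    (∀ x, f x = g x) ↔ ∀ c, adj f c = adj g c := by
  refine ⟨fun h c => ?_, fun h => grHom_ext hr fun x L => ?_⟩
  · refine Cochains.val_injective k D E (Conv.ext fun L => ?_)
    -- By definition the value of `adj f c` on `L` is `f` of `epsA c L`, where `epsA` extends `eps`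
    -- linearly; hence no reduction to homogeneous `c` is needed here.
    exact h (epsA k C D c L)
  · rw [← adj_val, ← adj_val, h]

end functoriality

end TwTensor

/-! ### Compatibility of insertions with morphisms of the target and of the inserted letters. -/

section insNaturality
variable {k D D' E Y Y' : Type*} [Field k] [Ring D] [Algebra k D] [GrAlgebra k D]
  [Ring D'] [Algebra k D'] [GrAlgebra k D'] [Ring E] [Algebra k E] [GrAlgebra k E]
  [Ring Y] [Algebra k Y] [GrAlgebra k Y] [Ring Y'] [Algebra k Y'] [GrAlgebra k Y']

open TwTensor

/-- A value of `ins G φ` is a signed sum of values of `φ`, with words and signs that depend only on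
`G` and `H`; a linear map applied to the values passes through such a sum. -/
theorem postA_ins (F : GrHom k Y Y') (G : List (Hm k D)) (φ : Conv k (TwTensor k D E) Y) :
    Conv.postA F (ins G φ) = ins G (Conv.postA F φ) := by
  induction G generalizing φ with
  | nil => rfl
  | cons g G ih =>
    -- `pref` acts on the argument and `postA` on the value, so they commute by definition.
    have hp : ∀ (W : List (Hm k (TwTensor k D E))),
      Conv.pref W (Conv.postA F φ) = Conv.postA F (Conv.pref W φ) := fun W => rfl
    ext H
    simp only [Conv.postA_apply, ins_cons, hp, ← ih]
    simp only [cutSum, map_sum, map_smul]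

/-- The two kinds of letters in a word produced by `ins` are `ε(x; H)` and `1 ⊗ x`. This lemma and
`map_inrG` describe how `g ⊗̃ id` moves each kind; the degrees agree by definition, so only the
underlying elements have to be compared. -/
theorem epsHm_map (g : GrHom k D D') (x : Hm k D) (H : List (Hm k E)) :
    (epsHm x H).map (map g (GrHom.id k E)) = epsHm (x.map g) H :=
  Hm.of_congr rfl (by
    rw [Hm.map_val]
    exact (map_eps _ _ _ _).trans (by rw [map_hm_id]; rfl))

theorem map_inrG (g : GrHom k D D') (x : Hm k E) :
    (x.map (inrG k D E)).map (map g (GrHom.id k E)) = x.map (inrG k D' E) :=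
  Hm.of_congr rfl (by
    have h := map_right g (GrHom.id k E) x
    rw [← inr_val, ← inr_val] at h
    exact h)

theorem map_map_inrG (g : GrHom k D D') (P : List (Hm k E)) :
    (P.map (Hm.map (inrG k D E))).map (Hm.map (map g (GrHom.id k E))) =
      P.map (Hm.map (inrG k D' E)) := by
  rw [List.map_map]
  exact List.map_congr_left fun x _ => map_inrG g x

/-- Applying `g ⊗̃ id` to a word with inserted letters changes each `ε(x; H₁)` to `ε(g x; H₁)` and
leaves the letters `1 ⊗ h` in place. The outcome is the word with the letters of `G` replaced by
their images under `g` before insertion. -/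
theorem ins_pre (g : GrHom k D D') (G : List (Hm k D)) (ψ : Conv k (TwTensor k D' E) Y) :
    ins G (Conv.pre (map g (GrHom.id k E)) ψ) = ins (G.map (Hm.map g)) ψ := by
  -- `ψ` has to vary: after the first letter is inserted, the remaining ones are inserted into `ψ`
  -- with a prefix fixed.
  induction G generalizing ψ with
  | nil => exact Conv.ext fun H => congrArg ψ (map_map_inrG g H)
  | cons x G ih =>
    -- Fixing the prefix `P, ε(x; H₁)` after pulling back along `g ⊗̃ id` is the same as fixing the
    -- transformed prefix `P, ε(g x; H₁)` before pulling back.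
    have hp : ∀ (P : List (Hm k E)) (H₁ : List (Hm k E)),
        Conv.pref (P.map (Hm.map (inrG k D E)) ++ [epsHm x H₁])
          (Conv.pre (map g (GrHom.id k E)) ψ) =
        Conv.pre (map g (GrHom.id k E))
          (Conv.pref (P.map (Hm.map (inrG k D' E)) ++ [epsHm (x.map g) H₁]) ψ) := fun P H₁ =>
      Conv.ext fun W => congrArg ψ (by
        rw [List.map_append, List.map_append, map_map_inrG, List.map_singleton, epsHm_map])
    ext H
    rw [List.map_cons]
    -- `Hm.map_sdeg` and `Hm.wdeg_map` identify the Koszul signs of the two sums; `hp` and then `ih`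
    -- match the summands.
    simp only [ins_cons, hp, ih, wdeg_cons, Hm.map_sdeg, Hm.wdeg_map]

end insNaturality

/-! ### Naturality of the associator. -/

section assocNaturality
variable {k C C' D D' E : Type*} [Field k] [Ring C] [Algebra k C] [GrAlgebra k C]
  [Ring C'] [Algebra k C'] [GrAlgebra k C'] [Ring D] [Algebra k D] [GrAlgebra k D]
  [Ring D'] [Algebra k D'] [GrAlgebra k D'] [Ring E] [Algebra k E] [GrAlgebra k E]

open TwTensor

/-- Here `x` is any homogeneous element of `C ⊗̃ D`, possibly a sum of products of generators. The
generators `ε(x; H)` of `(C ⊗̃ D) ⊗̃ E` involve all such `x`, so the explicit formulas for `x = 1 ⊗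
g` and `x = ε(f; G)` do not cover them directly. -/
theorem assoc_eps (x : Hm k (TwTensor k C D)) (H : List (Hm k E)) :
    assoc k C D E (eps x H) = lift (assocData k C D E) x.val H := desc_eps _ _ x H

/-- Naturality of the adjoint of the associator. Working with the adjoint pays off because both
sides are multiplicative in `x` for the cup product, which reduces the claim to generators of `C ⊗̃
D`. -/
theorem postA_lift_assocData (f : GrHom k C C') (g : GrHom k D D') (x : TwTensor k C D) :
    Conv.postA (map f (map g (GrHom.id k E))) (lift (assocData k C D E) x) =
      lift (assocData k C' D' E) (map f g x) := by
  -- The left side is a morphism of algebras because postcomposition with a morphism of graded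
  -- algebras respects cup products, the signs included.
  refine DFunLike.congr_fun (algHom_ext
    (f := (Conv.postA (map f (map g (GrHom.id k E)))).comp (lift (assocData k C D E)))
    (g := (lift (assocData k C' D' E)).comp (map f g).toAlgHom) (fun y => ?_) (fun y G => ?_)) x
  · change Conv.postA _ (lift _ (right C y)) = lift _ (map f g (right C y))
    rw [map_right, lift_right, lift_right]
    ext H
    -- At `1 ⊗ y` the two functions are `H ↦ (f ⊗̃ (g ⊗̃ id)) (1 ⊗ ε(y; H))` and `H ↦ 1 ⊗ ε(g y;
    -- H)`.
    have h := map_right f (map g (GrHom.id k E)) (epsHm y H)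
    rw [← inr_val, ← inr_val, epsHm_map] at h
    exact h
  · change Conv.postA _ (lift _ (eps y G)) = lift _ (map f g (eps y G))
    rw [map_eps, lift_eps, lift_eps]
    change Conv.postA _ (ins G (eps y)) = ins (G.map (Hm.map g)) (eps (y.map f))
    -- The morphism on values moves inside the insertion, and `g` moves from the inserted letters to
    -- the function on words. Left to compare are `ε(y; -)` followed by `f ⊗̃ (g ⊗̃ id)` and `ε(f y;
    -- -)` preceded by `g ⊗̃ id`, which agree by functoriality.
    rw [postA_ins, ← ins_pre]
    exact congrArg (ins G) (Conv.ext fun L => map_eps _ _ _ _)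

/-- Naturality of the associator in the first two variables. -/
theorem assoc_natural (f : GrHom k C C') (g : GrHom k D D')
    (x : TwTensor k (TwTensor k C D) E) :
    assoc k C' D' E (map (map f g) (GrHom.id k E) x) =
      map f (map g (GrHom.id k E)) (assoc k C D E x) := by
  refine grHom_ext (f := (assoc k C' D' E).comp (map (map f g) (GrHom.id k E)))
    (g := (map f (map g (GrHom.id k E))).comp (assoc k C D E)) (fun y => ?_) (fun y L => ?_) x
  · change assoc k C' D' E (map _ _ (right _ y)) = map _ _ (assoc k C D E (right _ y))
    rw [map_right, assoc_right, assoc_right]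
    -- Both composites send `1 ⊗ y` to `1 ⊗ (1 ⊗ y)`; for the right-hand one, `f ⊗̃ (g ⊗̃ id)` is
    -- evaluated at `1 ⊗ z` with `z = 1 ⊗ y` in `D ⊗̃ E`.
    have h := map_right f (map g (GrHom.id k E)) (y.map (inrG k D E))
    rw [← inr_val, ← inr_val, map_inrG] at h
    exact h.symm
  · change assoc k C' D' E (map _ _ (eps y L)) = map _ _ (assoc k C D E (eps y L))
    -- On `ε(y; L)` both sides are values on `L` of adjoints, so naturality of the adjoint applies
    -- to `y` as a whole and `y` need not be decomposed.
    rw [map_eps, assoc_eps, assoc_eps, map_hm_id, Hm.map_val, ← postA_lift_assocData]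
    rfl

end assocNaturality

/-! ### Evaluation, the product of `Hoch(A)`, and the adjoint of `ℓ`. -/

section action
variable {k A B : Type*} [Field k] [Ring A] [Algebra k A] [DGAlgebra k A]
  [Ring B] [Algebra k B] [DGAlgebra k B]

open TwTensor

/-- A morphism `B ⊗̃ A → A` that restricts to the identity of `A` is recovered from its adjoint. -/
theorem evalHoch_map_adj (ℓ : DGHom k (TwTensor k B A) A) (hℓ : ∀ a : A, ℓ (inr k B A a) = a)
    (x : TwTensor k B A) :
    evalHoch k A (map (adjDG (DGHom.id k A) ℓ hℓ).toGrHom (GrHom.id k A) x) = ℓ x := by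
  refine grHom_ext (f := (evalHoch k A).comp
    (map (adjDG (DGHom.id k A) ℓ hℓ).toGrHom (GrHom.id k A))) (g := ℓ.toGrHom)
    (fun y => ?_) (fun y L => ?_) x
  · change evalHoch k A (map _ _ (right _ y)) = ℓ (right _ y)
    -- The evaluation was built from the identity of `A`, so it sends `1 ⊗ y` to `y`; the hypothesis
    -- `hℓ` says the same of `ℓ`.
    rw [map_right, right_eq y, hℓ]
    exact desc_right _ _ _
  · change evalHoch k A (map _ _ (eps y L)) = ℓ (eps y L)
    rw [map_eps, map_hm_id]
    -- Evaluation of a cochain `c` at `L` is its value there, and for `c = φ y` this value is `ℓ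
    -- (ε(y; L))`.
    exact (desc_eps _ _ _ _).trans (adj_val ℓ.toGrHom y L)

/-- With `φ` the adjoint of `ℓ` and `e` the evaluation, this is `e ∘ (φ ⊗̃ id) = ℓ` used twice: once
in the second factor, where `e ∘ (φ ⊗̃ id)` becomes `ℓ`, and once on the outside. It treats the part
of the definition of the product of `Hoch(A)` that comes after the associator. -/
theorem evalHoch_map_adj_map (ℓ : DGHom k (TwTensor k B A) A)
    (hℓ : ∀ a : A, ℓ (inr k B A a) = a) (x : TwTensor k B (TwTensor k B A)) :
    evalHoch k A (map (GrHom.id k (Hoch (DGHom.id k A))) (evalHoch k A)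
      (map (adjDG (DGHom.id k A) ℓ hℓ).toGrHom
        (map (adjDG (DGHom.id k A) ℓ hℓ).toGrHom (GrHom.id k A)) x)) =
      ℓ (map (GrHom.id k B) ℓ.toGrHom x) := by
  -- The outer `ℓ` on the right is expanded as `e ∘ (φ ⊗̃ id)`. Both sides are then `e` after a
  -- single morphism `φ ⊗̃ _`, and only the second factors differ.
  rw [← evalHoch_map_adj ℓ hℓ, map_map, map_map]
  have h : ((evalHoch k A).comp (map (adjDG (DGHom.id k A) ℓ hℓ).toGrHom (GrHom.id k A))) =
      (GrHom.id k A).comp ℓ.toGrHom := by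
    -- The morphism occurs as an argument of `map`, so an equality of bundled morphisms is required,
    -- not only of their values. Preservation of degrees is a proposition, hence the underlying
    -- algebra morphism suffices.
    have : ∀ {f g : GrHom k (TwTensor k B A) A}, f.toAlgHom = g.toAlgHom → f = g := by
      rintro ⟨f, _⟩ ⟨g, _⟩ h
      congr
    exact this (AlgHom.ext (evalHoch_map_adj ℓ hℓ))
  rw [h]
  -- The remaining difference is `id ∘ φ` against `φ ∘ id` in the first factor.
  rfl

/-- The product of `Hoch(A)`, restricted along the adjoint of `ℓ`, is the adjoint of
`ℓ ∘ (id ⊗̃ ℓ) ∘ α`. -/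
theorem hochMul_map_adj (ℓ : DGHom k (TwTensor k B A) A) (hℓ : ∀ a : A, ℓ (inr k B A a) = a)
    (x : TwTensor k B B) :
    hochMul k A (map (adjDG (DGHom.id k A) ℓ hℓ).toGrHom (adjDG (DGHom.id k A) ℓ hℓ).toGrHom x) =
      adj (ℓ.toGrHom.comp ((map (GrHom.id k B) ℓ.toGrHom).comp (assoc k B B A))) x := by
  -- `hochMul` is itself an adjoint, so precomposing it with `φ ⊗̃ φ` amounts to precomposing the
  -- original morphism with `(φ ⊗̃ φ) ⊗̃ id`.
  refine (adj_comp_map_id _ (map (adjDG (DGHom.id k A) ℓ hℓ).toGrHom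
    (adjDG (DGHom.id k A) ℓ hℓ).toGrHom) x).symm.trans ?_
  refine Cochains.val_injective k A A (Conv.ext fun L => ?_)
  -- Values of adjoints unfold to values at `epsA x L`, for arbitrary `x` in `B ⊗̃ B`.
  change evalHoch k A (map (GrHom.id k _) (evalHoch k A) (assoc k _ _ A
    (map (map _ _) (GrHom.id k A) (epsA k _ A x L)))) = ℓ (map _ _ (assoc k B B A _))
  -- The associator moves to the right of `(φ ⊗̃ φ) ⊗̃ id`, which turns into `φ ⊗̃ (φ ⊗̃ id)` and
  -- meets the two evaluations.
  rw [assoc_natural]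
  exact evalHoch_map_adj_map ℓ hℓ _

end action

end TwDG


/-! ### The equivalence between actions on `A` and monoid maps to `Hoch(A)`. -/

theorem corollary2p5 {k A B : Type*} [Field k]
    [Ring A] [Algebra k A] [TwDG.DGAlgebra k A]
    [Ring B] [Algebra k B] [TwDG.DGAlgebra k B]
    (μ : TwDG.TwMonoid k B) (ℓ : TwDG.DGHom k (TwDG.TwTensor k B A) A)
    (hℓ : ∀ a : A, ℓ (TwDG.TwTensor.inr k B A a) = a) :
    TwDG.IsAction μ ℓ ↔ TwDG.IsMonoidMap μ (TwDG.adjDG (TwDG.DGHom.id k A) ℓ hℓ) := by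
  -- The two sides of the action law agree on `1 ⊗ y`: the left one gives `ℓ (1 ⊗ y) = y`, the right
  -- one `ℓ (1 ⊗ ℓ (1 ⊗ y)) = y`. This is the assumption of `eq_iff_adj_eq`.
  have hr : ∀ y : TwDG.Hm k A,
      (ℓ.toGrHom.comp (TwDG.TwTensor.map μ.mul.toGrHom (TwDG.GrHom.id k A)))
        (TwDG.TwTensor.right _ y) =
      (ℓ.toGrHom.comp ((TwDG.TwTensor.map (TwDG.GrHom.id k B) ℓ.toGrHom).comp
        (TwDG.assoc k B B A))) (TwDG.TwTensor.right _ y) := fun y => by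
    change ℓ (TwDG.TwTensor.map _ _ (TwDG.TwTensor.right _ y)) =
      ℓ (TwDG.TwTensor.map _ _ (TwDG.assoc k B B A (TwDG.TwTensor.right _ y)))
    have h := TwDG.TwTensor.map_right (TwDG.GrHom.id k B) ℓ.toGrHom
      (y.map (TwDG.TwTensor.inrG k B A))
    rw [TwDG.TwTensor.right_eq, TwDG.TwTensor.right_eq] at h
    rw [TwDG.TwTensor.map_right, TwDG.assoc_right, TwDG.TwTensor.right_eq, hℓ]
    refine Eq.trans ?_ (congrArg ℓ.toAlgHom h).symm
    -- `hℓ` serves once for the outer and once for the inner `ℓ`.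
    exact ((hℓ _).trans (hℓ y.val)).symm
  -- The action law is now the equality of the adjoints of `ℓ ∘ (m ⊗̃ id)` and `ℓ ∘ (id ⊗̃ ℓ) ∘ α`.
  -- In both directions below, `adj_comp_map_id` identifies the former with `φ ∘ m` and
  -- `hochMul_map_adj` the latter with `M ∘ (φ ⊗̃ φ)`.
  have key := TwDG.TwTensor.eq_iff_adj_eq hr
  constructor
  · intro h
    -- The unit condition is part of being a morphism of algebras.
    refine ⟨fun x => ?_, map_one (TwDG.adjDG (TwDG.DGHom.id k A) ℓ hℓ).toAlgHom⟩
    rw [TwDG.hochMul_map_adj]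
    exact (TwDG.TwTensor.adj_comp_map_id ℓ.toGrHom μ.mul.toGrHom x).symm.trans
      (key.mp h.mul_act x)
  · intro h
    -- The unit law of the action is the hypothesis `hℓ` itself.
    refine ⟨key.mpr fun x => ?_, hℓ⟩
    refine (TwDG.TwTensor.adj_comp_map_id ℓ.toGrHom μ.mul.toGrHom x).trans ?_
    exact (h.map_mul x).trans (TwDG.hochMul_map_adj ℓ hℓ x)
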